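/- Let $G$ be a finite group and let $\mathsf{Hilb}_G$ be the unitary fusion category of finite-dimensional $G$-graded Hilbert spaces. A Q-system in $\mathsf{Hilb}_G$ is a unital associative algebra $(A,m,\iota)$ in $\mathsf{Hilb}_G$ with $m m^\dagger=\mathrm{id}_A$ that satisfies the Frobenius condition and for which $\mathrm{ev}=\iota^\dagger m$, $\mathrm{coev}=m^\dagger\iota$ is a balanced dual, i.e. $\mathrm{ev}(\mathrm{id}\otimes f)\mathrm{ev}^\dagger=\mathrm{coev}^\dagger(f\otimes\mathrm{id})\mathrm{coev}$ for all endomorphisms $f$ of $A$ in $\mathsf{Hilb}_G$. Two Q-systems $A,B$ are Morita equivalent if there are an $A$-$B$-bimodule $M$ and a $B$-$A$-bimodule $N$ in $\mathsf{Hilb}_G$ (with partially isometric actions) such that $M\otimes_B N\cong A$ and $N\otimes_A M\cong B$ as bimodules. For a subgroup $H\le G$ and a normalized 2-cocycle $\psi:H\times H\to U(1)$, $\mathbb C^\psi[H]$ is the Q-system with orthonormal basis $H$, each $h\in H$ having degree $h$, multiplication $h\otimes k\mapsto |H|^{-1/2}\psi(h,k)\,hk$ and unit $|H|^{1/2}e$.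 The charge category of the symmetry $\mathsf{Rep}^\dagger(G)$ (with its forgetful fiber functor) is $\mathsf{Hilb}_G$; the $\mathsf{Rep}^\dagger(G)$ SPT phases are understood as the Morita classes of Q-systems in $\mathsf{Hilb}_G$ whose underlying algebra (the grading being forgotten) is a matrix algebra $M_n(\mathbb C)$, $n\ge1$. (1) Let $D_8=\langle s,r\mid s^2=r^4=e,\ srs=r^{-1}\rangle$, $A_0=\mathbb C_e$, $A_1=\mathbb C^\omega\langle r^2,s\rangle$ and $A_2=\mathbb C^\omega\langle r^2,sr\rangle$, where $\omega(a^ib^j,a^{i'}b^{j'})=(-1)^{j i'}$ with $a=r^2$ and $b=s$, respectively $b=sr$. The underlying algebras of $A_0,A_1,A_2$ are matrix algebras, the three Q-systems are pairwise not Morita equivalent, and every Q-system in $\mathsf{Hilb}_{D_8}$ whose underlying algebra is a matrix algebra is Morita equivalent to one of them. Hence there are exactly three $\mathsf{Rep}^\dagger(D_8)$ SPT phases. (2) Let $\mathbb Z_3\times\mathbb Z_3\le S_3\times\mathbb Z_3$ be the subgroup generated by a 3-cycle of $S_3$ and the factor $\mathbb Z_3$, let $\psi_\pm(g,h)=e^{\pm\frac{2\pi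 i}{3}g_2h_1}$, and let $A_\pm=\mathbb C^{\psi_\pm}[\mathbb Z_3\times\mathbb Z_3]$. In $\mathsf{Hilb}_{S_3\times\mathbb Z_3}$ the underlying algebras of $\mathbb C_e,A_+,A_-$ are matrix algebras, $A_+$ and $A_-$ are Morita equivalent, $\mathbb C_e$ and $A_+$ are not Morita equivalent, and every Q-system whose underlying algebra is a matrix algebra is Morita equivalent to $\mathbb C_e$ or to $A_+$. Hence there are exactly two $\mathsf{Rep}^\dagger(S_3\times\mathbb Z_3)$ SPT phases. -/

import Mathlib

open scoped TensorProduct ComplexConjugate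

/-! ### The unitary fusion category of finite-dimensional graded Hilbert spaces -/

/-- A finite-dimensional `G`-graded Hilbert space, i.e. an object of `Hilb_G`: a
finite-dimensional Hilbert space which is the orthogonal direct sum of subspaces `deg g`. -/
structure GradedHilb (G : Type) [Group G] where
  carrier : Type
  [normedAddCommGroup : NormedAddCommGroup carrier]
  [innerProductSpace : InnerProductSpace ℂ carrier]
  [finiteDimensional : FiniteDimensional ℂ carrier]
  deg : G → Submodule ℂ carrier
  orthogonal : ∀ g h : G, g ≠ h → deg g ⟂ deg h
  iSup_deg : ⨆ g, deg g = ⊤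

namespace GradedHilb

attribute [instance] GradedHilb.normedAddCommGroup GradedHilb.innerProductSpace
  GradedHilb.finiteDimensional

variable {G : Type} [Group G]

instance : CoeSort (GradedHilb G) Type := ⟨GradedHilb.carrier⟩

/-- Morphisms of `Hilb_G`: linear maps that preserve the grading. -/
def IsGraded {V W : GradedHilb G} (f : V →ₗ[ℂ] W) : Prop :=
  ∀ g : G, ∀ v ∈ V.deg g, f v ∈ W.deg g

/-- A linear map out of `V ⊗ W` preserves the grading, where
`(V ⊗ W)_k = ⨁_{gh = k} V_g ⊗ W_h`. -/
def IsGradedTensor {V W X : GradedHilb G} (f : V ⊗[ℂ] W →ₗ[ℂ] X) : Prop :=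
  ∀ g h : G, ∀ v ∈ V.deg g, ∀ w ∈ W.deg h, f (v ⊗ₜ[ℂ] w) ∈ X.deg (g * h)

end GradedHilb

/-! ### Q-systems -/

/-- A Q-system `(A, m, ι)` in `Hilb_G`: a unital associative algebra in `Hilb_G` whose
multiplication satisfies `m m† = id` and the Frobenius condition, and for which
`ev = ι† m`, `coev = m† ι` is a balanced dual of `A`, that is
`ev (id ⊗ f) ev† = coev† (f ⊗ id) coev` for every endomorphism `f` of `A` in `Hilb_G`.
(The zigzag identities for `ev` and `coev` follow from the Frobenius condition and the unit laws.) -/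
structure QSystem (G : Type) [Group G] where
  obj : GradedHilb G
  mul : obj ⊗[ℂ] obj →ₗ[ℂ] obj
  unit : ℂ →ₗ[ℂ] obj
  mul_graded : GradedHilb.IsGradedTensor mul
  unit_graded : ∀ z : ℂ, unit z ∈ obj.deg 1
  mul_assoc : mul ∘ₗ mul.rTensor obj =
    mul ∘ₗ mul.lTensor obj ∘ₗ (TensorProduct.assoc ℂ obj obj obj).toLinearMap
  unit_mul : mul ∘ₗ unit.rTensor obj = (TensorProduct.lid ℂ obj).toLinearMap
  mul_unit : mul ∘ₗ unit.lTensor obj = (TensorProduct.rid ℂ obj).toLinearMap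
  isometric : mul ∘ₗ LinearMap.adjoint mul = LinearMap.id
  frobenius_left : mul.lTensor obj ∘ₗ (TensorProduct.assoc ℂ obj obj obj).toLinearMap ∘ₗ
    (LinearMap.adjoint mul).rTensor obj = LinearMap.adjoint mul ∘ₗ mul
  frobenius_right : mul.rTensor obj ∘ₗ (TensorProduct.assoc ℂ obj obj obj).symm.toLinearMap ∘ₗ
    (LinearMap.adjoint mul).lTensor obj = LinearMap.adjoint mul ∘ₗ mul
  balanced : ∀ f : obj →ₗ[ℂ] obj, GradedHilb.IsGraded f →
    (LinearMap.adjoint unit ∘ₗ mul) ∘ₗ f.lTensor obj ∘ₗ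
        LinearMap.adjoint (LinearMap.adjoint unit ∘ₗ mul) =
      LinearMap.adjoint (LinearMap.adjoint mul ∘ₗ unit) ∘ₗ f.rTensor obj ∘ₗ
        (LinearMap.adjoint mul ∘ₗ unit)

namespace QSystem

variable {G : Type} [Group G]

/-- The underlying algebra of `A` (the grading being forgotten) is a matrix algebra `M_n(ℂ)`
with `n ≥ 1`. -/
def IsMatrixAlgebra (A : QSystem G) : Prop :=
  ∃ n : ℕ, 0 < n ∧ ∃ f : A.obj ≃ₗ[ℂ] Matrix (Fin n) (Fin n) ℂ,
    (∀ x y : A.obj, f (A.mul (x ⊗ₜ[ℂ] y)) = f x * f y) ∧ f (A.unit 1) = 1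

end QSystem

/-! ### Bimodules and Morita equivalence -/

/-- An `A`-`B`-bimodule in `Hilb_G` for Q-systems `A` and `B`, with partially isometric actions:
since the actions are surjective (by the unit laws) this means `l l† = id` and `r r† = id`. -/
structure QBimodule {G : Type} [Group G] (A B : QSystem G) where
  obj : GradedHilb G
  left : A.obj ⊗[ℂ] obj →ₗ[ℂ] obj
  right : obj ⊗[ℂ] B.obj →ₗ[ℂ] obj
  left_graded : GradedHilb.IsGradedTensor left
  right_graded : GradedHilb.IsGradedTensor right
  left_assoc : left ∘ₗ A.mul.rTensor obj =
    left ∘ₗ left.lTensor A.obj ∘ₗ (TensorProduct.assoc ℂ A.obj A.obj obj).toLinearMap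
  left_unit : left ∘ₗ A.unit.rTensor obj = (TensorProduct.lid ℂ obj).toLinearMap
  right_assoc : right ∘ₗ right.rTensor B.obj =
    right ∘ₗ B.mul.lTensor obj ∘ₗ (TensorProduct.assoc ℂ obj B.obj B.obj).toLinearMap
  right_unit : right ∘ₗ B.unit.lTensor obj = (TensorProduct.rid ℂ obj).toLinearMap
  left_right : right ∘ₗ left.rTensor B.obj =
    left ∘ₗ right.lTensor A.obj ∘ₗ (TensorProduct.assoc ℂ A.obj obj B.obj).toLinearMap
  left_isometric : left ∘ₗ LinearMap.adjoint left = LinearMap.id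
  right_isometric : right ∘ₗ LinearMap.adjoint right = LinearMap.id

namespace QBimodule

variable {G : Type} [Group G] {A B C : QSystem G}

/-- A Q-system as a bimodule over itself. -/
def regular (A : QSystem G) : QBimodule A A where
  obj := A.obj
  left := A.mul
  right := A.mul
  left_graded := A.mul_graded
  right_graded := A.mul_graded
  left_assoc := A.mul_assoc
  left_unit := A.unit_mul
  right_assoc := A.mul_assoc
  right_unit := A.mul_unit
  left_right := A.mul_assoc
  left_isometric := A.isometric
  right_isometric := A.isometric

/-- Isomorphism of bimodules in `Hilb_G`. (The inverse of a bijective grading-preserving linear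
map preserves the grading.) -/
def Isomorphic (M N : QBimodule A B) : Prop :=
  ∃ f : M.obj ≃ₗ[ℂ] N.obj, GradedHilb.IsGraded f.toLinearMap ∧
    f.toLinearMap ∘ₗ M.left = N.left ∘ₗ f.toLinearMap.lTensor A.obj ∧
    f.toLinearMap ∘ₗ M.right = N.right ∘ₗ f.toLinearMap.rTensor B.obj

/-- The projector `P_⊗` of `M ⊗ N` whose image is the relative tensor product over `B`:
`M ⊗ N → M ⊗ (B ⊗ B) ⊗ N → M ⊗ N`, where the first map inserts `m† ι` and the second one
lets the two factors act on `M` and `N`. -/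
noncomputable def relativeProjector (M : QBimodule A B) (N : QBimodule B C) :
    M.obj ⊗[ℂ] N.obj →ₗ[ℂ] M.obj ⊗[ℂ] N.obj :=
  TensorProduct.map M.right N.left ∘ₗ
    (TensorProduct.assoc ℂ M.obj B.obj (B.obj ⊗[ℂ] N.obj)).symm.toLinearMap ∘ₗ
    (TensorProduct.assoc ℂ B.obj B.obj N.obj).toLinearMap.lTensor M.obj ∘ₗ
    ((LinearMap.adjoint B.mul ∘ₗ B.unit).rTensor N.obj).lTensor M.obj ∘ₗ
    (TensorProduct.lid ℂ N.obj).symm.toLinearMap.lTensor M.obj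

/-- The `A`-`C`-bimodule `T` is the relative tensor product `M ⊗_B N`: the projector `P_⊗` splits
in `Hilb_G` as `P_⊗ = S† S` with `S S† = id` for some `S : M ⊗ N → T`, and the actions on `T`
are those induced through `S`. -/
def IsRelativeTensor (M : QBimodule A B) (N : QBimodule B C) (T : QBimodule A C) : Prop :=
  ∃ S : M.obj ⊗[ℂ] N.obj →ₗ[ℂ] T.obj, GradedHilb.IsGradedTensor S ∧
    LinearMap.adjoint S ∘ₗ S = relativeProjector M N ∧
    S ∘ₗ LinearMap.adjoint S = LinearMap.id ∧
    T.left = S ∘ₗ M.left.rTensor N.obj ∘ₗ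
      (TensorProduct.assoc ℂ A.obj M.obj N.obj).symm.toLinearMap ∘ₗ
      (LinearMap.adjoint S).lTensor A.obj ∧
    T.right = S ∘ₗ N.right.lTensor M.obj ∘ₗ
      (TensorProduct.assoc ℂ M.obj N.obj C.obj).toLinearMap ∘ₗ
      (LinearMap.adjoint S).rTensor C.obj

end QBimodule

namespace QSystem

variable {G : Type} [Group G]

/-- Morita equivalence of Q-systems in `Hilb_G`: there are an `A`-`B`-bimodule `M` and a
`B`-`A`-bimodule `N` with `M ⊗_B N ≅ A` and `N ⊗_A M ≅ B` as bimodules. -/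
def Morita (A B : QSystem G) : Prop :=
  ∃ (M : QBimodule A B) (N : QBimodule B A) (T : QBimodule A A) (T' : QBimodule B B),
    QBimodule.IsRelativeTensor M N T ∧ QBimodule.Isomorphic T (QBimodule.regular A) ∧
    QBimodule.IsRelativeTensor N M T' ∧ QBimodule.Isomorphic T' (QBimodule.regular B)

end QSystem

/-- The `Rep†(G)` SPT phases: the charge category of the symmetry `Rep†(G)` with its forgetful
fiber functor is `Hilb_G`, and the phases are the Morita classes of the Q-systems in `Hilb_G`
whose underlying algebra is a matrix algebra. -/
def RepSPTPhase (G : Type) [Group G] : Type 1 :=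
  Quot fun A B : {A : QSystem G // A.IsMatrixAlgebra} => A.1.Morita B.1

/-! ### Twisted group algebras -/

/-- Normalized `U(1)`-valued 2-cocycles on a group. -/
structure TwoCocycle (K : Type) [Group K] where
  toFun : K → K → ℂ
  norm_eq_one : ∀ g h, ‖toFun g h‖ = 1
  one_left : ∀ g, toFun 1 g = 1
  one_right : ∀ g, toFun g 1 = 1
  cocycle : ∀ g h k, toFun g h * toFun (g * h) k = toFun h k * toFun g (h * k)

namespace TwistedGroupAlgebra

set_option linter.unusedSectionVars false

variable {G K : Type} [Group G] [Group K] [Fintype K] [DecidableEq K]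

/-- The Hilbert space with orthonormal basis `K`, the basis vector `x` having degree `φ x`. -/
noncomputable def gradedHilb (φ : K →* G) : GradedHilb G where
  carrier := EuclideanSpace ℂ K
  deg g :=
    { carrier := {v | ∀ x, φ x ≠ g → v x = 0}
      add_mem' := by
        intro v w hv hw x hx
        simp [hv x hx, hw x hx]
      zero_mem' := by intro x _; simp
      smul_mem' := by
        intro c v hv x hx
        simp [hv x hx] }
  orthogonal := by
    intro g h hgh
    rw [Submodule.isOrtho_iff_inner_eq]
    intro v hv w hw
    rw [PiLp.inner_apply]
    refine Finset.sum_eq_zero fun x _ => ?_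
    by_cases hx : φ x = g
    · have : w x = 0 := hw x (by rw [hx]; exact hgh)
      simp [this]
    · have : v x = 0 := hv x hx
      simp [this]
  iSup_deg := by
    rw [eq_top_iff]
    intro v _
    rw [← (EuclideanSpace.basisFun K ℂ).sum_repr v]
    refine Submodule.sum_mem _ fun x _ => Submodule.smul_mem _ _ ?_
    refine Submodule.mem_iSup_of_mem (φ x) ?_
    intro y hy
    have : y ≠ x := fun h => hy (by rw [h])
    simp [this]

/-- The basis vector `x`. -/
noncomputable def e (x : K) : EuclideanSpace ℂ K := EuclideanSpace.single x 1

/-- The multiplication `x ⊗ y ↦ |K|^{-1/2} ψ(x, y) xy`. -/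
noncomputable def mul (ψ : TwoCocycle K) :
    EuclideanSpace ℂ K ⊗[ℂ] EuclideanSpace ℂ K →ₗ[ℂ] EuclideanSpace ℂ K :=
  ((EuclideanSpace.basisFun K ℂ).toBasis.tensorProduct
    (EuclideanSpace.basisFun K ℂ).toBasis).constr ℂ
    fun p => ((Real.sqrt (Fintype.card K) : ℂ)⁻¹ * ψ.toFun p.1 p.2) • e (p.1 * p.2)

/-- The unit `1 ↦ |K|^{1/2} e`. -/
noncomputable def unit : ℂ →ₗ[ℂ] EuclideanSpace ℂ K :=
  LinearMap.toSpanSingleton ℂ _ ((Real.sqrt (Fintype.card K) : ℂ) • e 1)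

/-- The adjoint of the multiplication: `z ↦ |K|^{-1/2} ∑_{x} conj ψ(x, x⁻¹z) x ⊗ x⁻¹z`. -/
noncomputable def comul (ψ : TwoCocycle K) :
    EuclideanSpace ℂ K →ₗ[ℂ] EuclideanSpace ℂ K ⊗[ℂ] EuclideanSpace ℂ K :=
  (EuclideanSpace.basisFun K ℂ).toBasis.constr ℂ
    fun z => ∑ x : K, ((Real.sqrt (Fintype.card K) : ℂ)⁻¹ * conj (ψ.toFun x (x⁻¹ * z))) •
      (e x ⊗ₜ[ℂ] e (x⁻¹ * z))

theorem ext_e {W : Type*} [AddCommGroup W] [Module ℂ W] {f g : EuclideanSpace ℂ K →ₗ[ℂ] W}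
    (h : ∀ x, f (e x) = g (e x)) : f = g :=
  (EuclideanSpace.basisFun K ℂ).toBasis.ext fun x => by simpa [e] using h x

theorem ext_e₂ {W : Type*} [AddCommGroup W] [Module ℂ W]
    {f g : EuclideanSpace ℂ K ⊗[ℂ] EuclideanSpace ℂ K →ₗ[ℂ] W}
    (h : ∀ x y, f (e x ⊗ₜ e y) = g (e x ⊗ₜ e y)) : f = g :=
  TensorProduct.ext (ext_e fun x => ext_e fun y => h x y)

theorem ext_e₃ {W : Type*} [AddCommGroup W] [Module ℂ W]
    {f g : (EuclideanSpace ℂ K ⊗[ℂ] EuclideanSpace ℂ K) ⊗[ℂ] EuclideanSpace ℂ K →ₗ[ℂ] W}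
    (h : ∀ x y z, f ((e x ⊗ₜ e y) ⊗ₜ e z) = g ((e x ⊗ₜ e y) ⊗ₜ e z)) : f = g :=
  TensorProduct.ext (ext_e₂ fun x y => ext_e fun z => h x y z)

theorem mul_e (ψ : TwoCocycle K) (x y : K) : mul ψ (e x ⊗ₜ e y) =
    ((Real.sqrt (Fintype.card K) : ℂ)⁻¹ * ψ.toFun x y) • e (x * y) := by
  have := ((EuclideanSpace.basisFun K ℂ).toBasis.tensorProduct
    (EuclideanSpace.basisFun K ℂ).toBasis).constr_basis ℂ
    (fun p => ((Real.sqrt (Fintype.card K) : ℂ)⁻¹ * ψ.toFun p.1 p.2) • e (p.1 * p.2)) (x, y)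
  simpa [mul, e] using this

theorem comul_e (ψ : TwoCocycle K) (z : K) : comul ψ (e z) =
    ∑ x : K, ((Real.sqrt (Fintype.card K) : ℂ)⁻¹ * conj (ψ.toFun x (x⁻¹ * z))) •
      (e x ⊗ₜ[ℂ] e (x⁻¹ * z)) := by
  have := (EuclideanSpace.basisFun K ℂ).toBasis.constr_basis ℂ
    (fun z => ∑ x : K, ((Real.sqrt (Fintype.card K) : ℂ)⁻¹ * conj (ψ.toFun x (x⁻¹ * z))) •
      ((e x : EuclideanSpace ℂ K) ⊗ₜ[ℂ] (e (x⁻¹ * z) : EuclideanSpace ℂ K))) z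
  rw [OrthonormalBasis.coe_toBasis, EuclideanSpace.basisFun_apply] at this
  exact this

theorem inner_e (x y : K) : inner ℂ (e x : EuclideanSpace ℂ K) (e y) = if x = y then 1 else 0 := by
  simp [e, EuclideanSpace.inner_single_left]

theorem inner_smul_tensor (c : ℂ) (u v : EuclideanSpace ℂ K ⊗[ℂ] EuclideanSpace ℂ K) :
    inner ℂ (c • u) v = conj c * inner ℂ u v := inner_smul_left u v c

theorem adjoint_mul (ψ : TwoCocycle K) : LinearMap.adjoint (mul ψ) = comul ψ := by
  symm
  rw [LinearMap.eq_adjoint_iff_basis (EuclideanSpace.basisFun K ℂ).toBasis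
    ((EuclideanSpace.basisFun K ℂ).toBasis.tensorProduct (EuclideanSpace.basisFun K ℂ).toBasis)]
  rintro z ⟨x, y⟩
  have h1 : (EuclideanSpace.basisFun K ℂ).toBasis z = e z := by simp [e]
  have h2 : ((EuclideanSpace.basisFun K ℂ).toBasis.tensorProduct
      (EuclideanSpace.basisFun K ℂ).toBasis) (x, y) = e x ⊗ₜ[ℂ] e y := by simp [e]
  rw [h1, h2, comul_e, mul_e, sum_inner, inner_smul_right, inner_e]
  rw [Finset.sum_eq_single x]
  · refine (inner_smul_tensor _ _ _).trans ?_
    rw [TensorProduct.inner_tmul, inner_e, inner_e]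
    by_cases h : z = x * y
    · subst h; simp
    · have h' : ¬ x⁻¹ * z = y := fun h' => h (by rw [← h']; group)
      simp [h, h']
  · intro w _ hw
    refine (inner_smul_tensor _ _ _).trans ?_
    rw [TensorProduct.inner_tmul, inner_e, if_neg hw]
    simp
  · simp

theorem mul_apply (ψ : TwoCocycle K) (v w : EuclideanSpace ℂ K) (z : K) :
    mul ψ (v ⊗ₜ w) z = (Real.sqrt (Fintype.card K) : ℂ)⁻¹ *
      ∑ x : K, ψ.toFun x (x⁻¹ * z) * v x * w (x⁻¹ * z) := by
  have h0 : ∀ (u : EuclideanSpace ℂ K) y, inner ℂ (e y) u = u y := by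
    intro u y; simp [e, EuclideanSpace.inner_single_left]
  rw [← h0, ← LinearMap.adjoint_inner_left, adjoint_mul, comul_e, sum_inner, Finset.mul_sum]
  refine Finset.sum_congr rfl fun x _ => (inner_smul_tensor _ _ _).trans ?_
  rw [TensorProduct.inner_tmul, h0, h0]
  simp
  ring

theorem mul_graded (φ : K →* G) (ψ : TwoCocycle K) (g h : G) (v w : EuclideanSpace ℂ K)
    (hv : ∀ x, φ x ≠ g → v x = 0) (hw : ∀ x, φ x ≠ h → w x = 0) (z : K) (hz : φ z ≠ g * h) :
    mul ψ (v ⊗ₜ w) z = 0 := by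
  rw [mul_apply]
  refine mul_eq_zero_of_right _ (Finset.sum_eq_zero fun x _ => ?_)
  by_cases hx : φ x = g
  · have : w (x⁻¹ * z) = 0 := hw _ fun h' => hz (by
      rw [← hx, ← h', ← map_mul, mul_inv_cancel_left])
    rw [this, mul_zero]
  · have : v x = 0 := hv x hx
    rw [this, mul_zero, zero_mul]

theorem unit_graded (φ : K →* G) (z : ℂ) (x : K) (hx : φ x ≠ 1) : unit (K := K) z x = 0 := by
  have : x ≠ 1 := fun h => hx (by rw [h, map_one])
  simp [unit, e, this]

theorem sqrt_card_ne_zero : ((Real.sqrt (Fintype.card K) : ℝ) : ℂ) ≠ 0 := by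
  have : 0 < (Fintype.card K : ℝ) := by exact_mod_cast Fintype.card_pos
  exact_mod_cast (Real.sqrt_pos.mpr this).ne'

theorem sqrt_card_mul_self :
    ((Real.sqrt (Fintype.card K) : ℝ) : ℂ) * ((Real.sqrt (Fintype.card K) : ℝ) : ℂ) =
      Fintype.card K := by
  rw [← Complex.ofReal_mul, Real.mul_self_sqrt (by positivity)]
  simp

theorem conj_mul_self (ψ : TwoCocycle K) (x y : K) : conj (ψ.toFun x y) * ψ.toFun x y = 1 := by
  rw [Complex.conj_mul', ψ.norm_eq_one]; simp

theorem unit_one : unit (1 : ℂ) = (Real.sqrt (Fintype.card K) : ℂ) • (e 1 : EuclideanSpace ℂ K) := by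
  simp [unit]

theorem mul_comp_comul (ψ : TwoCocycle K) : mul ψ ∘ₗ comul ψ = LinearMap.id := by
  refine ext_e fun z => ?_
  simp only [LinearMap.comp_apply, comul_e, map_sum, map_smul, mul_e, LinearMap.id_apply, smul_smul]
  have : ∀ x : K, (((Real.sqrt (Fintype.card K) : ℂ)⁻¹ * conj (ψ.toFun x (x⁻¹ * z))) *
      ((Real.sqrt (Fintype.card K) : ℂ)⁻¹ * ψ.toFun x (x⁻¹ * z))) • e (x * (x⁻¹ * z)) =
      ((Fintype.card K : ℂ)⁻¹) • e z := by
    intro x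
    rw [mul_inv_cancel_left]
    congr 1
    rw [← sqrt_card_mul_self (K := K), mul_inv]
    linear_combination ((Real.sqrt (Fintype.card K) : ℂ)⁻¹ * (Real.sqrt (Fintype.card K) : ℂ)⁻¹) *
      conj_mul_self ψ x (x⁻¹ * z)
  rw [Finset.sum_congr rfl fun x _ => this x, Finset.sum_const, Finset.card_univ,
    ← Nat.cast_smul_eq_nsmul ℂ, smul_smul, mul_inv_cancel₀, one_smul]
  exact_mod_cast Fintype.card_ne_zero

theorem mul_assoc_e (ψ : TwoCocycle K) : mul ψ ∘ₗ (mul ψ).rTensor _ =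
    mul ψ ∘ₗ (mul ψ).lTensor _ ∘ₗ (TensorProduct.assoc ℂ _ _ _).toLinearMap := by
  refine ext_e₃ fun x y z => ?_
  simp only [LinearMap.comp_apply, LinearMap.rTensor_tmul, LinearEquiv.coe_coe,
    TensorProduct.assoc_tmul, LinearMap.lTensor_tmul, mul_e, ← TensorProduct.smul_tmul',
    TensorProduct.tmul_smul, map_smul, smul_smul, mul_assoc]
  congr 1
  linear_combination (Real.sqrt (Fintype.card K) : ℂ)⁻¹ * (Real.sqrt (Fintype.card K) : ℂ)⁻¹ *
    ψ.cocycle x y z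

theorem unit_mul_e (ψ : TwoCocycle K) :
    mul ψ ∘ₗ unit.rTensor _ = (TensorProduct.lid ℂ _).toLinearMap := by
  refine TensorProduct.ext (LinearMap.ext_ring (ext_e fun x => ?_))
  have h := sqrt_card_ne_zero (K := K)
  change mul ψ (unit 1 ⊗ₜ e x) = TensorProduct.lid ℂ _ (1 ⊗ₜ e x)
  simp only [unit_one,
    ← TensorProduct.smul_tmul', map_smul, mul_e, smul_smul, ψ.one_left, mul_one,
    mul_inv_cancel₀ h, one_smul, one_mul, TensorProduct.lid_tmul]

theorem mul_unit_e (ψ : TwoCocycle K) :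
    mul ψ ∘ₗ unit.lTensor _ = (TensorProduct.rid ℂ _).toLinearMap := by
  refine TensorProduct.ext (ext_e fun x => LinearMap.ext_ring ?_)
  have h := sqrt_card_ne_zero (K := K)
  change mul ψ (e x ⊗ₜ unit 1) = TensorProduct.rid ℂ _ (e x ⊗ₜ 1)
  simp only [unit_one,
    TensorProduct.tmul_smul, map_smul, mul_e, smul_smul, ψ.one_right, mul_one,
    mul_inv_cancel₀ h, one_smul, TensorProduct.rid_tmul]

theorem frobenius_left_e (ψ : TwoCocycle K) : (mul ψ).lTensor _ ∘ₗ
    (TensorProduct.assoc ℂ _ _ _).toLinearMap ∘ₗ (comul ψ).rTensor _ = comul ψ ∘ₗ mul ψ := by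
  refine ext_e₂ fun x y => ?_
  simp only [LinearMap.comp_apply, LinearMap.rTensor_tmul, comul_e, TensorProduct.sum_tmul,
    map_sum, ← TensorProduct.smul_tmul', map_smul, LinearEquiv.coe_coe, TensorProduct.assoc_tmul,
    LinearMap.lTensor_tmul, mul_e, TensorProduct.tmul_smul, smul_smul, Finset.smul_sum]
  refine Finset.sum_congr rfl fun w _ => ?_
  rw [mul_assoc w⁻¹ x y]
  congr 1
  have h := ψ.cocycle w (w⁻¹ * x) y
  rw [mul_inv_cancel_left, mul_assoc w⁻¹ x y] at h
  have h1 := conj_mul_self ψ w (w⁻¹ * x)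
  have h2 := conj_mul_self ψ w (w⁻¹ * (x * y))
  linear_combination (Real.sqrt (Fintype.card K) : ℂ)⁻¹ * (Real.sqrt (Fintype.card K) : ℂ)⁻¹ *
    (ψ.toFun x y * conj (ψ.toFun w (w⁻¹ * (x * y))) * h1
      - conj (ψ.toFun w (w⁻¹ * x)) * conj (ψ.toFun w (w⁻¹ * (x * y))) * h
      - conj (ψ.toFun w (w⁻¹ * x)) * ψ.toFun (w⁻¹ * x) y * h2)

theorem frobenius_right_e (ψ : TwoCocycle K) : (mul ψ).rTensor _ ∘ₗ
    (TensorProduct.assoc ℂ _ _ _).symm.toLinearMap ∘ₗ (comul ψ).lTensor _ = comul ψ ∘ₗ mul ψ := by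
  refine ext_e₂ fun x y => ?_
  simp only [LinearMap.comp_apply, LinearMap.lTensor_tmul, comul_e, TensorProduct.tmul_sum,
    map_sum, TensorProduct.tmul_smul, map_smul, LinearEquiv.coe_coe, TensorProduct.assoc_symm_tmul,
    LinearMap.rTensor_tmul, mul_e, ← TensorProduct.smul_tmul', smul_smul, Finset.smul_sum]
  refine Fintype.sum_equiv (Equiv.mulLeft x) _ _ fun w => ?_
  have e1 : (x * w)⁻¹ * (x * y) = w⁻¹ * y := by group
  simp only [Equiv.coe_mulLeft, e1]
  congr 1
  have h := ψ.cocycle x w (w⁻¹ * y)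
  rw [mul_inv_cancel_left] at h
  have h1 := conj_mul_self ψ w (w⁻¹ * y)
  have h2 := conj_mul_self ψ (x * w) (w⁻¹ * y)
  linear_combination (Real.sqrt (Fintype.card K) : ℂ)⁻¹ * (Real.sqrt (Fintype.card K) : ℂ)⁻¹ *
    (ψ.toFun x y * conj (ψ.toFun (x * w) (w⁻¹ * y)) * h1
      + conj (ψ.toFun w (w⁻¹ * y)) * conj (ψ.toFun (x * w) (w⁻¹ * y)) * h
      - conj (ψ.toFun w (w⁻¹ * y)) * ψ.toFun x w * h2)

theorem adjoint_unit_apply (v : EuclideanSpace ℂ K) :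
    LinearMap.adjoint (unit (K := K)) v = (Real.sqrt (Fintype.card K) : ℂ) * v 1 := by
  have h := LinearMap.adjoint_inner_right (unit (K := K)) (1 : ℂ) v
  rw [unit_one, inner_smul_left, e, EuclideanSpace.inner_single_left] at h
  simpa using h

theorem balanced_e (ψ : TwoCocycle K) (f : EuclideanSpace ℂ K →ₗ[ℂ] EuclideanSpace ℂ K) :
    (LinearMap.adjoint unit ∘ₗ mul ψ) ∘ₗ f.lTensor _ ∘ₗ
        LinearMap.adjoint (LinearMap.adjoint unit ∘ₗ mul ψ) =
      LinearMap.adjoint (LinearMap.adjoint (mul ψ) ∘ₗ unit) ∘ₗ f.rTensor _ ∘ₗ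
        (LinearMap.adjoint (mul ψ) ∘ₗ unit) := by
  have key1 : ∀ (x : K) (v : EuclideanSpace ℂ K),
      (Real.sqrt (Fintype.card K) : ℂ) * (mul ψ (e x ⊗ₜ v)) 1 = ψ.toFun x x⁻¹ * v x⁻¹ := by
    intro x v
    have h := sqrt_card_ne_zero (K := K)
    rw [← (EuclideanSpace.basisFun K ℂ).sum_repr v]
    have : ∀ y, EuclideanSpace.basisFun K ℂ y = e y := by intro y; simp [e]
    simp only [this, TensorProduct.tmul_sum, TensorProduct.tmul_smul, map_sum, map_smul, mul_e]
    simp [e, Pi.single_apply, eq_comm (a := (1 : K)), mul_eq_one_iff_inv_eq,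
      eq_comm (a := (x⁻¹ : K))]
    field_simp
  have key2 : ∀ (x : K) (v : EuclideanSpace ℂ K),
      (Real.sqrt (Fintype.card K) : ℂ) * (mul ψ (v ⊗ₜ e x⁻¹)) 1 = ψ.toFun x x⁻¹ * v x := by
    intro x v
    have h := sqrt_card_ne_zero (K := K)
    rw [← (EuclideanSpace.basisFun K ℂ).sum_repr v]
    have : ∀ y, EuclideanSpace.basisFun K ℂ y = e y := by intro y; simp [e]
    simp only [this, TensorProduct.sum_tmul, ← TensorProduct.smul_tmul', map_sum, map_smul, mul_e]
    simp [e, Pi.single_apply, eq_comm (a := (1 : K)), mul_inv_eq_one,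
      eq_comm (a := (x : K))]
    field_simp
  rw [LinearMap.adjoint_comp, LinearMap.adjoint_comp, LinearMap.adjoint_adjoint,
    LinearMap.adjoint_adjoint, adjoint_mul]
  refine LinearMap.ext_ring ?_
  have h := sqrt_card_ne_zero (K := K)
  simp only [LinearMap.comp_apply, unit_one, map_smul, comul_e, map_sum, LinearMap.lTensor_tmul,
    LinearMap.rTensor_tmul, adjoint_unit_apply, key1, key2, mul_one]
  congr 1
  refine Fintype.sum_equiv (Equiv.inv K) _ _ fun x => ?_
  have h1 := conj_mul_self ψ x x⁻¹
  have h2 := conj_mul_self ψ x⁻¹ x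
  simp only [smul_eq_mul, Equiv.inv_apply, inv_inv]
  linear_combination (Real.sqrt (Fintype.card K) : ℂ)⁻¹ * (f (e x⁻¹)).ofLp x⁻¹ * (h1 - h2)

end TwistedGroupAlgebra

/-- The Q-system `ℂ^ψ[H]` in `Hilb_G`, where `H` is the image of the injective homomorphism
`φ : K → G`, `ψ` is a 2-cocycle on `K ≅ H`: it has an orthonormal basis indexed by `H`, each
`h ∈ H` having degree `h`, the multiplication `h ⊗ k ↦ |H|^{-1/2} ψ(h, k) hk` and
the unit `|H|^{1/2} e`. -/
noncomputable def twistedGroupAlgebra {G K : Type} [Group G] [Group K] [Fintype K] [DecidableEq K]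
    (φ : K →* G) (_hφ : Function.Injective φ) (ψ : TwoCocycle K) : QSystem G where
  obj := TwistedGroupAlgebra.gradedHilb φ
  mul := TwistedGroupAlgebra.mul ψ
  unit := TwistedGroupAlgebra.unit
  mul_graded := by
    intro g h v hv w hw
    exact TwistedGroupAlgebra.mul_graded φ ψ g h v w hv hw
  unit_graded := TwistedGroupAlgebra.unit_graded φ
  mul_assoc := TwistedGroupAlgebra.mul_assoc_e ψ
  unit_mul := TwistedGroupAlgebra.unit_mul_e ψ
  mul_unit := TwistedGroupAlgebra.mul_unit_e ψ
  isometric := by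
    have h := TwistedGroupAlgebra.mul_comp_comul ψ
    rw [← TwistedGroupAlgebra.adjoint_mul] at h
    exact h
  frobenius_left := by
    have h := TwistedGroupAlgebra.frobenius_left_e ψ
    rw [← TwistedGroupAlgebra.adjoint_mul] at h
    exact h
  frobenius_right := by
    have h := TwistedGroupAlgebra.frobenius_right_e ψ
    rw [← TwistedGroupAlgebra.adjoint_mul] at h
    exact h
  balanced := fun f _ => TwistedGroupAlgebra.balanced_e ψ f

/-! ### The Q-systems of the classification -/

/-- The 2-cocycle `ψ(g, h) = λ ^ (g₂ h₁)` on `ℤ_p × ℤ_p` (written multiplicatively), for a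
`p`-th root of unity `λ`. -/
noncomputable def bicharacterCocycle (p : ℕ) [NeZero p] (lam : ℂ) (hlam : lam ^ p = 1) :
    TwoCocycle (Multiplicative (ZMod p × ZMod p)) where
  toFun g h := lam ^ (g.toAdd.2.val * h.toAdd.1.val)
  norm_eq_one g h := by
    rw [norm_pow, Complex.norm_eq_one_of_pow_eq_one hlam (NeZero.ne p), one_pow]
  one_left g := by simp
  one_right g := by simp
  cocycle g h k := by
    have key : ∀ a b c : ZMod p, lam ^ ((a + b).val * c.val) =
        lam ^ (a.val * c.val) * lam ^ (b.val * c.val) := by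
      intro a b c
      rw [ZMod.val_add, ← pow_add, ← add_mul, pow_eq_pow_mod _ hlam, Nat.mod_mul_mod,
        ← pow_eq_pow_mod _ hlam]
    have key' : ∀ a b c : ZMod p, lam ^ (c.val * (a + b).val) =
        lam ^ (c.val * a.val) * lam ^ (c.val * b.val) := by
      intro a b c
      rw [mul_comm, key, mul_comm a.val, mul_comm b.val]
    simp only [toAdd_mul, Prod.fst_add, Prod.snd_add, key, key']
    ring

/-- The trivial 2-cocycle. -/
def trivialCocycle (K : Type) [Group K] : TwoCocycle K where
  toFun _ _ := 1
  norm_eq_one := by simp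
  one_left := by simp
  one_right := by simp
  cocycle := by simp

/-- `A₀ = ℂ_e`, the group algebra of the trivial subgroup of `G`. -/
noncomputable def trivialQSystem (G : Type) [Group G] : QSystem G :=
  twistedGroupAlgebra (⊥ : Subgroup G).subtype (Subgroup.subtype_injective _) (trivialCocycle _)

/-- The dihedral group of order 8; `DihedralGroup.r 1` and `DihedralGroup.sr 0` are the generators
`r` and `s`, and `DihedralGroup.sr i` is `s r ^ i`. -/
abbrev D8 : Type := DihedralGroup 4

/-- `a ^ i b ^ j ↦ (r²) ^ i (s r ^ k) ^ j`. -/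
def kleinEmbedding (k : ZMod 4) : Multiplicative (ZMod 2 × ZMod 2) →* D8 where
  toFun x := DihedralGroup.r 2 ^ x.toAdd.1.val * DihedralGroup.sr k ^ x.toAdd.2.val
  map_one' := by revert k; decide
  map_mul' := by revert k; decide

theorem kleinEmbedding_injective (k : ZMod 4) : Function.Injective (kleinEmbedding k) := by
  revert k; unfold Function.Injective; decide

theorem kleinEmbedding_range (k : ZMod 4) : (kleinEmbedding k).range =
    Subgroup.closure {DihedralGroup.r 2, DihedralGroup.sr k} := by
  apply le_antisymm
  · rintro _ ⟨x, rfl⟩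
    exact mul_mem (pow_mem (Subgroup.subset_closure (by simp)) _)
      (pow_mem (Subgroup.subset_closure (by simp)) _)
  · rw [Subgroup.closure_le]
    rintro _ (rfl | rfl)
    · exact ⟨Multiplicative.ofAdd (1, 0), by revert k; decide⟩
    · exact ⟨Multiplicative.ofAdd (0, 1), by revert k; decide⟩

/-- `ℂ^ω⟨r², s r ^ k⟩`, where `ω(a ^ i b ^ j, a ^ i' b ^ j') = (-1) ^ (j i')` for `a = r²` and
`b = s r ^ k`. -/
noncomputable def kleinQSystem (k : ZMod 4) : QSystem D8 :=
  twistedGroupAlgebra (kleinEmbedding k) (kleinEmbedding_injective k)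
    (bicharacterCocycle 2 (-1) (by norm_num))

/-- `S₃ × ℤ₃`. -/
abbrev S3Z3 : Type := Equiv.Perm (Fin 3) × Multiplicative (ZMod 3)

/-- `(i, j) ↦ (r ^ i, a ^ j)`, where `r` is the 3-cycle `finRotate 3` and `a` the generator of
`ℤ₃`; the image is the subgroup `ℤ₃ × ℤ₃` of `S₃ × ℤ₃`. -/
def z3z3Embedding : Multiplicative (ZMod 3 × ZMod 3) →* S3Z3 where
  toFun x := (finRotate 3 ^ x.toAdd.1.val, Multiplicative.ofAdd x.toAdd.2)
  map_one' := by decide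
  map_mul' := by decide

theorem z3z3Embedding_injective : Function.Injective z3z3Embedding := by
  unfold Function.Injective; decide

/-- `ℂ^ψ[ℤ₃ × ℤ₃]` with `ψ(g, h) = λ ^ (g₂ h₁)`, for a third root of unity `λ`. -/
noncomputable def z3z3QSystem (lam : ℂ) (hlam : lam ^ 3 = 1) : QSystem S3Z3 :=
  twistedGroupAlgebra z3z3Embedding z3z3Embedding_injective (bicharacterCocycle 3 lam hlam)

theorem exp_two_pi_div_three_pow : Complex.exp (2 * Real.pi * Complex.I / 3) ^ 3 = 1 := by
  rw [← Complex.exp_nat_mul, ← Complex.exp_two_pi_mul_I]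
  congr 1
  push_cast
  ring

theorem exp_neg_two_pi_div_three_pow : Complex.exp (-(2 * Real.pi * Complex.I / 3)) ^ 3 = 1 := by
  rw [Complex.exp_neg, inv_pow, exp_two_pi_div_three_pow, inv_one]

/-- `A₊ = ℂ^{ψ₊}[ℤ₃ × ℤ₃]` with `ψ₊(g, h) = exp(2πi/3 · g₂ h₁)`. -/
noncomputable def z3z3QSystemPlus : QSystem S3Z3 :=
  z3z3QSystem (Complex.exp (2 * Real.pi * Complex.I / 3)) exp_two_pi_div_three_pow

/-- `A₋ = ℂ^{ψ₋}[ℤ₃ × ℤ₃]` with `ψ₋(g, h) = exp(-2πi/3 · g₂ h₁)`. -/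
noncomputable def z3z3QSystemMinus : QSystem S3Z3 :=
  z3z3QSystem (Complex.exp (-(2 * Real.pi * Complex.I / 3))) exp_neg_two_pi_div_three_pow

/-! A Q-system is a finite-dimensional star algebra with a faithful positive trace: the Frobenius
condition turns the adjoint of a left or right multiplication into a multiplication of the same
kind, and balancedness makes the two resulting involutions agree (`QSystem.inner_mul_right`).

Classification. A minimal projection p of the degree-one part cuts out a corner p A p in which every
nonzero homogeneous element is a multiple of a unitary. Each degree occurring there contributes
exactly a line, and these degrees form a subgroup H; the corner is thus a twisted group algebra of
H. When A is a matrix algebra, p generates A as an ideal, so A is Morita equivalent to the corner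
(`CornerEmbedding.morita`). Moreover |H| is a square (`exists_card_support`) and the corner has
trivial centre (`exists_smul_of_corner`), which excludes nontrivial cyclic H. In D8 this leaves the
trivial group and the two Klein four-groups, on which the generating unitaries must anticommute. In
S3 × Z3 it leaves the trivial group and the unique subgroup of order 9, with a primitive cube root
of unity as commutation scalar; conjugation by a transposition exchanges the two possible roots.

Distinction. Inequivalent Q-systems are separated by an invariant, the set of degrees in which the
full centre is nonzero (`HasCentralElement`). A central family for B acts on M by twisted
endomorphisms, which descend to M ⊗_B N ≅ A and become left multiplications by a central family for
A (`Morita.hasCentralElement`). -/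

namespace GradedHilb

/-! ### Homogeneous components of graded Hilbert spaces -/

variable {G : Type} [Group G]

theorem linearMap_ext_deg (V : GradedHilb G) {W : Type*} [AddCommGroup W] [Module ℂ W]
    {f f' : V →ₗ[ℂ] W} (h : ∀ g, ∀ v ∈ V.deg g, f v = f' v) : f = f' := by
  have : (⊤ : Submodule ℂ V) ≤ LinearMap.eqLocus f f' := by
    rw [← V.iSup_deg]
    exact iSup_le fun g v hv => h g v hv
  exact LinearMap.ext fun v => this (Submodule.mem_top (x := v))

theorem inner_eq_zero_of_ne (V : GradedHilb G) {g h : G} (hgh : g ≠ h) {v w : V}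
    (hv : v ∈ V.deg g) (hw : w ∈ V.deg h) : inner ℂ v w = 0 :=
  (Submodule.isOrtho_iff_inner_eq.mp (V.orthogonal g h hgh)) v hv w hw

/-- The orthogonal projection onto the component of degree `g`. -/
noncomputable def proj (V : GradedHilb G) (g : G) : V →ₗ[ℂ] V :=
  ((V.deg g).starProjection : V →L[ℂ] V).toLinearMap

theorem proj_mem (V : GradedHilb G) (g : G) (v : V) : V.proj g v ∈ V.deg g :=
  Submodule.starProjection_apply_mem _ _

theorem proj_of_mem (V : GradedHilb G) {g : G} {v : V} (hv : v ∈ V.deg g) : V.proj g v = v :=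
  Submodule.starProjection_eq_self_iff.mpr hv

theorem proj_of_mem_ne (V : GradedHilb G) {g h : G} (hgh : g ≠ h) {v : V} (hv : v ∈ V.deg h) :
    V.proj g v = 0 :=
  (Submodule.starProjection_apply_eq_zero_iff _).mpr
    ((Submodule.mem_orthogonal _ _).mpr fun _ hw => V.inner_eq_zero_of_ne hgh hw hv)

theorem sum_proj [Fintype G] (V : GradedHilb G) (v : V) : ∑ g, V.proj g v = v := by
  classical
  have : ∑ g, V.proj g = LinearMap.id := by
    refine V.linearMap_ext_deg fun g v hv => ?_
    rw [LinearMap.sum_apply, Finset.sum_eq_single g]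
    · exact V.proj_of_mem hv
    · exact fun h _ hh => V.proj_of_mem_ne hh hv
    · simp
  simpa using LinearMap.congr_fun this v

/-- The difference between v and its projection to degree g is orthogonal to every component, hence
zero. Elements such as `star a` are only known through inner products, and this determines their
degrees. -/
theorem mem_deg_of_inner (V : GradedHilb G) {g : G} {v : V}
    (hv : ∀ h, h ≠ g → ∀ w ∈ V.deg h, inner ℂ w v = 0) : v ∈ V.deg g := by
  have key : v - V.proj g v = 0 := by
    have h1 : innerₛₗ ℂ (v - V.proj g v) = (0 : V →ₗ[ℂ] ℂ) := by
      refine V.linearMap_ext_deg fun h w hw => ?_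
      by_cases hg : h = g
      · subst hg
        exact Submodule.starProjection_inner_eq_zero v w hw
      · rw [LinearMap.zero_apply]
        change inner ℂ (v - V.proj g v) w = 0
        rw [inner_sub_left, V.inner_eq_zero_of_ne (Ne.symm hg) (V.proj_mem g v) hw, sub_zero,
          ← inner_conj_symm, hv h hg w hw, map_zero]
    have h2 := LinearMap.congr_fun h1 (v - V.proj g v)
    exact inner_self_eq_zero.mp h2
  rw [sub_eq_zero.mp key]
  exact V.proj_mem g v

theorem eq_zero_of_mem_of_mem (V : GradedHilb G) {g h : G} (hgh : g ≠ h) {v : V}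
    (hv : v ∈ V.deg g) (hw : v ∈ V.deg h) : v = 0 :=
  inner_self_eq_zero.mp (V.inner_eq_zero_of_ne hgh hv hw)

end GradedHilb

/-! ### The star algebra and the trace of a Q-system -/

namespace QSystem

variable {G : Type} [Group G]

theorem mul_tmul_assoc (A : QSystem G) (x y z : A.obj) :
    A.mul (A.mul (x ⊗ₜ y) ⊗ₜ z) = A.mul (x ⊗ₜ A.mul (y ⊗ₜ z)) :=
  LinearMap.congr_fun A.mul_assoc ((x ⊗ₜ y) ⊗ₜ z)

theorem mul_unit_tmul (A : QSystem G) (x : A.obj) : A.mul (A.unit 1 ⊗ₜ x) = x := by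
  have := LinearMap.congr_fun A.unit_mul ((1 : ℂ) ⊗ₜ x)
  simpa using this

theorem mul_tmul_unit (A : QSystem G) (x : A.obj) : A.mul (x ⊗ₜ A.unit 1) = x := by
  have := LinearMap.congr_fun A.mul_unit (x ⊗ₜ (1 : ℂ))
  simpa using this

/-- The underlying ring of a Q-system. -/
noncomputable instance instRing (A : QSystem G) : Ring A.obj where
  __ := (inferInstance : AddCommGroup A.obj)
  mul x y := A.mul (x ⊗ₜ y)
  one := A.unit 1
  left_distrib x y z := by
    change A.mul _ = A.mul _ + A.mul _
    rw [TensorProduct.tmul_add, map_add]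
  right_distrib x y z := by
    change A.mul _ = A.mul _ + A.mul _
    rw [TensorProduct.add_tmul, map_add]
  zero_mul x := by
    change A.mul _ = 0
    rw [TensorProduct.zero_tmul, map_zero]
  mul_zero x := by
    change A.mul _ = 0
    rw [TensorProduct.tmul_zero, map_zero]
  mul_assoc := A.mul_tmul_assoc
  one_mul := A.mul_unit_tmul
  mul_one := A.mul_tmul_unit

theorem mul_tmul (A : QSystem G) (x y : A.obj) : A.mul (x ⊗ₜ y) = x * y := rfl

theorem unit_apply_one (A : QSystem G) : A.unit 1 = 1 := rfl

/-- The underlying algebra of a Q-system. -/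
noncomputable instance instAlgebra (A : QSystem G) : Algebra ℂ A.obj :=
  Algebra.ofModule
    (fun c x y => by
      change A.mul _ = c • A.mul _
      rw [← TensorProduct.smul_tmul', map_smul])
    (fun c x y => by
      change A.mul _ = c • A.mul _
      rw [TensorProduct.tmul_smul, map_smul])

theorem mul_mem_deg (A : QSystem G) {g h : G} {x y : A.obj} (hx : x ∈ A.obj.deg g)
    (hy : y ∈ A.obj.deg h) : x * y ∈ A.obj.deg (g * h) :=
  A.mul_graded g h x hx y hy

theorem one_mem_deg (A : QSystem G) : (1 : A.obj) ∈ A.obj.deg 1 := A.unit_graded 1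

/-- The element `m† ι` of `A ⊗ A`. -/
noncomputable def coev (A : QSystem G) : A.obj ⊗[ℂ] A.obj := LinearMap.adjoint A.mul 1

theorem mul_coev (A : QSystem G) : A.mul A.coev = 1 :=
  LinearMap.congr_fun A.isometric 1

theorem inner_tmul_coev (A : QSystem G) (x y : A.obj) :
    inner ℂ (x ⊗ₜ[ℂ] y) A.coev = inner ℂ (x * y) 1 :=
  LinearMap.adjoint_inner_right _ _ _

/-- The Frobenius condition evaluated at x ⊗ 1. With its mirror image below it shows that the whole
comultiplication is determined by `coev`. -/
theorem adjoint_mul_eq_rTensor (A : QSystem G) (x : A.obj) :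
    LinearMap.adjoint A.mul x = (LinearMap.mulLeft ℂ x).rTensor A.obj A.coev := by
  have h := LinearMap.congr_fun A.frobenius_right (x ⊗ₜ (1 : A.obj))
  simp only [LinearMap.comp_apply, LinearMap.lTensor_tmul, mul_tmul, mul_one] at h
  have key : A.mul.rTensor A.obj ∘ₗ
      (TensorProduct.assoc ℂ A.obj A.obj A.obj).symm.toLinearMap ∘ₗ TensorProduct.mk ℂ _ _ x =
      (LinearMap.mulLeft ℂ x).rTensor A.obj := TensorProduct.ext' fun a b => rfl
  exact h.symm.trans (LinearMap.congr_fun key A.coev)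

theorem adjoint_mul_eq_lTensor (A : QSystem G) (x : A.obj) :
    LinearMap.adjoint A.mul x = (LinearMap.mulRight ℂ x).lTensor A.obj A.coev := by
  have h := LinearMap.congr_fun A.frobenius_left ((1 : A.obj) ⊗ₜ x)
  simp only [LinearMap.comp_apply, LinearMap.rTensor_tmul, mul_tmul, one_mul] at h
  have key : A.mul.lTensor A.obj ∘ₗ
      (TensorProduct.assoc ℂ A.obj A.obj A.obj).toLinearMap ∘ₗ
        (TensorProduct.mk ℂ _ _).flip x =
      (LinearMap.mulRight ℂ x).lTensor A.obj := TensorProduct.ext' fun a b => rfl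
  exact h.symm.trans (LinearMap.congr_fun key A.coev)

/-- The element `a'` with `⟨x a, y⟩ = ⟨x, y a'⟩`. -/
noncomputable def rstar (A : QSystem G) (a : A.obj) : A.obj :=
  LinearMap.adjoint (LinearMap.mulRight ℂ a) 1

/-- The adjoint of left multiplication by a turns out to be a left multiplication, so it must be the
one by its value at 1. -/
noncomputable instance instStar (A : QSystem G) : Star A.obj where
  star a := LinearMap.adjoint (LinearMap.mulLeft ℂ a) 1

/-- Moving right multiplication by y to the other side as an adjoint leaves an inner product with 1,
that is, with `coev` on the tensor square. Moving it back and using m†(y) = (id ⊗ R_y) `coev`, where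
R_y is right multiplication by y, gives the claim. -/
theorem inner_mul_left (A : QSystem G) (a x y : A.obj) :
    inner ℂ (a * x) y = inner ℂ x (star a * y) := by
  have h1 : inner ℂ x (star a * y) =
      inner ℂ (a * LinearMap.adjoint (LinearMap.mulRight ℂ y) x) 1 := by
    change inner ℂ x (LinearMap.mulRight ℂ y (LinearMap.adjoint (LinearMap.mulLeft ℂ a) 1)) = _
    rw [← LinearMap.adjoint_inner_left, LinearMap.adjoint_inner_right]
    rfl
  rw [h1, ← inner_tmul_coev, ← mul_tmul, ← LinearMap.adjoint_inner_right,
    adjoint_mul_eq_lTensor, ← LinearMap.adjoint_inner_left, LinearMap.adjoint_lTensor]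
  rfl

theorem inner_mul_right_rstar (A : QSystem G) (a x y : A.obj) :
    inner ℂ (x * a) y = inner ℂ x (y * A.rstar a) := by
  have h1 : inner ℂ x (y * A.rstar a) =
      inner ℂ (LinearMap.adjoint (LinearMap.mulLeft ℂ y) x * a) 1 := by
    change inner ℂ x (LinearMap.mulLeft ℂ y (LinearMap.adjoint (LinearMap.mulRight ℂ a) 1)) = _
    rw [← LinearMap.adjoint_inner_left, LinearMap.adjoint_inner_right]
    rfl
  rw [h1, ← inner_tmul_coev, ← mul_tmul, ← LinearMap.adjoint_inner_right,
    adjoint_mul_eq_rTensor, ← LinearMap.adjoint_inner_left, LinearMap.adjoint_rTensor]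
  rfl

theorem inner_eq_inner_one (A : QSystem G) (x y : A.obj) : inner ℂ x y = inner ℂ 1 (star x * y) := by
  rw [← inner_mul_left, mul_one]

theorem eq_star_of_inner (A : QSystem G) {a b : A.obj}
    (h : ∀ x, inner ℂ (a * x) 1 = inner ℂ x b) : b = star a := by
  refine ext_inner_left ℂ fun x => ?_
  rw [← h, inner_mul_left, mul_one]

theorem eq_rstar_of_inner (A : QSystem G) {a b : A.obj}
    (h : ∀ x, inner ℂ (x * a) 1 = inner ℂ x b) : b = A.rstar a := by
  refine ext_inner_left ℂ fun x => ?_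
  rw [← h, inner_mul_right_rstar, one_mul]

noncomputable instance instStarRing (A : QSystem G) : StarRing A.obj where
  star_involutive a := by
    refine ext_inner_left ℂ fun x => ?_
    rw [← mul_one (star (star a)), ← inner_mul_left, ← inner_conj_symm, ← inner_mul_left, mul_one,
      inner_conj_symm]
  star_mul a b := by
    symm
    refine A.eq_star_of_inner fun x => ?_
    rw [_root_.mul_assoc, inner_mul_left, inner_mul_left, mul_one]
  star_add a b := by
    symm
    refine A.eq_star_of_inner fun x => ?_
    rw [add_mul, inner_add_left, inner_mul_left, inner_mul_left, mul_one, mul_one, inner_add_right]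

instance instStarModule (A : QSystem G) : StarModule ℂ A.obj where
  star_smul c a := by
    symm
    refine A.eq_star_of_inner fun x => ?_
    rw [smul_mul_assoc, inner_smul_left, inner_mul_left, mul_one, inner_smul_right]
    rfl

theorem star_mem_deg (A : QSystem G) {g : G} {a : A.obj} (ha : a ∈ A.obj.deg g) :
    star a ∈ A.obj.deg g⁻¹ := by
  refine A.obj.mem_deg_of_inner fun h hh w hw => ?_
  rw [← mul_one (star a), ← inner_mul_left]
  refine A.obj.inner_eq_zero_of_ne ?_ (A.mul_mem_deg ha hw) A.one_mem_deg
  exact fun h' => hh (eq_inv_of_mul_eq_one_right h')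

theorem rstar_mem_deg (A : QSystem G) {g : G} {a : A.obj} (ha : a ∈ A.obj.deg g) :
    A.rstar a ∈ A.obj.deg g⁻¹ := by
  refine A.obj.mem_deg_of_inner fun h hh w hw => ?_
  rw [← one_mul (A.rstar a), ← inner_mul_right_rstar]
  refine A.obj.inner_eq_zero_of_ne ?_ (A.mul_mem_deg hw ha) A.one_mem_deg
  exact fun h' => hh (eq_inv_of_mul_eq_one_left h')

theorem rstar_rstar (A : QSystem G) (a : A.obj) : A.rstar (A.rstar a) = a := by
  refine ext_inner_left ℂ fun x => ?_
  rw [← one_mul (A.rstar (A.rstar a)), ← inner_mul_right_rstar, ← inner_conj_symm,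
    ← inner_mul_right_rstar, one_mul, inner_conj_symm]

theorem rstar_smul (A : QSystem G) (c : ℂ) (a : A.obj) : A.rstar (c • a) = conj c • A.rstar a := by
  symm
  refine A.eq_rstar_of_inner fun x => ?_
  rw [mul_smul_comm, inner_smul_left, inner_mul_right_rstar, one_mul, inner_smul_right]

theorem rstar_add (A : QSystem G) (a b : A.obj) : A.rstar (a + b) = A.rstar a + A.rstar b := by
  symm
  refine A.eq_rstar_of_inner fun x => ?_
  rw [mul_add, inner_add_left, inner_mul_right_rstar, inner_mul_right_rstar, one_mul, one_mul,
    inner_add_right]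

/-- The modular operator `a ↦ (a*)'`. -/
noncomputable def modular (A : QSystem G) : A.obj →ₗ[ℂ] A.obj where
  toFun a := A.rstar (star a)
  map_add' a b := by rw [star_add, rstar_add]
  map_smul' c a := by
    rw [star_smul, rstar_smul]
    simp

/-- The inverse of the modular operator. -/
noncomputable def modularInv (A : QSystem G) : A.obj →ₗ[ℂ] A.obj where
  toFun a := star (A.rstar a)
  map_add' a b := by rw [rstar_add, star_add]
  map_smul' c a := by
    rw [rstar_smul, star_smul]
    simp

/-- Positivity of the modular operator, which will exclude the eigenvalue -1. -/
theorem inner_modular_self (A : QSystem G) (a : A.obj) :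
    inner ℂ a (A.modular a) = inner ℂ (star a) (star a) := by
  change inner ℂ a (A.rstar (star a)) = _
  rw [← one_mul (A.rstar (star a)), ← inner_mul_right_rstar, inner_mul_left, mul_one]

/-- The vector `coev` represents x ⊗ y ↦ ⟨xy, 1⟩, which equals ⟨y, x*⟩. Having one expansion with
`star` and another with `rstar` lets the two sides of the balancing condition be compared. -/
theorem coev_eq_sum_star (A : QSystem G) {ι : Type*} [Fintype ι] (b : OrthonormalBasis ι ℂ A.obj) :
    A.coev = ∑ i, b i ⊗ₜ[ℂ] star (b i) := by
  refine TensorProduct.ext_iff_inner_left.mpr fun x y => ?_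
  rw [inner_tmul_coev, inner_mul_left, mul_one, inner_sum]
  have h : star x = ∑ i, inner ℂ x (b i) • star (b i) := by
    conv_lhs => rw [← b.sum_repr' x, star_sum]
    refine Finset.sum_congr rfl fun i _ => ?_
    rw [star_smul, ← inner_conj_symm x]
    rfl
  rw [h, inner_sum]
  refine Finset.sum_congr rfl fun i _ => ?_
  rw [inner_smul_right, TensorProduct.inner_tmul]

theorem coev_eq_sum_rstar (A : QSystem G) {ι : Type*} [Fintype ι] (b : OrthonormalBasis ι ℂ A.obj) :
    A.coev = ∑ i, A.rstar (b i) ⊗ₜ[ℂ] b i := by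
  refine TensorProduct.ext_iff_inner_left.mpr fun x y => ?_
  rw [inner_tmul_coev, inner_mul_right_rstar, one_mul, inner_sum]
  have h : A.rstar y = ∑ i, inner ℂ y (b i) • A.rstar (b i) := by
    have hs : ∀ s : Finset ι, A.rstar (∑ i ∈ s, inner ℂ (b i) y • b i) =
        ∑ i ∈ s, inner ℂ y (b i) • A.rstar (b i) := by
      classical
      intro s
      induction s using Finset.induction_on with
      | empty => simpa using A.rstar_smul 0 0
      | insert i s hi ih => rw [Finset.sum_insert hi, Finset.sum_insert hi, rstar_add, rstar_smul,
          inner_conj_symm, ih]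
    conv_lhs => rw [← b.sum_repr' y, hs]
  rw [h, inner_sum]
  refine Finset.sum_congr rfl fun i _ => ?_
  rw [inner_smul_right, TensorProduct.inner_tmul, mul_comm]

theorem adjoint_unit_apply (A : QSystem G) (v : A.obj) :
    LinearMap.adjoint A.unit v = inner ℂ 1 v := by
  have h := LinearMap.adjoint_inner_right A.unit (1 : ℂ) v
  rw [unit_apply_one] at h
  simpa using h

theorem balanced_coev (A : QSystem G) (f : A.obj →ₗ[ℂ] A.obj) (hf : GradedHilb.IsGraded f) :
    inner ℂ 1 (A.mul (f.lTensor A.obj A.coev)) = inner ℂ 1 (A.mul (f.rTensor A.obj A.coev)) := by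
  have h := LinearMap.congr_fun (A.balanced f hf) 1
  rw [LinearMap.adjoint_comp, LinearMap.adjoint_comp, LinearMap.adjoint_adjoint,
    LinearMap.adjoint_adjoint] at h
  rw [← adjoint_unit_apply, ← adjoint_unit_apply]
  exact h

/-- Balancedness says that Δ and its inverse, Δ being the modular operator, have the same
Hilbert–Schmidt pairing with every graded endomorphism. -/
theorem sum_inner_modular (A : QSystem G) (f : A.obj →ₗ[ℂ] A.obj) (hf : GradedHilb.IsGraded f)
    {ι : Type*} [Fintype ι] (b : OrthonormalBasis ι ℂ A.obj) :
    ∑ i, inner ℂ (A.modular (b i)) (f (b i)) = ∑ i, inner ℂ (A.modularInv (b i)) (f (b i)) := by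
  have h := A.balanced_coev f hf
  conv_lhs at h => rw [coev_eq_sum_rstar A b]
  conv_rhs at h => rw [coev_eq_sum_star A b]
  simp only [map_sum, inner_sum, LinearMap.lTensor_tmul, LinearMap.rTensor_tmul, mul_tmul] at h
  refine Eq.trans ?_ (h.symm.trans ?_) <;> refine Finset.sum_congr rfl fun i _ => ?_
  · change inner ℂ (A.rstar (star (b i))) (f (b i)) = _
    rw [← one_mul (A.rstar _), ← inner_conj_symm, ← inner_mul_right_rstar, inner_conj_symm]
  · change _ = inner ℂ (star (A.rstar (b i))) (f (b i))
    rw [← mul_one (star _), ← inner_conj_symm (star _ * 1), ← inner_mul_left, inner_conj_symm]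

theorem modular_graded (A : QSystem G) : GradedHilb.IsGraded A.modular := fun g v hv => by
  have := A.rstar_mem_deg (A.star_mem_deg hv)
  rwa [inv_inv] at this

theorem modularInv_graded (A : QSystem G) : GradedHilb.IsGraded A.modularInv := fun g v hv => by
  have := A.star_mem_deg (A.rstar_mem_deg hv)
  rwa [inv_inv] at this

/-- The difference of the two operators is itself graded, so it may be used as the test
endomorphism; its Hilbert–Schmidt norm is then zero. -/
theorem modular_eq_modularInv (A : QSystem G) : A.modular = A.modularInv := by
  have b := stdOrthonormalBasis ℂ A.obj
  have h := A.sum_inner_modular (A.modular - A.modularInv)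
    (fun g v hv => sub_mem (A.modular_graded g v hv) (A.modularInv_graded g v hv)) b
  rw [← sub_eq_zero, ← Finset.sum_sub_distrib] at h
  simp only [← inner_sub_left, LinearMap.sub_apply] at h
  have h' : ∑ i, ‖A.modular (b i) - A.modularInv (b i)‖ ^ 2 = 0 := by
    simp only [inner_self_eq_norm_sq_to_K] at h
    rw [← Complex.ofReal_inj]
    push_cast
    exact h
  rw [Finset.sum_eq_zero_iff_of_nonneg fun i _ => by positivity] at h'
  refine b.toBasis.ext fun i => ?_
  have := h' i (Finset.mem_univ i)
  rw [sq_eq_zero_iff, norm_eq_zero, sub_eq_zero] at this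
  simpa using this

theorem modular_apply (A : QSystem G) (a : A.obj) : A.modular a = a := by
  have h1 : A.modular (A.modular a) = a := by
    refine (LinearMap.congr_fun A.modular_eq_modularInv _).trans ?_
    change star (A.rstar (A.rstar (star a))) = a
    rw [rstar_rstar, star_star]
  -- Since the modular operator squares to the identity, c is in its (-1)-eigenspace; positivity
  -- gives -‖c‖² = ‖c*‖², so c = 0.
  set c := A.modular a - a with hc
  have h2 : A.modular c = -c := by rw [hc, map_sub, h1]; abel
  have h3 := A.inner_modular_self c
  rw [h2, inner_neg_right, inner_self_eq_norm_sq_to_K, inner_self_eq_norm_sq_to_K] at h3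
  have h4 : -‖c‖ ^ 2 = ‖star c‖ ^ 2 := by exact_mod_cast h3
  have h5 : c = 0 := norm_eq_zero.mp (by nlinarith [sq_nonneg ‖c‖, sq_nonneg ‖star c‖])
  exact sub_eq_zero.mp h5

/-- Triviality of the modular operator identifies `rstar` with `star`; equivalently, a ↦ ⟨1, a⟩ is a
trace. -/
theorem inner_mul_right (A : QSystem G) (a x y : A.obj) :
    inner ℂ (x * a) y = inner ℂ x (y * star a) := by
  rw [inner_mul_right_rstar]
  have h := A.modular_apply (star a)
  change A.rstar (star (star a)) = star a at h
  rw [star_star] at h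
  rw [h]

end QSystem

/-! ### Recognizing relative tensor products -/

namespace QBimodule

variable {G : Type} [Group G] {A B C : QSystem G}

theorem relativeProjector_tmul (M : QBimodule A B) (N : QBimodule B C) (m : M.obj) (n : N.obj) :
    relativeProjector M N (m ⊗ₜ n) = TensorProduct.map (M.right ∘ₗ TensorProduct.mk ℂ _ _ m)
      (N.left ∘ₗ (TensorProduct.mk ℂ _ _).flip n) B.coev := by
  have key : TensorProduct.map M.right N.left ∘ₗ
      (TensorProduct.assoc ℂ M.obj B.obj (B.obj ⊗[ℂ] N.obj)).symm.toLinearMap ∘ₗ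
      (TensorProduct.assoc ℂ B.obj B.obj N.obj).toLinearMap.lTensor M.obj ∘ₗ
      TensorProduct.mk ℂ _ _ m ∘ₗ (TensorProduct.mk ℂ _ _).flip n =
      TensorProduct.map (M.right ∘ₗ TensorProduct.mk ℂ _ _ m)
      (N.left ∘ₗ (TensorProduct.mk ℂ _ _).flip n) := TensorProduct.ext' fun x y => rfl
  exact LinearMap.congr_fun key B.coev

theorem inner_relativeProjector (M : QBimodule A B) (N : QBimodule B C) (m m' : M.obj)
    (n n' : N.obj) : inner ℂ (m' ⊗ₜ[ℂ] n') (relativeProjector M N (m ⊗ₜ n)) =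
      inner ℂ (LinearMap.adjoint (M.right ∘ₗ TensorProduct.mk ℂ _ _ m) m' *
        LinearMap.adjoint (N.left ∘ₗ (TensorProduct.mk ℂ _ _).flip n) n') 1 := by
  rw [relativeProjector_tmul, ← LinearMap.adjoint_inner_left, TensorProduct.adjoint_map,
    TensorProduct.map_tmul, QSystem.inner_tmul_coev]

/-- A criterion free of adjoints of S. The inner product identity says S†S = P; then SP = S and
surjectivity give SS† = id, and the actions, being compatible with S, are the induced ones. -/
theorem isRelativeTensor_of_surjective (M : QBimodule A B) (N : QBimodule B C) (T : QBimodule A C)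
    (S : M.obj ⊗[ℂ] N.obj →ₗ[ℂ] T.obj) (hgr : GradedHilb.IsGradedTensor S)
    (hinner : ∀ m n m' n', inner ℂ (S (m' ⊗ₜ n')) (S (m ⊗ₜ n)) =
      inner ℂ (m' ⊗ₜ[ℂ] n') (relativeProjector M N (m ⊗ₜ n)))
    (hsurj : Function.Surjective S)
    (hSP : ∀ m n, S (relativeProjector M N (m ⊗ₜ n)) = S (m ⊗ₜ n))
    (hleft : ∀ a m n, S (M.left (a ⊗ₜ m) ⊗ₜ n) = T.left (a ⊗ₜ S (m ⊗ₜ n)))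
    (hright : ∀ m n c, S (m ⊗ₜ N.right (n ⊗ₜ c)) = T.right (S (m ⊗ₜ n) ⊗ₜ c)) :
    IsRelativeTensor M N T := by
  have h1 : LinearMap.adjoint S ∘ₗ S = relativeProjector M N := by
    refine TensorProduct.ext' fun m n => ?_
    refine TensorProduct.ext_iff_inner_left.mpr fun m' n' => ?_
    rw [← hinner, LinearMap.comp_apply, LinearMap.adjoint_inner_right]
  have h2 : S ∘ₗ LinearMap.adjoint S = LinearMap.id := by
    refine LinearMap.ext fun t => ?_
    obtain ⟨y, rfl⟩ := hsurj t
    have h3 : S ∘ₗ relativeProjector M N = S := TensorProduct.ext' hSP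
    have h4 := LinearMap.congr_fun h1 y
    rw [LinearMap.comp_apply] at h4
    rw [LinearMap.comp_apply, h4]
    exact LinearMap.congr_fun h3 y
  refine ⟨S, hgr, h1, h2, ?_, ?_⟩
  · refine TensorProduct.ext' fun a t => ?_
    have key : S ∘ₗ M.left.rTensor N.obj ∘ₗ
        (TensorProduct.assoc ℂ A.obj M.obj N.obj).symm.toLinearMap ∘ₗ TensorProduct.mk ℂ _ _ a =
        T.left ∘ₗ TensorProduct.mk ℂ _ _ a ∘ₗ S := TensorProduct.ext' fun m n => hleft a m n
    have h5 := LinearMap.congr_fun key (LinearMap.adjoint S t)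
    have h6 := LinearMap.congr_fun h2 t
    rw [LinearMap.comp_apply] at h6
    refine Eq.trans ?_ h5.symm
    change _ = T.left (a ⊗ₜ S (LinearMap.adjoint S t))
    rw [h6]
    rfl
  · refine TensorProduct.ext' fun t c => ?_
    have key : S ∘ₗ N.right.lTensor M.obj ∘ₗ
        (TensorProduct.assoc ℂ M.obj N.obj C.obj).toLinearMap ∘ₗ
          (TensorProduct.mk ℂ _ _).flip c =
        T.right ∘ₗ (TensorProduct.mk ℂ _ _).flip c ∘ₗ S :=
      TensorProduct.ext' fun m n => hright m n c
    have h5 := LinearMap.congr_fun key (LinearMap.adjoint S t)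
    have h6 := LinearMap.congr_fun h2 t
    rw [LinearMap.comp_apply] at h6
    refine Eq.trans ?_ h5.symm
    change _ = T.right (S (LinearMap.adjoint S t) ⊗ₜ c)
    rw [h6]
    rfl

theorem Isomorphic.refl (M : QBimodule A B) : Isomorphic M M :=
  ⟨LinearEquiv.refl ℂ _, fun _ _ hv => hv,
    TensorProduct.ext' fun _ _ => rfl, TensorProduct.ext' fun _ _ => rfl⟩

end QBimodule

/-! ### Corners of a Q-system and their Morita equivalence -/

/-- An embedding of the Q-system `A` as a corner `p C p` of the Q-system `C`, where `p` is the image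
of the unit, that scales the inner product and conjugates the degrees by `shift`. -/
structure CornerEmbedding {G : Type} [Group G] (C A : QSystem G) where
  toFun : A.obj →ₗ[ℂ] C.obj
  map_mul : ∀ a b, toFun (a * b) = toFun a * toFun b
  star_map_one : star (toFun 1) = toFun 1
  exists_eq : ∀ c, ∃ a, toFun a = toFun 1 * c * toFun 1
  scale : ℝ
  scale_pos : 0 < scale
  inner_map : ∀ a b, inner ℂ (toFun a) (toFun b) = scale * inner ℂ a b
  shift : G
  map_mem : ∀ h, ∀ a ∈ A.obj.deg h, toFun a ∈ C.obj.deg (shift * h * shift⁻¹)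

namespace CornerEmbedding

variable {G : Type} [Group G] {C A B : QSystem G}

/-- The identity embedding. -/
noncomputable def refl (C : QSystem G) : CornerEmbedding C C where
  toFun := LinearMap.id
  map_mul _ _ := rfl
  star_map_one := star_one _
  exists_eq c := ⟨c, by simp⟩
  scale := 1
  scale_pos := one_pos
  inner_map a b := by simp
  shift := 1
  map_mem h a ha := by simpa using ha

/-- The projection onto the corner. -/
noncomputable def p (α : CornerEmbedding C A) : C.obj := α.toFun 1

variable (α : CornerEmbedding C A) (β : CornerEmbedding C B)

theorem star_p : star α.p = α.p := α.star_map_one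

theorem p_mul_map (a : A.obj) : α.p * α.toFun a = α.toFun a := by
  rw [p, ← α.map_mul, one_mul]

theorem map_mul_p (a : A.obj) : α.toFun a * α.p = α.toFun a := by
  rw [p, ← α.map_mul, mul_one]

theorem p_mul_p : α.p * α.p = α.p := α.p_mul_map 1

theorem p_mem : α.p ∈ C.obj.deg 1 := by
  have := α.map_mem 1 1 A.one_mem_deg
  rwa [mul_one, mul_inv_cancel] at this

theorem scale_ne_zero : (α.scale : ℂ) ≠ 0 := by exact_mod_cast α.scale_pos.ne'

/-- The compression of `C` to the corner, read in `A`. -/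
noncomputable def coord : C.obj →ₗ[ℂ] A.obj := (α.scale : ℂ)⁻¹ • LinearMap.adjoint α.toFun

theorem inner_coord (a : A.obj) (c : C.obj) :
    inner ℂ (α.toFun a) c = α.scale * inner ℂ a (α.coord c) := by
  rw [coord, LinearMap.smul_apply, inner_smul_right, LinearMap.adjoint_inner_right,
    mul_inv_cancel_left₀ α.scale_ne_zero]

theorem coord_map (a : A.obj) : α.coord (α.toFun a) = a := by
  refine ext_inner_left ℂ fun v => mul_left_cancel₀ α.scale_ne_zero ?_
  rw [← inner_coord, inner_map]

theorem coord_compress (c : C.obj) : α.coord (α.p * c * α.p) = α.coord c := by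
  refine ext_inner_left ℂ fun v => mul_left_cancel₀ α.scale_ne_zero ?_
  rw [← inner_coord, ← inner_coord]
  conv_rhs => rw [← α.p_mul_map v, ← α.map_mul_p v, ← mul_assoc]
  rw [QSystem.inner_mul_right, mul_assoc α.p, QSystem.inner_mul_left, α.star_p, ← mul_assoc]

theorem map_coord (c : C.obj) : α.toFun (α.coord c) = α.p * c * α.p := by
  obtain ⟨a, ha⟩ := α.exists_eq c
  rw [← coord_compress]
  change α.toFun a = α.p * c * α.p at ha
  rw [← ha, coord_map]

theorem coord_mem {h : G} {c : C.obj} (hc : c ∈ C.obj.deg (α.shift * h * α.shift⁻¹)) :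
    α.coord c ∈ A.obj.deg h := by
  refine A.obj.mem_deg_of_inner fun k hk w hw => mul_left_cancel₀ α.scale_ne_zero ?_
  rw [← inner_coord, mul_zero]
  exact C.obj.inner_eq_zero_of_ne (by simpa using hk) (α.map_mem k w hw) hc

/-- The subspace `p C q`. -/
def cornerSubmodule : Submodule ℂ C.obj where
  carrier := {x | α.p * x = x ∧ x * β.p = x}
  add_mem' := by
    rintro x y ⟨h1, h2⟩ ⟨h3, h4⟩
    exact ⟨by rw [mul_add, h1, h3], by rw [add_mul, h2, h4]⟩
  zero_mem' := ⟨mul_zero _, zero_mul _⟩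
  smul_mem' := by
    rintro c x ⟨h1, h2⟩
    exact ⟨by rw [mul_smul_comm, h1], by rw [smul_mul_assoc, h2]⟩

theorem compress_mem (x : C.obj) : α.p * x * β.p ∈ cornerSubmodule α β :=
  ⟨by rw [← mul_assoc, ← mul_assoc, α.p_mul_p], by rw [mul_assoc, β.p_mul_p]⟩

/-- The map `x ↦ p x q` onto `p C q`. -/
noncomputable def compress : C.obj →ₗ[ℂ] cornerSubmodule α β :=
  (LinearMap.mulRight ℂ β.p ∘ₗ LinearMap.mulLeft ℂ α.p).codRestrict _ (compress_mem α β)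

/-- The graded Hilbert space `p C q`. -/
noncomputable def cornerHilb : GradedHilb G where
  carrier := cornerSubmodule α β
  -- Undoing the shifts on both sides makes the actions of A and B graded, since A_h lies in degree
  -- s h s⁻¹ of C, where s is the shift of α, and similarly for B.
  deg d := (C.obj.deg (α.shift * d * β.shift⁻¹)).comap (cornerSubmodule α β).subtype
  orthogonal g h hgh := by
    rw [Submodule.isOrtho_iff_inner_eq]
    intro v hv w hw
    exact C.obj.inner_eq_zero_of_ne (by simpa using hgh) hv hw
  iSup_deg := by
    have h1 : LinearMap.range (compress α β) = ⊤ := by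
      refine LinearMap.range_eq_top.mpr fun x => ⟨x.1, Subtype.ext ?_⟩
      change α.p * x.1 * β.p = x.1
      rw [x.2.1, x.2.2]
    rw [eq_top_iff, ← h1, LinearMap.range_eq_map, ← C.obj.iSup_deg, Submodule.map_iSup]
    refine iSup_le fun g => ?_
    rintro _ ⟨x, hx, rfl⟩
    refine Submodule.mem_iSup_of_mem (α.shift⁻¹ * g * β.shift) ?_
    change α.p * x * β.p ∈ C.obj.deg (α.shift * (α.shift⁻¹ * g * β.shift) * β.shift⁻¹)
    have := C.mul_mem_deg (C.mul_mem_deg α.p_mem hx) β.p_mem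
    simpa [mul_assoc] using this

/-- The inclusion of `p C q` into `C`. -/
noncomputable def incl : (cornerHilb α β).carrier →ₗ[ℂ] C.obj := (cornerSubmodule α β).subtype

theorem incl_injective : Function.Injective (incl α β) := Subtype.val_injective

theorem inner_incl (m n : cornerHilb α β) : inner ℂ (incl α β m) (incl α β n) = inner ℂ m n := rfl

theorem p_mul_incl (m : cornerHilb α β) : α.p * incl α β m = incl α β m := m.2.1

theorem incl_mul_p (m : cornerHilb α β) : incl α β m * β.p = incl α β m := m.2.2

/-- The map `x ↦ p x q`, as a map to the graded Hilbert space `p C q`. -/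
noncomputable def toCorner : C.obj →ₗ[ℂ] (cornerHilb α β).carrier := compress α β

/-- The left action. -/
noncomputable def cornerLeft : A.obj ⊗[ℂ] cornerHilb α β →ₗ[ℂ] cornerHilb α β :=
  toCorner α β ∘ₗ LinearMap.mul' ℂ C.obj ∘ₗ TensorProduct.map α.toFun (incl α β)

/-- The right action. -/
noncomputable def cornerRight : cornerHilb α β ⊗[ℂ] B.obj →ₗ[ℂ] cornerHilb α β :=
  toCorner α β ∘ₗ LinearMap.mul' ℂ C.obj ∘ₗ TensorProduct.map (incl α β) β.toFun

theorem incl_cornerLeft (a : A.obj) (m : cornerHilb α β) :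
    incl α β (cornerLeft α β (a ⊗ₜ m)) = α.toFun a * incl α β m := by
  change α.p * (α.toFun a * incl α β m) * β.p = _
  rw [← mul_assoc, p_mul_map, mul_assoc, incl_mul_p]

theorem incl_cornerRight (m : cornerHilb α β) (b : B.obj) :
    incl α β (cornerRight α β (m ⊗ₜ b)) = incl α β m * β.toFun b := by
  change α.p * (incl α β m * β.toFun b) * β.p = _
  rw [← mul_assoc, p_mul_incl, mul_assoc, map_mul_p]

/-- By the trace property the adjoint of x ↦ x m in C is n ↦ n m*. The factor appears because inner
products of A are rescaled inside C. -/
theorem adjoint_cornerLeft (m n : cornerHilb α β) :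
    LinearMap.adjoint (cornerLeft α β ∘ₗ (TensorProduct.mk ℂ _ _).flip m) n =
      (α.scale : ℂ) • α.coord (incl α β n * star (incl α β m)) := by
  refine ext_inner_left ℂ fun a => ?_
  rw [LinearMap.adjoint_inner_right, inner_smul_right, ← inner_coord]
  change inner ℂ (cornerLeft α β (a ⊗ₜ m)) n = _
  rw [← inner_incl, incl_cornerLeft, QSystem.inner_mul_right]

theorem adjoint_cornerRight (m n : cornerHilb α β) :
    LinearMap.adjoint (cornerRight α β ∘ₗ TensorProduct.mk ℂ _ _ m) n =
      (β.scale : ℂ) • β.coord (star (incl α β m) * incl α β n) := by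
  refine ext_inner_left ℂ fun b => ?_
  rw [LinearMap.adjoint_inner_right, inner_smul_right, ← inner_coord]
  change inner ℂ (cornerRight α β (m ⊗ₜ b)) n = _
  rw [← inner_incl, incl_cornerRight, QSystem.inner_mul_left]

theorem scale_mul_inner_one (a : A.obj) : α.scale * inner ℂ a 1 = inner ℂ (α.toFun a) α.p :=
  (α.inner_map a 1).symm

/-- With f the action on a fixed m, the adjoint of the action sends m to (id ⊗ f) `coev`. Acting
again multiplies out `coev` to 1 by associativity, leaving f 1 = m. -/
theorem cornerLeft_isometric :
    cornerLeft α β ∘ₗ LinearMap.adjoint (cornerLeft α β) = LinearMap.id := by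
  refine LinearMap.ext fun m => ?_
  set f := cornerLeft α β ∘ₗ (TensorProduct.mk ℂ _ _).flip m with hf
  have h1 : LinearMap.adjoint (cornerLeft α β) m = f.lTensor A.obj A.coev := by
    refine TensorProduct.ext_iff_inner_left.mpr fun a n => ?_
    rw [LinearMap.adjoint_inner_right, ← LinearMap.adjoint_inner_left (f.lTensor A.obj),
      LinearMap.adjoint_lTensor, LinearMap.lTensor_tmul, QSystem.inner_tmul_coev, hf,
      adjoint_cornerLeft, mul_smul_comm, inner_smul_left, Complex.conj_ofReal,
      scale_mul_inner_one, map_mul, map_coord, ← inner_incl, incl_cornerLeft]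
    symm
    simp only [← mul_assoc, map_mul_p]
    rw [QSystem.inner_mul_right, α.star_p, α.p_mul_p, QSystem.inner_mul_right, star_star,
      p_mul_incl]
  rw [LinearMap.comp_apply, h1]
  have h2 : cornerLeft α β ∘ₗ f.lTensor A.obj = f ∘ₗ A.mul := by
    refine TensorProduct.ext' fun x y => incl_injective α β ?_
    change incl α β (cornerLeft α β (x ⊗ₜ cornerLeft α β (y ⊗ₜ m))) =
      incl α β (cornerLeft α β ((x * y) ⊗ₜ m))
    rw [incl_cornerLeft, incl_cornerLeft, incl_cornerLeft, map_mul, mul_assoc]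
  refine (LinearMap.congr_fun h2 A.coev).trans ?_
  rw [LinearMap.comp_apply, A.mul_coev]
  refine incl_injective α β ?_
  change incl α β (cornerLeft α β (1 ⊗ₜ m)) = _
  rw [incl_cornerLeft]
  exact p_mul_incl α β m

theorem cornerRight_isometric :
    cornerRight α β ∘ₗ LinearMap.adjoint (cornerRight α β) = LinearMap.id := by
  refine LinearMap.ext fun m => ?_
  set f := cornerRight α β ∘ₗ TensorProduct.mk ℂ _ _ m with hf
  have h1 : LinearMap.adjoint (cornerRight α β) m = f.rTensor B.obj B.coev := by
    refine TensorProduct.ext_iff_inner_left.mpr fun n b => ?_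
    rw [LinearMap.adjoint_inner_right, ← LinearMap.adjoint_inner_left (f.rTensor B.obj),
      LinearMap.adjoint_rTensor, LinearMap.rTensor_tmul, QSystem.inner_tmul_coev, hf,
      adjoint_cornerRight, smul_mul_assoc, inner_smul_left, Complex.conj_ofReal,
      scale_mul_inner_one, map_mul, map_coord, ← inner_incl, incl_cornerRight]
    symm
    simp only [mul_assoc, p_mul_map]
    rw [QSystem.inner_mul_left, β.star_p, β.p_mul_p, QSystem.inner_mul_left, star_star,
      incl_mul_p]
  rw [LinearMap.comp_apply, h1]
  have h2 : cornerRight α β ∘ₗ f.rTensor B.obj = f ∘ₗ B.mul := by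
    refine TensorProduct.ext' fun x y => incl_injective α β ?_
    change incl α β (cornerRight α β (cornerRight α β (m ⊗ₜ x) ⊗ₜ y)) =
      incl α β (cornerRight α β (m ⊗ₜ (x * y)))
    rw [incl_cornerRight, incl_cornerRight, incl_cornerRight, map_mul, mul_assoc]
  refine (LinearMap.congr_fun h2 B.coev).trans ?_
  rw [LinearMap.comp_apply, B.mul_coev]
  refine incl_injective α β ?_
  change incl α β (cornerRight α β (m ⊗ₜ 1)) = _
  rw [incl_cornerRight]
  exact incl_mul_p α β m

/-- The bimodule `p C q`. -/
noncomputable def bimodule : QBimodule A B where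
  obj := cornerHilb α β
  left := cornerLeft α β
  right := cornerRight α β
  left_graded g h a ha m hm := by
    change incl α β (cornerLeft α β (a ⊗ₜ m)) ∈ C.obj.deg (α.shift * (g * h) * β.shift⁻¹)
    rw [incl_cornerLeft]
    have := C.mul_mem_deg (α.map_mem g a ha)
      (show incl α β m ∈ C.obj.deg (α.shift * h * β.shift⁻¹) from hm)
    simpa [mul_assoc] using this
  right_graded g h m hm b hb := by
    change incl α β (cornerRight α β (m ⊗ₜ b)) ∈ C.obj.deg (α.shift * (g * h) * β.shift⁻¹)
    rw [incl_cornerRight]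
    have := C.mul_mem_deg (show incl α β m ∈ C.obj.deg (α.shift * g * β.shift⁻¹) from hm)
      (β.map_mem h b hb)
    simpa [mul_assoc] using this
  left_assoc := by
    refine TensorProduct.ext_threefold fun a b m => incl_injective α β ?_
    change incl α β (cornerLeft α β ((a * b) ⊗ₜ m)) =
      incl α β (cornerLeft α β (a ⊗ₜ cornerLeft α β (b ⊗ₜ m)))
    rw [incl_cornerLeft, incl_cornerLeft, incl_cornerLeft, map_mul, mul_assoc]
  left_unit := by
    refine TensorProduct.ext (LinearMap.ext_ring (LinearMap.ext fun m => incl_injective α β ?_))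
    change incl α β (cornerLeft α β (1 ⊗ₜ m)) = incl α β ((1 : ℂ) • m)
    rw [incl_cornerLeft, one_smul]
    exact p_mul_incl α β m
  right_assoc := by
    refine TensorProduct.ext_threefold fun m a b => incl_injective α β ?_
    change incl α β (cornerRight α β (cornerRight α β (m ⊗ₜ a) ⊗ₜ b)) =
      incl α β (cornerRight α β (m ⊗ₜ (a * b)))
    rw [incl_cornerRight, incl_cornerRight, incl_cornerRight, map_mul, mul_assoc]
  right_unit := by
    refine TensorProduct.ext (LinearMap.ext fun m => LinearMap.ext_ring (incl_injective α β ?_))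
    change incl α β (cornerRight α β (m ⊗ₜ 1)) = incl α β ((1 : ℂ) • m)
    rw [incl_cornerRight, one_smul]
    exact incl_mul_p α β m
  left_right := by
    refine TensorProduct.ext_threefold fun a m b => incl_injective α β ?_
    change incl α β (cornerRight α β (cornerLeft α β (a ⊗ₜ m) ⊗ₜ b)) =
      incl α β (cornerLeft α β (a ⊗ₜ cornerRight α β (m ⊗ₜ b)))
    rw [incl_cornerRight, incl_cornerLeft, incl_cornerLeft, incl_cornerRight, mul_assoc]
  left_isometric := cornerLeft_isometric α β
  right_isometric := cornerRight_isometric α β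

/-- The map `m ⊗ n ↦ m n` from `p C q ⊗ q C p` to `A`, normalized to be a partial isometry. -/
noncomputable def pairing : cornerHilb α β ⊗[ℂ] cornerHilb β α →ₗ[ℂ] A.obj :=
  (Real.sqrt (α.scale * β.scale) : ℂ) • α.coord ∘ₗ LinearMap.mul' ℂ C.obj ∘ₗ
    TensorProduct.map (incl α β) (incl β α)

theorem pairing_tmul (m : cornerHilb α β) (n : cornerHilb β α) : pairing α β (m ⊗ₜ n) =
    (Real.sqrt (α.scale * β.scale) : ℂ) • α.coord (incl α β m * incl β α n) := rfl

theorem coord_map_mul (a : A.obj) (c : C.obj) : α.coord (α.toFun a * c) = a * α.coord c := by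
  rw [← coord_compress, ← coord_map α (a * _), map_mul, map_coord]
  rw [← mul_assoc, p_mul_map, ← mul_assoc, ← mul_assoc, map_mul_p]

theorem coord_mul_map (a : A.obj) (c : C.obj) : α.coord (c * α.toFun a) = α.coord c * a := by
  rw [← coord_compress, ← coord_map α (_ * a), map_mul, map_coord]
  rw [mul_assoc, mul_assoc, map_mul_p, mul_assoc, mul_assoc, p_mul_map]

theorem pairing_mem {g h : G} {m : cornerHilb α β} (hm : m ∈ (cornerHilb α β).deg g)
    {n : cornerHilb β α} (hn : n ∈ (cornerHilb β α).deg h) :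
    pairing α β (m ⊗ₜ n) ∈ A.obj.deg (g * h) := by
  rw [pairing_tmul]
  refine Submodule.smul_mem _ _ (coord_mem α ?_)
  have := C.mul_mem_deg (show incl α β m ∈ C.obj.deg (α.shift * g * β.shift⁻¹) from hm)
    (show incl β α n ∈ C.obj.deg (β.shift * h * α.shift⁻¹) from hn)
  simpa [mul_assoc] using this

/-- Both sides are `β.scale` times ⟨m'n', mn⟩ computed in C. On the left the square root contributes
both scales and passing from A to C absorbs `α.scale`; on the right one of the two factors `β.scale`
is absorbed in passing from B to C. The trace property does the rest. -/
theorem inner_pairing (m m' : cornerHilb α β) (n n' : cornerHilb β α) :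
    inner ℂ (pairing α β (m' ⊗ₜ n')) (pairing α β (m ⊗ₜ n)) =
      inner ℂ (((β.scale : ℂ) • β.coord (star (incl α β m) * incl α β m')) *
        ((β.scale : ℂ) • β.coord (incl β α n' * star (incl β α n)))) 1 := by
  have h1 : β.toFun (β.coord (star (incl α β m) * incl α β m')) =
      star (incl α β m) * incl α β m' := by
    rw [map_coord, ← mul_assoc, ← β.star_p, ← star_mul, incl_mul_p, mul_assoc, β.star_p,
      incl_mul_p]
  have h2 : β.toFun (β.coord (incl β α n' * star (incl β α n))) =
      incl β α n' * star (incl β α n) := by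
    rw [map_coord, ← mul_assoc, p_mul_incl, mul_assoc, ← β.star_p, ← star_mul, p_mul_incl]
  have h3 : α.toFun (α.coord (incl α β m' * incl β α n')) = incl α β m' * incl β α n' := by
    rw [map_coord, ← mul_assoc, p_mul_incl, mul_assoc, incl_mul_p]
  rw [pairing_tmul, pairing_tmul, inner_smul_left, inner_smul_right, Complex.conj_ofReal,
    smul_mul_assoc, inner_smul_left, mul_smul_comm, inner_smul_left, Complex.conj_ofReal,
    scale_mul_inner_one, map_mul, h1, h2, ← mul_assoc, ← Complex.ofReal_mul,
    Real.mul_self_sqrt (mul_pos α.scale_pos β.scale_pos).le, Complex.ofReal_mul,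
    mul_comm (α.scale : ℂ), mul_assoc, ← inner_coord, h3]
  congr 1
  symm
  rw [← mul_assoc, QSystem.inner_mul_right, star_star, p_mul_incl, mul_assoc,
    QSystem.inner_mul_left, star_star]

theorem pairing_surjective
    (hfull : ∃ (ι : Type) (_ : Fintype ι) (x y : ι → C.obj),
      ∑ i, α.p * x i * β.p * y i * α.p = α.p) : Function.Surjective (pairing α β) := by
  have hs : (Real.sqrt (α.scale * β.scale) : ℂ) ≠ 0 := by
    have := Real.sqrt_pos.mpr (mul_pos α.scale_pos β.scale_pos)
    exact_mod_cast this.ne'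
  obtain ⟨ι, _, x, y, hxy⟩ := hfull
  intro a
  -- Multiplying the expression of p as an element of p C q C p by the image of a gives a preimage
  -- of a.
  refine ⟨∑ i, (Real.sqrt (α.scale * β.scale) : ℂ)⁻¹ •
    (toCorner α β (x i) ⊗ₜ toCorner β α (y i * α.toFun a)), ?_⟩
  rw [map_sum]
  have h : ∀ i, α.p * x i * β.p * (β.p * (y i * α.toFun a) * α.p) =
      (α.p * x i * β.p * y i * α.p) * α.toFun a := fun i => by
    simp only [mul_assoc, map_mul_p, p_mul_map]
    rw [← mul_assoc β.p β.p, p_mul_p]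
  have h' : ∀ i, pairing α β ((Real.sqrt (α.scale * β.scale) : ℂ)⁻¹ •
      (toCorner α β (x i) ⊗ₜ toCorner β α (y i * α.toFun a))) =
      α.coord ((α.p * x i * β.p * y i * α.p) * α.toFun a) := fun i => by
    rw [map_smul, pairing_tmul, smul_smul, inv_mul_cancel₀ hs, one_smul]
    exact congrArg _ (h i)
  rw [Finset.sum_congr rfl fun i _ => h' i, ← map_sum, ← Finset.sum_mul, hxy, p_mul_map, coord_map]

theorem pairing_cornerLeft (a : A.obj) (m : cornerHilb α β) (n : cornerHilb β α) :
    pairing α β (cornerLeft α β (a ⊗ₜ m) ⊗ₜ n) = a * pairing α β (m ⊗ₜ n) := by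
  rw [pairing_tmul, pairing_tmul, incl_cornerLeft, mul_assoc, coord_map_mul, mul_smul_comm]

theorem pairing_cornerRight (m : cornerHilb α β) (n : cornerHilb β α) (a : A.obj) :
    pairing α β (m ⊗ₜ cornerRight β α (n ⊗ₜ a)) = pairing α β (m ⊗ₜ n) * a := by
  rw [pairing_tmul, pairing_tmul, incl_cornerRight, ← mul_assoc, coord_mul_map, smul_mul_assoc]

theorem pairing_map_coev (m : cornerHilb α β) (n : cornerHilb β α) :
    pairing α β (TensorProduct.map (cornerRight α β ∘ₗ TensorProduct.mk ℂ _ _ m)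
      (cornerLeft β α ∘ₗ (TensorProduct.mk ℂ _ _).flip n) B.coev) = pairing α β (m ⊗ₜ n) := by
  have key : pairing α β ∘ₗ (TensorProduct.map (cornerRight α β ∘ₗ TensorProduct.mk ℂ _ _ m)
      (cornerLeft β α ∘ₗ (TensorProduct.mk ℂ _ _).flip n)) =
      (pairing α β ∘ₗ (TensorProduct.mk ℂ _ _).flip n ∘ₗ cornerRight α β ∘ₗ
        TensorProduct.mk ℂ _ _ m) ∘ₗ B.mul := by
    refine TensorProduct.ext' fun x y => ?_
    change pairing α β (cornerRight α β (m ⊗ₜ x) ⊗ₜ cornerLeft β α (y ⊗ₜ n)) =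
      pairing α β (cornerRight α β (m ⊗ₜ (x * y)) ⊗ₜ n)
    rw [pairing_tmul, pairing_tmul, incl_cornerLeft, incl_cornerRight, incl_cornerRight, map_mul]
    simp only [mul_assoc]
  refine (LinearMap.congr_fun key B.coev).trans ?_
  rw [LinearMap.comp_apply, B.mul_coev]
  change pairing α β (cornerRight α β (m ⊗ₜ 1) ⊗ₜ n) = _
  rw [pairing_tmul, pairing_tmul, incl_cornerRight]
  change _ • α.coord (incl α β m * β.p * _) = _
  rw [incl_mul_p]

theorem isRelativeTensor_bimodule
    (hfull : ∃ (ι : Type) (_ : Fintype ι) (x y : ι → C.obj),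
      ∑ i, α.p * x i * β.p * y i * α.p = α.p) :
    QBimodule.IsRelativeTensor (bimodule α β) (bimodule β α) (QBimodule.regular A) := by
  refine QBimodule.isRelativeTensor_of_surjective _ _ _ (pairing α β)
    (fun g h m hm n hn => pairing_mem α β hm hn) (fun m n m' n' => ?_)
    (pairing_surjective α β hfull) (fun m n => ?_) (pairing_cornerLeft α β)
    (pairing_cornerRight α β)
  · rw [QBimodule.inner_relativeProjector]
    refine (inner_pairing α β m m' n n').trans ?_
    exact (congrArg₂ (fun u v => inner ℂ (u * v) (1 : B.obj)) (adjoint_cornerRight α β m m')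
      (adjoint_cornerLeft β α n n')).symm
  · rw [QBimodule.relativeProjector_tmul]
    exact pairing_map_coev α β m n

/-- The hypotheses say that each of the two projections lies in the ideal generated by the other; p
C q and q C p are then inverse bimodules. -/
theorem morita
    (hα : ∃ (ι : Type) (_ : Fintype ι) (x y : ι → C.obj),
      ∑ i, α.p * x i * β.p * y i * α.p = α.p)
    (hβ : ∃ (ι : Type) (_ : Fintype ι) (x y : ι → C.obj),
      ∑ i, β.p * x i * α.p * y i * β.p = β.p) : A.Morita B :=
  ⟨bimodule α β, bimodule β α, _, _, isRelativeTensor_bimodule α β hα,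
    QBimodule.Isomorphic.refl _, isRelativeTensor_bimodule β α hβ, QBimodule.Isomorphic.refl _⟩

end CornerEmbedding

/-! ### Pairings attached to a Morita equivalence -/

namespace QBimodule

variable {G : Type} [Group G] {A B C : QSystem G}

theorem right_right (M : QBimodule A B) (m : M.obj) (b b' : B.obj) :
    M.right (M.right (m ⊗ₜ b) ⊗ₜ b') = M.right (m ⊗ₜ (b * b')) :=
  LinearMap.congr_fun M.right_assoc ((m ⊗ₜ b) ⊗ₜ b')

theorem right_one (M : QBimodule A B) (m : M.obj) : M.right (m ⊗ₜ 1) = m := by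
  have := LinearMap.congr_fun M.right_unit (m ⊗ₜ (1 : ℂ))
  simpa [QSystem.unit_apply_one] using this

theorem right_left_tmul (M : QBimodule A B) (a : A.obj) (m : M.obj) (b : B.obj) :
    M.right (M.left (a ⊗ₜ m) ⊗ₜ b) = M.left (a ⊗ₜ M.right (m ⊗ₜ b)) :=
  LinearMap.congr_fun M.left_right ((a ⊗ₜ m) ⊗ₜ b)

/-- The projector touches M only through the right action of B. This lets B-linear endomorphisms of
M descend to M ⊗_B N. -/
theorem relativeProjector_comp_rTensor (M : QBimodule A B) (N : QBimodule B C)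
    (φ : M.obj →ₗ[ℂ] M.obj) (hφ : ∀ m b, φ (M.right (m ⊗ₜ b)) = M.right (φ m ⊗ₜ b)) :
    relativeProjector M N ∘ₗ φ.rTensor N.obj = φ.rTensor N.obj ∘ₗ relativeProjector M N := by
  refine TensorProduct.ext' fun m n => ?_
  rw [LinearMap.comp_apply, LinearMap.comp_apply, LinearMap.rTensor_tmul, relativeProjector_tmul,
    relativeProjector_tmul]
  have key : TensorProduct.map (M.right ∘ₗ TensorProduct.mk ℂ _ _ (φ m))
      (N.left ∘ₗ (TensorProduct.mk ℂ _ _).flip n) =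
      φ.rTensor N.obj ∘ₗ TensorProduct.map (M.right ∘ₗ TensorProduct.mk ℂ _ _ m)
      (N.left ∘ₗ (TensorProduct.mk ℂ _ _).flip n) := by
    refine TensorProduct.ext' fun x y => ?_
    change M.right (φ m ⊗ₜ x) ⊗ₜ N.left (y ⊗ₜ n) = φ (M.right (m ⊗ₜ x)) ⊗ₜ N.left (y ⊗ₜ n)
    rw [hφ]
  exact LinearMap.congr_fun key _

theorem relativeProjector_comp_lTensor (M : QBimodule A B) (N : QBimodule B C)
    (φ : N.obj →ₗ[ℂ] N.obj) (hφ : ∀ b n, φ (N.left (b ⊗ₜ n)) = N.left (b ⊗ₜ φ n)) :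
    relativeProjector M N ∘ₗ φ.lTensor M.obj = φ.lTensor M.obj ∘ₗ relativeProjector M N := by
  refine TensorProduct.ext' fun m n => ?_
  rw [LinearMap.comp_apply, LinearMap.comp_apply, LinearMap.lTensor_tmul, relativeProjector_tmul,
    relativeProjector_tmul]
  have key : TensorProduct.map (M.right ∘ₗ TensorProduct.mk ℂ _ _ m)
      (N.left ∘ₗ (TensorProduct.mk ℂ _ _).flip (φ n)) =
      φ.lTensor M.obj ∘ₗ TensorProduct.map (M.right ∘ₗ TensorProduct.mk ℂ _ _ m)
      (N.left ∘ₗ (TensorProduct.mk ℂ _ _).flip n) := by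
    refine TensorProduct.ext' fun x y => ?_
    change M.right (m ⊗ₜ x) ⊗ₜ N.left (y ⊗ₜ φ n) = M.right (m ⊗ₜ x) ⊗ₜ φ (N.left (y ⊗ₜ n))
    rw [hφ]
  exact LinearMap.congr_fun key _

/-- A relative tensor product isomorphic to the regular bimodule, as a bilinear pairing. -/
theorem IsRelativeTensor.exists_pairing {M : QBimodule A B} {N : QBimodule B A}
    {T : QBimodule A A} (hT : IsRelativeTensor M N T) (hA : Isomorphic T (regular A)) :
    ∃ Θ : M.obj ⊗[ℂ] N.obj →ₗ[ℂ] A.obj, GradedHilb.IsGradedTensor Θ ∧ Function.Surjective Θ ∧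
      (∀ a m n, Θ (M.left (a ⊗ₜ m) ⊗ₜ n) = a * Θ (m ⊗ₜ n)) ∧
      (∀ m n a, Θ (m ⊗ₜ N.right (n ⊗ₜ a)) = Θ (m ⊗ₜ n) * a) ∧
      ∀ t, Θ t = 0 ↔ relativeProjector M N t = 0 := by
  obtain ⟨S, hgr, hP, hid, hl, hr⟩ := hT
  obtain ⟨f, hf, hfl, hfr⟩ := hA
  have hP' : ∀ t, LinearMap.adjoint S (S t) = relativeProjector M N t := LinearMap.congr_fun hP
  have hid' : ∀ t, S (LinearMap.adjoint S t) = t := LinearMap.congr_fun hid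
  have hSP : ∀ t, S (relativeProjector M N t) = S t := fun t => by rw [← hP', hid']
  refine ⟨f.toLinearMap ∘ₗ S, fun g h v hv w hw => hf _ _ (hgr g h v hv w hw), fun a => ?_,
    fun a m n => ?_, fun m n a => ?_, fun t => ?_⟩
  · refine ⟨LinearMap.adjoint S (f.symm a), ?_⟩
    change f (S (LinearMap.adjoint S (f.symm a))) = a
    rw [hid']
    exact f.apply_symm_apply a
  · have h1 := LinearMap.congr_fun hfl (a ⊗ₜ S (m ⊗ₜ n))
    refine Eq.trans ?_ h1
    change f (S _) = f (T.left (a ⊗ₜ S (m ⊗ₜ n)))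
    have h2 := LinearMap.congr_fun (relativeProjector_comp_rTensor M N
      (M.left ∘ₗ TensorProduct.mk ℂ _ _ a) fun m b => (right_left_tmul M a m b).symm) (m ⊗ₜ n)
    have h3 : M.left.rTensor N.obj ∘ₗ
      (TensorProduct.assoc ℂ A.obj M.obj N.obj).symm.toLinearMap ∘ₗ TensorProduct.mk ℂ _ _ a =
        (M.left ∘ₗ TensorProduct.mk ℂ _ _ a).rTensor N.obj := TensorProduct.ext' fun m n => rfl
    have h4 := LinearMap.congr_fun h3 (relativeProjector M N (m ⊗ₜ n))
    -- The induced action passes through S†S, the projector, which commutes with the action of a and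
    -- is absorbed by S.
    have h5 : T.left (a ⊗ₜ S (m ⊗ₜ n)) = S ((M.left ∘ₗ TensorProduct.mk ℂ _ _ a).rTensor N.obj
        (relativeProjector M N (m ⊗ₜ n))) := by
      rw [← h4, ← hP', hl]
      rfl
    rw [LinearMap.comp_apply, LinearMap.comp_apply] at h2
    rw [h5, ← h2, hSP]
    rfl
  · have h1 := LinearMap.congr_fun hfr (S (m ⊗ₜ n) ⊗ₜ a)
    refine Eq.trans ?_ h1
    change f (S _) = f (T.right (S (m ⊗ₜ n) ⊗ₜ a))
    have h2 := LinearMap.congr_fun (relativeProjector_comp_lTensor M N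
      (N.right ∘ₗ (TensorProduct.mk ℂ _ _).flip a) fun b n => right_left_tmul N b n a) (m ⊗ₜ n)
    have h3 : N.right.lTensor M.obj ∘ₗ
      (TensorProduct.assoc ℂ M.obj N.obj A.obj).toLinearMap ∘ₗ (TensorProduct.mk ℂ _ _).flip a =
        (N.right ∘ₗ (TensorProduct.mk ℂ _ _).flip a).lTensor M.obj :=
      TensorProduct.ext' fun m n => rfl
    have h4 := LinearMap.congr_fun h3 (relativeProjector M N (m ⊗ₜ n))
    have h5 : T.right (S (m ⊗ₜ n) ⊗ₜ a) = S ((N.right ∘ₗ (TensorProduct.mk ℂ _ _).flip a).lTensor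
        M.obj (relativeProjector M N (m ⊗ₜ n))) := by
      rw [← h4, ← hP', hr]
      rfl
    rw [LinearMap.comp_apply, LinearMap.comp_apply] at h2
    rw [h5, ← h2, hSP]
    rfl
  · change f (S t) = 0 ↔ _
    rw [map_eq_zero_iff f f.injective, ← hP']
    exact ⟨fun h => by rw [h, map_zero], fun h => by rw [← hid' (S t), h, map_zero]⟩

/-- If `m ⊗_B n = 0` for all `n ∈ N`, where `N ⊗_A M ≅ B`, then `m = 0`. -/
theorem eq_zero_of_relativeProjector {M : QBimodule A B} {N : QBimodule B A}
    (Θ : N.obj ⊗[ℂ] M.obj →ₗ[ℂ] B.obj) (hΘ : Function.Surjective Θ)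
    (hl : ∀ b n m, Θ (N.left (b ⊗ₜ n) ⊗ₜ m) = b * Θ (n ⊗ₜ m)) {m : M.obj}
    (hm : ∀ n, relativeProjector M N (m ⊗ₜ n) = 0) : m = 0 := by
  have h1 : (M.right ∘ₗ TensorProduct.mk ℂ _ _ m) ∘ₗ Θ = 0 := by
    refine TensorProduct.ext' fun n m' => ?_
    -- Applying Θ(- ⊗ m') to the second leg of P(m ⊗ n) and then letting it act on the first leg
    -- recovers m Θ(n ⊗ m'), because `coev` multiplies to 1.
    have h2 : M.right ∘ₗ (Θ ∘ₗ (TensorProduct.mk ℂ _ _).flip m').lTensor M.obj ∘ₗ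
        TensorProduct.map (M.right ∘ₗ TensorProduct.mk ℂ _ _ m)
          (N.left ∘ₗ (TensorProduct.mk ℂ _ _).flip n) =
        (M.right ∘ₗ TensorProduct.mk ℂ _ _ m) ∘ₗ LinearMap.mulRight ℂ (Θ (n ⊗ₜ m')) ∘ₗ B.mul := by
      refine TensorProduct.ext' fun x y => ?_
      change M.right (M.right (m ⊗ₜ x) ⊗ₜ Θ (N.left (y ⊗ₜ n) ⊗ₜ m')) =
        M.right (m ⊗ₜ (x * y * Θ (n ⊗ₜ m')))
      rw [hl, right_right, mul_assoc]
    have h3 := LinearMap.congr_fun h2 B.coev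
    simp only [LinearMap.comp_apply, B.mul_coev] at h3
    rw [← LinearMap.comp_apply, ← relativeProjector_tmul, hm] at h3
    simp only [map_zero, LinearMap.mulRight_apply, one_mul] at h3
    exact h3.symm
  obtain ⟨t, ht⟩ := hΘ 1
  have h4 := LinearMap.congr_fun h1 t
  rw [LinearMap.comp_apply, ht] at h4
  rw [← M.right_one m]
  exact h4

/-- The endomorphism `m ↦ m f(g d)` of `M`, for `m` of degree `d`. -/
noncomputable def twist [Fintype G] (M : QBimodule A B) (f : G → B.obj) (g : G) :
    M.obj →ₗ[ℂ] M.obj :=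
  ∑ d, (M.right ∘ₗ (TensorProduct.mk ℂ _ _).flip (f (g * d))) ∘ₗ M.obj.proj d

theorem twist_of_mem [Fintype G] (M : QBimodule A B) (f : G → B.obj) (g : G) {d : G} {m : M.obj}
    (hm : m ∈ M.obj.deg d) : M.twist f g m = M.right (m ⊗ₜ f (g * d)) := by
  classical
  rw [twist, LinearMap.sum_apply, Finset.sum_eq_single d]
  · rw [LinearMap.comp_apply, M.obj.proj_of_mem hm]
    rfl
  · intro e _ he
    rw [LinearMap.comp_apply, M.obj.proj_of_mem_ne he hm, map_zero]
  · simp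

end QBimodule

/-! ### Morita invariance of the full centre -/

namespace QSystem

variable {G : Type} [Group G] {A B : QSystem G}

theorem Morita.symm (h : A.Morita B) : B.Morita A := by
  obtain ⟨M, N, T, T', h1, h2, h3, h4⟩ := h
  exact ⟨N, M, T', T, h3, h4, h1, h2⟩

/-- The full centre of `A` has a nonzero component of degree `k`. -/
def HasCentralElement (A : QSystem G) (k : G) : Prop :=
  ∃ f : G → A.obj, (∃ g, f g ≠ 0) ∧ (∀ g, f g ∈ A.obj.deg (g⁻¹ * k * g)) ∧
    ∀ g h, ∀ b ∈ A.obj.deg h, b * f (g * h) = f g * b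

/-- Centrality of f makes `twist f g` right B-linear, and commuting it past the left action of A_h
replaces g by g h. So it descends to M ⊗_B N ≅ A as a right A-linear map, that is, as left
multiplication by the image F g of 1, and F inherits the relation satisfied by f. -/
theorem Morita.hasCentralElement [Fintype G] {k : G} (hAB : A.Morita B)
    (hB : B.HasCentralElement k) : A.HasCentralElement k := by
  classical
  obtain ⟨M, N, T, T', hT, hTA, hT', hTB⟩ := hAB
  obtain ⟨Θ, hgr, hsurj, hl, hr, hker⟩ := hT.exists_pairing hTA
  obtain ⟨Θ', -, hsurj', hl', hr', -⟩ := hT'.exists_pairing hTB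
  obtain ⟨f, ⟨g₀, hg₀⟩, hfdeg, hf⟩ := hB
  have hφr : ∀ g m b, M.twist f g (M.right (m ⊗ₜ b)) = M.right (M.twist f g m ⊗ₜ b) := by
    intro g m b
    have h1 : M.twist f g ∘ₗ M.right = M.right ∘ₗ (M.twist f g).rTensor B.obj := by
      refine TensorProduct.ext (M.obj.linearMap_ext_deg fun d m hm =>
        B.obj.linearMap_ext_deg fun h b hb => ?_)
      change M.twist f g (M.right (m ⊗ₜ b)) = M.right (M.twist f g m ⊗ₜ b)
      rw [M.twist_of_mem f g (M.right_graded d h m hm b hb), M.twist_of_mem f g hm,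
        QBimodule.right_right, QBimodule.right_right, ← _root_.mul_assoc g d h, hf _ _ b hb]
    exact LinearMap.congr_fun h1 (m ⊗ₜ b)
  have hφl : ∀ g h, ∀ a ∈ A.obj.deg h, ∀ m, M.twist f g (M.left (a ⊗ₜ m)) =
      M.left (a ⊗ₜ M.twist f (g * h) m) := by
    intro g h a ha m
    have h1 : M.twist f g ∘ₗ M.left ∘ₗ TensorProduct.mk ℂ _ _ a =
        M.left ∘ₗ TensorProduct.mk ℂ _ _ a ∘ₗ M.twist f (g * h) := by
      refine M.obj.linearMap_ext_deg fun d m hm => ?_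
      change M.twist f g (M.left (a ⊗ₜ m)) = M.left (a ⊗ₜ M.twist f (g * h) m)
      rw [M.twist_of_mem f g (M.left_graded h d a ha m hm), M.twist_of_mem f _ hm,
        QBimodule.right_left_tmul, _root_.mul_assoc g h d]
    exact LinearMap.congr_fun h1 m
  have hwell : ∀ g t t', Θ t = Θ t' →
      Θ ((M.twist f g).rTensor N.obj t) = Θ ((M.twist f g).rTensor N.obj t') := by
    intro g t t' h
    rw [← sub_eq_zero, ← map_sub, hker] at h
    rw [← sub_eq_zero, ← map_sub, ← map_sub, hker, ← LinearMap.comp_apply,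
      QBimodule.relativeProjector_comp_rTensor M N _ (hφr g), LinearMap.comp_apply, h, map_zero]
  have hleft : ∀ a t, Θ ((M.left ∘ₗ TensorProduct.mk ℂ _ _ a).rTensor N.obj t) = a * Θ t := by
    intro a t
    have h1 : Θ ∘ₗ (M.left ∘ₗ TensorProduct.mk ℂ _ _ a).rTensor N.obj =
        LinearMap.mulLeft ℂ a ∘ₗ Θ := TensorProduct.ext' fun m n => hl a m n
    exact LinearMap.congr_fun h1 t
  have hright : ∀ a t, Θ ((N.right ∘ₗ (TensorProduct.mk ℂ _ _).flip a).lTensor M.obj t) =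
      Θ t * a := by
    intro a t
    have h1 : Θ ∘ₗ (N.right ∘ₗ (TensorProduct.mk ℂ _ _).flip a).lTensor M.obj =
        LinearMap.mulRight ℂ a ∘ₗ Θ := TensorProduct.ext' fun m n => hr m n a
    exact LinearMap.congr_fun h1 t
  have hproj : A.obj.proj 1 ∘ₗ Θ = Θ ∘ₗ ∑ d, TensorProduct.map (M.obj.proj d) (N.obj.proj d⁻¹) := by
    refine TensorProduct.ext (M.obj.linearMap_ext_deg fun d m hm =>
        N.obj.linearMap_ext_deg fun e n hn => ?_)
    change A.obj.proj 1 (Θ (m ⊗ₜ n)) =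
      Θ ((∑ d, TensorProduct.map (M.obj.proj d) (N.obj.proj d⁻¹)) (m ⊗ₜ n))
    rw [LinearMap.sum_apply, Finset.sum_eq_single d]
    · rw [TensorProduct.map_tmul, M.obj.proj_of_mem hm]
      by_cases he : d⁻¹ = e
      · subst he
        have := hgr d _ m hm n hn
        rw [mul_inv_cancel] at this
        rw [N.obj.proj_of_mem hn, A.obj.proj_of_mem this]
      · rw [N.obj.proj_of_mem_ne he hn, TensorProduct.tmul_zero, map_zero,
          A.obj.proj_of_mem_ne _ (hgr d e m hm n hn)]
        exact fun h' => he (inv_eq_of_mul_eq_one_right h'.symm)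
    · intro c _ hc
      rw [TensorProduct.map_tmul, M.obj.proj_of_mem_ne hc hm, TensorProduct.zero_tmul]
    · simp
  obtain ⟨t₀, ht₀⟩ := hsurj 1
  -- Only the degree-one part of a preimage of 1 matters, as 1 has degree one; the degree of F g can
  -- be read off from it.
  set t₁ := ∑ d, TensorProduct.map (M.obj.proj d) (N.obj.proj d⁻¹) t₀ with ht₁
  have hΘt₁ : Θ t₁ = 1 := by
    have := LinearMap.congr_fun hproj t₀
    rw [LinearMap.comp_apply, LinearMap.comp_apply, ht₀, A.obj.proj_of_mem A.one_mem_deg,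
      LinearMap.sum_apply] at this
    exact this.symm
  -- A right A-linear map on A is left multiplication by its value at 1: t and t₁ · Θ t have the
  -- same image under Θ, and `hwell` applies.
  have hF : ∀ g t, Θ ((M.twist f g).rTensor N.obj t) =
      Θ ((M.twist f g).rTensor N.obj t₁) * Θ t := by
    intro g t
    rw [← hright, ← LinearMap.comp_apply (LinearMap.lTensor _ _), LinearMap.lTensor_comp_rTensor,
      ← LinearMap.rTensor_comp_lTensor, LinearMap.comp_apply]
    refine hwell g _ _ ?_
    rw [hright, hΘt₁, one_mul]
  refine ⟨fun g => Θ ((M.twist f g).rTensor N.obj t₁), ?_, fun g => ?_, fun g h b hb => ?_⟩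
  · by_contra! h0
    refine hg₀ ?_
    -- If F vanishes, all twists vanish on M, so f g₀ annihilates M and therefore also B, the image
    -- of N ⊗ M.
    have h1 : ∀ g m, M.twist f g m = 0 := by
      intro g m
      refine QBimodule.eq_zero_of_relativeProjector Θ' hsurj' hl' fun n => ?_
      have h2 := hF g (m ⊗ₜ n)
      rwa [h0, zero_mul, LinearMap.rTensor_tmul, hker] at h2
    have h3 : M.right ∘ₗ (TensorProduct.mk ℂ _ _).flip (f g₀) = 0 := by
      refine M.obj.linearMap_ext_deg fun d m hm => ?_
      -- The index is chosen so that the twist acts on degree d exactly by f g₀.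
      have h4 := h1 (g₀ * d⁻¹) m
      rwa [M.twist_of_mem f _ hm, inv_mul_cancel_right] at h4
    have h5 : LinearMap.mulRight ℂ (f g₀) ∘ₗ Θ' = 0 := by
      refine TensorProduct.ext' fun n m => ?_
      change Θ' (n ⊗ₜ m) * f g₀ = 0
      rw [← hr']
      have h6 : M.right (m ⊗ₜ f g₀) = 0 := LinearMap.congr_fun h3 m
      rw [h6, TensorProduct.tmul_zero, map_zero]
    obtain ⟨t, ht⟩ := hsurj' 1
    have h7 := LinearMap.congr_fun h5 t
    rw [LinearMap.comp_apply, ht] at h7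
    simpa using h7
  · dsimp only
    rw [ht₁, map_sum, map_sum]
    refine Submodule.sum_mem _ fun d _ => ?_
    clear_value t₁
    clear ht₀ ht₁
    induction t₀ using TensorProduct.induction_on with
    | zero => simp
    | add x y hx hy =>
      rw [map_add, map_add, map_add]
      exact add_mem hx hy
    | tmul m n =>
      rw [TensorProduct.map_tmul, LinearMap.rTensor_tmul, M.twist_of_mem f g (M.obj.proj_mem d m)]
      have h1 := hgr _ _ _ (M.right_graded _ _ _ (M.obj.proj_mem d m) _ (hfdeg (g * d)))
        _ (N.obj.proj_mem d⁻¹ n)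
      convert h1 using 2
      group
  · dsimp only
    rw [← hleft, ← LinearMap.comp_apply (LinearMap.rTensor _ _), ← LinearMap.rTensor_comp]
    have h1 : (M.left ∘ₗ TensorProduct.mk ℂ _ _ b) ∘ₗ M.twist f (g * h) =
        M.twist f g ∘ₗ M.left ∘ₗ TensorProduct.mk ℂ _ _ b :=
      LinearMap.ext fun m => (hφl g h b hb m).symm
    rw [h1, LinearMap.rTensor_comp, LinearMap.comp_apply, hF, hleft, hΘt₁, mul_one]

end QSystem

/-! ### Twisted group algebras: central families and matrix representations -/

namespace TwistedGroupAlgebra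

variable {G K : Type} [Group G] [Group K] [Fintype K] [DecidableEq K] (φ : K →* G)
  (hφ : Function.Injective φ) (ψ : TwoCocycle K)

/-- The basis vector `x` of the twisted group algebra. -/
noncomputable def basisVec (x : K) : (twistedGroupAlgebra φ hφ ψ).obj :=
  (e x : EuclideanSpace ℂ K)

/-- The basis of group elements. -/
noncomputable def basis : Module.Basis K ℂ (twistedGroupAlgebra φ hφ ψ).obj :=
  (EuclideanSpace.basisFun K ℂ).toBasis

theorem basis_apply (x : K) : basis φ hφ ψ x = basisVec φ hφ ψ x := by
  change (EuclideanSpace.basisFun K ℂ).toBasis x = e x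
  simp [e]

theorem basisVec_mul (x y : K) : basisVec φ hφ ψ x * basisVec φ hφ ψ y =
    ((Real.sqrt (Fintype.card K) : ℂ)⁻¹ * ψ.toFun x y) • basisVec φ hφ ψ (x * y) :=
  mul_e ψ x y

theorem one_eq_smul_basisVec : (1 : (twistedGroupAlgebra φ hφ ψ).obj) =
    (Real.sqrt (Fintype.card K) : ℂ) • basisVec φ hφ ψ 1 :=
  unit_one

theorem basisVec_mem (x : K) :
    basisVec φ hφ ψ x ∈ (twistedGroupAlgebra φ hφ ψ).obj.deg (φ x) := by
  intro y hy
  have : y ≠ x := fun h => hy (by rw [h])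
  change (e x : EuclideanSpace ℂ K) y = 0
  simp [e, this]

theorem inner_basisVec (x y : K) :
    inner ℂ (basisVec φ hφ ψ x) (basisVec φ hφ ψ y) = if x = y then 1 else 0 :=
  inner_e x y

theorem basisVec_ne_zero (x : K) : basisVec φ hφ ψ x ≠ 0 := by
  rw [← basis_apply]
  exact (basis φ hφ ψ).ne_zero x

theorem eq_zero_of_mem_deg {g : G} (hg : ∀ x, φ x ≠ g) {v : (twistedGroupAlgebra φ hφ ψ).obj}
    (hv : v ∈ (twistedGroupAlgebra φ hφ ψ).obj.deg g) : v = 0 := by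
  refine (basis φ hφ ψ).repr.map_eq_zero_iff.mp (Finsupp.ext fun x => ?_)
  exact hv x (hg x)

theorem eq_smul_of_mem_deg {y : K} {v : (twistedGroupAlgebra φ hφ ψ).obj}
    (hv : v ∈ (twistedGroupAlgebra φ hφ ψ).obj.deg (φ y)) : ∃ c : ℂ, v = c • basisVec φ hφ ψ y := by
  refine ⟨(basis φ hφ ψ).repr v y, ?_⟩
  rw [← basis_apply]
  conv_lhs => rw [← (basis φ hφ ψ).sum_repr v]
  refine Finset.sum_eq_single y (fun x _ hx => ?_) (by simp)
  have : (basis φ hφ ψ).repr v x = 0 := hv x fun h => hx (hφ h)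
  rw [this, zero_smul]

theorem not_hasCentralElement {k : G} (hk : ∀ g x, φ x ≠ g⁻¹ * k * g) :
    ¬ (twistedGroupAlgebra φ hφ ψ).HasCentralElement k := by
  rintro ⟨f, ⟨g, hg⟩, hf, -⟩
  exact hg (eq_zero_of_mem_deg φ hφ ψ (hk g) (hf g))

/-- The family is c(y) times the basis vector x in degree φ y, and zero off the image of φ.
Commutativity keeps the degree of x fixed under conjugation by K, and `hc` is the centrality
relation tested on the basis vector z. -/
theorem hasCentralElement (hcomm : ∀ x y : K, x * y = y * x) (x : K) (c : K → ℂ) (hc1 : c 1 ≠ 0)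
    (hc : ∀ y z, c (y * z) * ψ.toFun z x = c y * ψ.toFun x z) :
    (twistedGroupAlgebra φ hφ ψ).HasCentralElement (φ x) := by
  classical
  set f : G → (twistedGroupAlgebra φ hφ ψ).obj :=
    fun g => if h : ∃ y, φ y = g then c h.choose • basisVec φ hφ ψ x else 0 with hf
  have hf1 : ∀ y, f (φ y) = c y • basisVec φ hφ ψ x := by
    intro y
    have h : ∃ z, φ z = φ y := ⟨y, rfl⟩
    rw [hf]
    dsimp only
    rw [dif_pos h, hφ h.choose_spec]
  have hf0 : ∀ g, (¬ ∃ y, φ y = g) → f g = 0 := fun g hg => dif_neg hg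
  refine ⟨f, ⟨φ 1, ?_⟩, fun g => ?_, fun g h b hb => ?_⟩
  · rw [hf1]
    exact smul_ne_zero hc1 (basisVec_ne_zero φ hφ ψ x)
  · by_cases hg : ∃ y, φ y = g
    · obtain ⟨y, rfl⟩ := hg
      rw [hf1, ← map_inv, ← map_mul, ← map_mul, mul_assoc, hcomm x y, inv_mul_cancel_left]
      exact Submodule.smul_mem _ _ (basisVec_mem φ hφ ψ x)
    · rw [hf0 g hg]
      exact zero_mem _
  · by_cases hh : ∃ z, φ z = h
    · obtain ⟨z, rfl⟩ := hh
      obtain ⟨β, rfl⟩ := eq_smul_of_mem_deg φ hφ ψ hb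
      by_cases hg : ∃ y, φ y = g
      · obtain ⟨y, rfl⟩ := hg
        rw [← map_mul, hf1, hf1, smul_mul_smul_comm, smul_mul_smul_comm, basisVec_mul,
          basisVec_mul, hcomm z x, smul_smul, smul_smul]
        congr 1
        linear_combination β * (Real.sqrt (Fintype.card K) : ℂ)⁻¹ * hc y z
      -- Extension by zero is consistent: right multiplication by φ z preserves the image of φ and
      -- its complement.
      · have hg' : ¬ ∃ y, φ y = g * φ z := by
          rintro ⟨y, hy⟩
          exact hg ⟨y * z⁻¹, by rw [map_mul, hy, map_inv, mul_inv_cancel_right]⟩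
        rw [hf0 g hg, hf0 _ hg', mul_zero, zero_mul]
    · rw [eq_zero_of_mem_deg φ hφ ψ (fun x hx => hh ⟨x, hx⟩) hb, zero_mul, mul_zero]

/-- A projective representation with this cocycle and linearly independent matrices gives an
injective algebra map between spaces of dimension n². -/
theorem isMatrixAlgebra {n : ℕ} (hn : 0 < n) (hK : Fintype.card K = n * n)
    (R : K → Matrix (Fin n) (Fin n) ℂ) (hR1 : R 1 = 1)
    (hR : ∀ x y, R x * R y = ψ.toFun x y • R (x * y)) (hli : LinearIndependent ℂ R) :
    (twistedGroupAlgebra φ hφ ψ).IsMatrixAlgebra := by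
  have hs := sqrt_card_ne_zero (K := K)
  set f : (twistedGroupAlgebra φ hφ ψ).obj →ₗ[ℂ] Matrix (Fin n) (Fin n) ℂ :=
    (basis φ hφ ψ).constr ℂ fun x => (Real.sqrt (Fintype.card K) : ℂ)⁻¹ • R x with hf
  have hfb : ∀ x, f (basisVec φ hφ ψ x) = (Real.sqrt (Fintype.card K) : ℂ)⁻¹ • R x := by
    intro x
    rw [← basis_apply, hf, Module.Basis.constr_basis]
  have hinj : Function.Injective f := by
    rw [← LinearMap.ker_eq_bot]
    have h1 : LinearIndependent ℂ fun x => f (basis φ hφ ψ x) := by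
      have := hli.units_smul fun _ => (Units.mk0 _ hs)⁻¹
      convert this using 1
      funext x
      rw [basis_apply, hfb]
      simp [Units.smul_def]
    refine LinearMap.ker_eq_bot'.mpr fun v hv => ?_
    rw [← (basis φ hφ ψ).sum_repr v, map_sum] at hv
    simp only [map_smul] at hv
    have h2 := Fintype.linearIndependent_iff.mp h1 _ hv
    exact (basis φ hφ ψ).repr.map_eq_zero_iff.mp (Finsupp.ext h2)
  have hrank : Module.finrank ℂ (twistedGroupAlgebra φ hφ ψ).obj =
      Module.finrank ℂ (Matrix (Fin n) (Fin n) ℂ) := by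
    rw [Module.finrank_eq_card_basis (basis φ hφ ψ), hK]
    simp [Module.finrank_matrix]
  refine ⟨n, hn, LinearEquiv.ofInjectiveOfFinrankEq f hinj hrank, fun x y => ?_, ?_⟩
  · change f (x * y) = f x * f y
    have h1 : f ∘ₗ LinearMap.mul' ℂ _ = LinearMap.mul' ℂ _ ∘ₗ TensorProduct.map f f := by
      refine TensorProduct.ext ((basis φ hφ ψ).ext fun x => (basis φ hφ ψ).ext fun y => ?_)
      change f (basis φ hφ ψ x * basis φ hφ ψ y) = f (basis φ hφ ψ x) * f (basis φ hφ ψ y)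
      rw [basis_apply, basis_apply, basisVec_mul, map_smul, hfb, hfb, hfb, smul_mul_smul_comm, hR,
        smul_smul, smul_smul]
      congr 1
      ring
    exact LinearMap.congr_fun h1 (x ⊗ₜ y)
  · change f 1 = 1
    rw [one_eq_smul_basisVec, map_smul, hfb, smul_smul, mul_inv_cancel₀ hs, one_smul, hR1]

end TwistedGroupAlgebra

/-! ### Clock and shift matrices -/

theorem pow_val_add_mul {p : ℕ} [NeZero p] {lam : ℂ} (hlam : lam ^ p = 1) (a b c : ZMod p) :
    lam ^ ((a + b).val * c.val) = lam ^ (a.val * c.val) * lam ^ (b.val * c.val) := by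
  rw [ZMod.val_add, ← pow_add, ← add_mul, pow_eq_pow_mod _ hlam, Nat.mod_mul_mod,
    ← pow_eq_pow_mod _ hlam]

theorem pow_val_mul_add {p : ℕ} [NeZero p] {lam : ℂ} (hlam : lam ^ p = 1) (a b c : ZMod p) :
    lam ^ (c.val * (a + b).val) = lam ^ (c.val * a.val) * lam ^ (c.val * b.val) := by
  rw [mul_comm, pow_val_add_mul hlam, mul_comm a.val, mul_comm b.val]

/-- The clock and shift matrices `Z ^ a X ^ b`. -/
noncomputable def clockShift (p : ℕ) [NeZero p] (lam : ℂ) (x : Multiplicative (ZMod p × ZMod p)) :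
    Matrix (ZMod p) (ZMod p) ℂ :=
  Matrix.of fun i j => if j = i + x.toAdd.2 then lam ^ (x.toAdd.1.val * i.val) else 0

theorem clockShift_one (p : ℕ) [NeZero p] (lam : ℂ) : clockShift p lam 1 = 1 := by
  ext i j
  simp [clockShift, Matrix.one_apply, eq_comm]

/-- Moving X ^ b past Z ^ a' costs λ ^ (b a'), which is the bicharacter. -/
theorem clockShift_mul {p : ℕ} [NeZero p] {lam : ℂ} (hlam : lam ^ p = 1)
    (x y : Multiplicative (ZMod p × ZMod p)) : clockShift p lam x * clockShift p lam y =
      (bicharacterCocycle p lam hlam).toFun x y • clockShift p lam (x * y) := by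
  ext i j
  simp only [Matrix.mul_apply, clockShift, Matrix.of_apply, Matrix.smul_apply, smul_eq_mul,
    bicharacterCocycle, toAdd_mul, Prod.fst_add, Prod.snd_add]
  rw [Finset.sum_eq_single (i + x.toAdd.2)]
  · simp only [if_true, ← add_assoc, mul_ite, mul_zero]
    congr 1
    rw [pow_val_add_mul hlam, pow_val_mul_add hlam, mul_comm x.toAdd.2.val]
    ring
  · intro k _ hk
    rw [if_neg hk, zero_mul]
  · simp

/-- The entries (i, i + b) of a vanishing combination isolate the coefficients with second index b
and form a Vandermonde system at the nodes λ ^ i, distinct because λ is primitive. -/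
theorem linearIndependent_clockShift {p : ℕ} [NeZero p] {lam : ℂ} (hlam : IsPrimitiveRoot lam p) :
    LinearIndependent ℂ (clockShift p lam) := by
  rw [Fintype.linearIndependent_iff]
  intro c hc x
  obtain ⟨n, rfl⟩ : ∃ n, p = n + 1 := ⟨p - 1, (Nat.succ_pred_eq_of_pos (NeZero.pos p)).symm⟩
  have h1 : ∀ b i : ZMod (n + 1), ∑ a : ZMod (n + 1),
      c (Multiplicative.ofAdd (a, b)) * (lam ^ i.val) ^ a.val = 0 := by
    intro b i
    have h2 := congrFun (congrFun hc i) (i + b)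
    rw [Matrix.sum_apply] at h2
    refine Eq.trans ?_ h2
    rw [← (Multiplicative.ofAdd (α := ZMod (n + 1) × ZMod (n + 1))).sum_comp,
      Fintype.sum_prod_type]
    refine Finset.sum_congr rfl fun a _ => ?_
    rw [Finset.sum_eq_single b]
    · simp [clockShift, ← pow_mul, mul_comm]
    · intro b' _ hb'
      simp [clockShift, hb'.symm]
    · simp
  have h3 : Function.Injective fun i : ZMod (n + 1) => lam ^ i.val := fun i j hij =>
    ZMod.val_injective _ (hlam.pow_inj (ZMod.val_lt i) (ZMod.val_lt j) hij)
  have h4 := Matrix.eq_zero_of_forall_index_sum_mul_pow_eq_zero (n := n + 1)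
    (v := fun a => c (Multiplicative.ofAdd (a, x.toAdd.2))) h3 (h1 x.toAdd.2)
  exact congrFun h4 x.toAdd.1

theorem isMatrixAlgebra_bicharacter {G : Type} [Group G] {p : ℕ} [NeZero p] {lam : ℂ}
    (hlam : IsPrimitiveRoot lam p) (φ : Multiplicative (ZMod p × ZMod p) →* G)
    (hφ : Function.Injective φ) :
    (twistedGroupAlgebra φ hφ (bicharacterCocycle p lam hlam.pow_eq_one)).IsMatrixAlgebra := by
  let ε := Fintype.equivFinOfCardEq (ZMod.card p)
  refine TwistedGroupAlgebra.isMatrixAlgebra φ hφ _ (NeZero.pos p) ?_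
    (fun x => Matrix.reindexAlgEquiv ℂ ℂ ε (clockShift p lam x)) ?_ ?_ ?_
  · rw [Fintype.card_multiplicative, Fintype.card_prod, ZMod.card]
  · rw [clockShift_one, map_one]
  · intro x y
    rw [← map_mul, clockShift_mul hlam.pow_eq_one, map_smul]
  · exact (linearIndependent_clockShift hlam).map'
      (Matrix.reindexAlgEquiv ℂ ℂ ε).toLinearEquiv.toLinearMap (LinearEquiv.ker _)

theorem isMatrixAlgebra_trivialQSystem (G : Type) [Group G] :
    (trivialQSystem G).IsMatrixAlgebra := by
  refine TwistedGroupAlgebra.isMatrixAlgebra _ _ _ one_pos ?_ (fun _ => 1) rfl ?_ ?_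
  · simp
  · intro x y
    simp [trivialCocycle]
  · exact LinearIndependent.of_subsingleton 1 one_ne_zero

theorem not_hasCentralElement_trivialQSystem {G : Type} [Group G] {k : G} (hk : k ≠ 1) :
    ¬ (trivialQSystem G).HasCentralElement k := by
  refine TwistedGroupAlgebra.not_hasCentralElement _ _ _ fun g x hx => hk ?_
  have h1 : (⊥ : Subgroup G).subtype x = 1 := Subgroup.mem_bot.mp x.2
  rw [h1] at hx
  rw [eq_comm, mul_assoc, inv_mul_eq_one, eq_comm] at hx
  exact mul_eq_right.mp hx

/-- For x = (0, 1) one has ψ(z, x) = 1 and ψ(x, z) = λ ^ z₁, so the coefficients must satisfy c(yz)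
= c(y) λ ^ z₁, solved by c(y) = λ ^ y₁. -/
theorem hasCentralElement_bicharacter {G : Type} [Group G] {p : ℕ} [NeZero p] [Fact (1 < p)]
    {lam : ℂ} (hlam : lam ^ p = 1) (φ : Multiplicative (ZMod p × ZMod p) →* G)
    (hφ : Function.Injective φ) :
    (twistedGroupAlgebra φ hφ (bicharacterCocycle p lam hlam)).HasCentralElement
      (φ (Multiplicative.ofAdd (0, 1))) := by
  refine TwistedGroupAlgebra.hasCentralElement φ hφ _ mul_comm _
    (fun y => lam ^ (y.toAdd.1.val * (1 : ZMod p).val)) (by simp) fun y z => ?_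
  simp only [bicharacterCocycle, toAdd_mul, toAdd_ofAdd, Prod.fst_add, pow_val_add_mul hlam]
  simp [ZMod.val_one]

/-! ### Minimal projections and their corners -/

namespace QSystem

variable {G : Type} [Group G] {A : QSystem G}

/-- A minimal projection of the component of degree `1`. -/
structure IsMinimalProjection (A : QSystem G) (p : A.obj) : Prop where
  mem : p ∈ A.obj.deg 1
  ne_zero : p ≠ 0
  star_eq : star p = p
  mul_self : p * p = p
  scalar : ∀ a ∈ A.obj.deg 1, ∃ c : ℂ, p * a * p = c • p

theorem mul_mem_deg_one {a b : A.obj} (ha : a ∈ A.obj.deg 1) (hb : b ∈ A.obj.deg 1) :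
    a * b ∈ A.obj.deg 1 := by
  simpa using A.mul_mem_deg ha hb

theorem star_mem_deg_one {a : A.obj} (ha : a ∈ A.obj.deg 1) : star a ∈ A.obj.deg 1 := by
  simpa using A.star_mem_deg ha

/-- The orthogonal projection of 1 to a minimal nonzero right ideal W of the degree-one part is a
self-adjoint left unit of W. Scalarity of its corner is Schur's lemma. -/
theorem exists_isMinimalProjection (h1 : (1 : A.obj) ≠ 0) : ∃ p, A.IsMinimalProjection p := by
  obtain ⟨W, ⟨hW0, hW1, hWmul⟩, hWmin⟩ := exists_minimal_of_wellFoundedLT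
    (fun W : Submodule ℂ A.obj => W ≠ ⊥ ∧ W ≤ A.obj.deg 1 ∧ ∀ w ∈ W, ∀ a ∈ A.obj.deg 1, w * a ∈ W)
    ⟨A.obj.deg 1, fun h => h1 ((Submodule.eq_bot_iff _).mp h 1 A.one_mem_deg), le_rfl,
      fun w hw a ha => mul_mem_deg_one hw ha⟩
  set p : A.obj := W.starProjection 1 with hp
  have hpW : p ∈ W := Submodule.starProjection_apply_mem _ _
  have hp1 : p ∈ A.obj.deg 1 := hW1 hpW
  have horth : ∀ v ∈ W, inner ℂ v (1 - p) = 0 := fun v hv =>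
    (Submodule.mem_orthogonal _ _).mp (Submodule.sub_starProjection_mem_orthogonal _) v hv
  have hpw : ∀ w ∈ W, p * w = w := by
    intro w hw
    have h2 : (1 - p) * w ∈ W := by
      rw [sub_mul, one_mul]
      exact sub_mem hw (hWmul p hpW w (hW1 hw))
    have h3 : inner ℂ ((1 - p) * w) ((1 - p) * w) = 0 := by
      -- The trace property moves w* across, turning orthogonality of 1 - p to W into the vanishing
      -- of the norm of (1 - p) w.
      have h4 := horth _ (hWmul _ h2 _ (star_mem_deg_one (hW1 hw)))
      rwa [inner_mul_right, star_star] at h4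
    have h5 := inner_self_eq_zero.mp h3
    rw [sub_mul, one_mul, sub_eq_zero] at h5
    exact h5.symm
  have hstar : star p = p := by
    have h2 : star p * (1 - p) = 0 := by
      have h3 : star p * (1 - p) ∈ A.obj.deg 1 :=
        mul_mem_deg_one (star_mem_deg_one hp1) (sub_mem A.one_mem_deg hp1)
      have h4 := horth _ (hWmul p hpW _ h3)
      rw [inner_mul_left] at h4
      exact inner_self_eq_zero.mp h4
    rw [mul_sub, mul_one, sub_eq_zero] at h2
    have h3 := congrArg star h2
    rw [star_star, star_mul, star_star] at h3
    exact h2.trans h3.symm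
  refine ⟨p, hp1, fun h0 => hW0 ?_, hstar, hpw p hpW, fun a ha => ?_⟩
  · refine (Submodule.eq_bot_iff _).mpr fun w hw => ?_
    rw [← hpw w hw, h0, zero_mul]
  · have hb : p * a * p ∈ W := hWmul _ (hWmul p hpW a ha) p hp1
    set b := p * a * p with hbdef
    have hbw : ∀ w ∈ W, b * w ∈ W := fun w hw => hWmul b hb w (hW1 hw)
    have : Nontrivial W := Submodule.nontrivial_iff_ne_bot.mpr hW0
    obtain ⟨c, hc⟩ := Module.End.exists_eigenvalue ((LinearMap.mulLeft ℂ b).restrict hbw)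
    obtain ⟨v, hv⟩ := hc.exists_hasEigenvector
    have hvb : b * v.1 = c • v.1 := congrArg Subtype.val hv.apply_eq_smul
    -- An eigenspace of left multiplication by b is stable under right multiplication, so by
    -- minimality it is all of W; applied to p this gives b = c p.
    set W' : Submodule ℂ A.obj := W ⊓ LinearMap.ker (LinearMap.mulLeft ℂ b - c • LinearMap.id)
      with hW'
    have hmem : ∀ w, w ∈ W' ↔ w ∈ W ∧ b * w = c • w := by
      intro w
      rw [hW', Submodule.mem_inf, LinearMap.mem_ker]
      simp [sub_eq_zero]
    have hle : W ≤ W' := by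
      refine hWmin ⟨?_, inf_le_left.trans hW1, fun w hw a ha => ?_⟩ inf_le_left
      · intro h0
        refine hv.2 (Subtype.ext ?_)
        exact (Submodule.eq_bot_iff _).mp h0 _ ((hmem _).mpr ⟨v.2, hvb⟩)
      · rw [hmem] at hw ⊢
        exact ⟨hWmul w hw.1 a ha, by rw [← _root_.mul_assoc, hw.2, smul_mul_assoc]⟩
    have h2 := ((hmem p).mp (hle hpW)).2
    refine ⟨c, ?_⟩
    rw [← h2, hbdef, _root_.mul_assoc _ p p, hpw p hpW]

/-- A homogeneous element of degree `h` of the corner `p A p` that is unitary there. -/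
structure IsHomogeneousUnitary (A : QSystem G) (p : A.obj) (h : G) (u : A.obj) : Prop where
  mem : u ∈ A.obj.deg h
  left : p * u = u
  right : u * p = u
  star_mul : star u * u = p
  mul_star : u * star u = p

namespace IsHomogeneousUnitary

variable {p : A.obj} {h k : G} {u v : A.obj}

theorem mul (hu : A.IsHomogeneousUnitary p h u)
    (hv : A.IsHomogeneousUnitary p k v) : A.IsHomogeneousUnitary p (h * k) (u * v) where
  mem := A.mul_mem_deg hu.mem hv.mem
  left := by rw [← _root_.mul_assoc, hu.left]
  right := by rw [_root_.mul_assoc, hv.right]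
  star_mul := by
    rw [StarMul.star_mul, _root_.mul_assoc, ← _root_.mul_assoc (star u), hu.star_mul, hv.left,
      hv.star_mul]
  mul_star := by
    rw [StarMul.star_mul, _root_.mul_assoc, ← _root_.mul_assoc v, hv.mul_star,
      ← _root_.mul_assoc, hu.right, hu.mul_star]

theorem star (hp : A.IsMinimalProjection p) (hu : A.IsHomogeneousUnitary p h u) :
    A.IsHomogeneousUnitary p h⁻¹ (star u) where
  mem := A.star_mem_deg hu.mem
  left := by
    have := congrArg Star.star hu.right
    rwa [StarMul.star_mul, hp.star_eq] at this
  right := by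
    have := congrArg Star.star hu.left
    rwa [StarMul.star_mul, hp.star_eq] at this
  star_mul := by rw [star_star, hu.mul_star]
  mul_star := by rw [star_star, hu.star_mul]

theorem one (hp : A.IsMinimalProjection p) : A.IsHomogeneousUnitary p 1 p where
  mem := hp.mem
  left := hp.mul_self
  right := hp.mul_self
  star_mul := by rw [hp.star_eq, hp.mul_self]
  mul_star := by rw [hp.star_eq, hp.mul_self]

theorem smul (hu : A.IsHomogeneousUnitary p h u) {c : ℂ} (hc : ‖c‖ = 1) :
    A.IsHomogeneousUnitary p h (c • u) where
  mem := Submodule.smul_mem _ _ hu.mem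
  left := by rw [mul_smul_comm, hu.left]
  right := by rw [smul_mul_assoc, hu.right]
  star_mul := by
    rw [star_smul, smul_mul_smul_comm, hu.star_mul]
    have : Star.star c * c = 1 := by
      change conj c * c = 1
      rw [Complex.conj_mul', hc]; simp
    rw [this, one_smul]
  mul_star := by
    rw [star_smul, smul_mul_smul_comm, hu.mul_star]
    have : c * Star.star c = 1 := by
      change c * conj c = 1
      rw [Complex.mul_conj', hc]; simp
    rw [this, one_smul]

theorem ne_zero (hp : A.IsMinimalProjection p) (hu : A.IsHomogeneousUnitary p h u) : u ≠ 0 := by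
  rintro rfl
  exact hp.ne_zero (by rw [← hu.mul_star, zero_mul])

theorem inner_self (hp : A.IsMinimalProjection p) (hu : A.IsHomogeneousUnitary p h u) :
    inner ℂ u u = inner ℂ p p := by
  rw [inner_eq_inner_one, hu.star_mul, inner_eq_inner_one A p p, hp.star_eq, hp.mul_self]

/-- The product u* b lies in the degree-one part of the corner, hence is a multiple of p. Thus every
degree occurs in the corner with multiplicity at most one. -/
theorem exists_eq_smul (hp : A.IsMinimalProjection p) (hu : A.IsHomogeneousUnitary p h u)
    {b : A.obj} (hb : b ∈ A.obj.deg h) (hl : p * b = b) (hr : b * p = b) :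
    ∃ c : ℂ, b = c • u := by
  have hmem : Star.star u * b ∈ A.obj.deg 1 := by
    have := A.mul_mem_deg (A.star_mem_deg hu.mem) hb
    rwa [inv_mul_cancel] at this
  obtain ⟨c, hc⟩ := hp.scalar _ hmem
  refine ⟨c, ?_⟩
  rw [← _root_.mul_assoc, (hu.star hp).left, _root_.mul_assoc, hr] at hc
  have : u * (Star.star u * b) = u * c • p := congrArg (u * ·) hc
  rwa [← _root_.mul_assoc, hu.mul_star, hl, mul_smul_comm, hu.right] at this

theorem exists_norm_eq_one (hp : A.IsMinimalProjection p) (hu : A.IsHomogeneousUnitary p h u)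
    (hv : A.IsHomogeneousUnitary p h v) : ∃ c : ℂ, ‖c‖ = 1 ∧ v = c • u := by
  obtain ⟨c, rfl⟩ := hu.exists_eq_smul hp hv.mem hv.left hv.right
  refine ⟨c, ?_, rfl⟩
  have h1 : ‖c • u‖ = ‖u‖ := by
    rw [norm_eq_sqrt_re_inner (𝕜 := ℂ), norm_eq_sqrt_re_inner (𝕜 := ℂ) u, hv.inner_self hp,
      hu.inner_self hp]
  rw [norm_smul] at h1
  exact mul_eq_right₀ (norm_ne_zero_iff.mpr (hu.ne_zero hp)) |>.mp h1

/-- The factor p matters only for n = 0, where u ^ 0 is the unit of A and not that of the corner. -/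
theorem pow (hp : A.IsMinimalProjection p) (hu : A.IsHomogeneousUnitary p h u) (n : ℕ) :
    A.IsHomogeneousUnitary p (h ^ n) (p * u ^ n) := by
  induction n with
  | zero => simpa using one hp
  | succ n ih =>
    have := ih.mul hu
    rwa [_root_.mul_assoc, ← pow_succ, ← pow_succ] at this

end IsHomogeneousUnitary

/-- Both b* b and b b* are scalar multiples of p, and the trace computes both scalars as (‖b‖ /
‖p‖)², so rescaling b makes it unitary. -/
theorem IsMinimalProjection.exists_unitary {p : A.obj} (hp : A.IsMinimalProjection p) {h : G}
    {b : A.obj} (hb : b ∈ A.obj.deg h) (hl : p * b = b) (hr : b * p = b) (hb0 : b ≠ 0) :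
    ∃ u, A.IsHomogeneousUnitary p h u := by
  have hl' : p * star b = star b := by
    have := congrArg star hr
    rwa [star_mul, hp.star_eq] at this
  have hr' : star b * p = star b := by
    have := congrArg star hl
    rwa [star_mul, hp.star_eq] at this
  have hpp : inner ℂ (1 : A.obj) p = (‖p‖ : ℂ) ^ 2 := by
    have h1 := A.inner_mul_right p 1 p
    rw [one_mul, hp.star_eq, hp.mul_self, inner_self_eq_norm_sq_to_K] at h1
    exact h1.symm
  have hnp : (‖p‖ : ℂ) ≠ 0 := by exact_mod_cast norm_ne_zero_iff.mpr hp.ne_zero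
  have hnb : (‖b‖ : ℂ) ≠ 0 := by exact_mod_cast norm_ne_zero_iff.mpr hb0
  have key : ∀ c : ℂ, inner ℂ (1 : A.obj) (c • p) = (‖b‖ : ℂ) ^ 2 →
      c = (‖b‖ / ‖p‖ : ℂ) ^ 2 := by
    intro c hc
    rw [inner_smul_right, hpp] at hc
    rw [div_pow, ← hc, mul_div_cancel_right₀ _ (pow_ne_zero _ hnp)]
  have h1 : star b * b = ((‖b‖ / ‖p‖ : ℂ) ^ 2) • p := by
    have hmem := A.mul_mem_deg (A.star_mem_deg hb) hb
    rw [inv_mul_cancel] at hmem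
    obtain ⟨c, hc⟩ := hp.scalar _ hmem
    rw [← _root_.mul_assoc, hl', _root_.mul_assoc, hr] at hc
    rw [hc, key c]
    rw [← hc, ← inner_eq_inner_one, inner_self_eq_norm_sq_to_K]
    rfl
  have h2 : b * star b = ((‖b‖ / ‖p‖ : ℂ) ^ 2) • p := by
    have hmem := A.mul_mem_deg hb (A.star_mem_deg hb)
    rw [mul_inv_cancel] at hmem
    obtain ⟨c, hc⟩ := hp.scalar _ hmem
    rw [← _root_.mul_assoc, hl, _root_.mul_assoc, hr'] at hc
    rw [hc, key c]
    rw [← hc, ← inner_mul_right, one_mul, inner_self_eq_norm_sq_to_K]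
    rfl
  have hs : star ((‖p‖ / ‖b‖ : ℂ)) = ‖p‖ / ‖b‖ := by
    rw [← Complex.ofReal_div]
    exact Complex.conj_ofReal _
  have h3 : (‖p‖ / ‖b‖ : ℂ) * (‖p‖ / ‖b‖ : ℂ) * (‖b‖ / ‖p‖ : ℂ) ^ 2 = 1 := by
    field_simp
  refine ⟨(‖p‖ / ‖b‖ : ℂ) • b, Submodule.smul_mem _ _ hb, by rw [mul_smul_comm, hl],
    by rw [smul_mul_assoc, hr], ?_, ?_⟩
  · rw [star_smul, smul_mul_smul_comm, h1, smul_smul, hs, h3, one_smul]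
  · rw [star_smul, smul_mul_smul_comm, h2, smul_smul, hs, h3, one_smul]

/-- The degrees that occur in the corner of a minimal projection. -/
def IsMinimalProjection.support {p : A.obj} (hp : A.IsMinimalProjection p) : Subgroup G where
  carrier := {h | ∃ u, A.IsHomogeneousUnitary p h u}
  mul_mem' := by
    rintro h k ⟨u, hu⟩ ⟨v, hv⟩
    exact ⟨u * v, hu.mul hv⟩
  one_mem' := ⟨p, IsHomogeneousUnitary.one hp⟩
  inv_mem' := by
    rintro h ⟨u, hu⟩
    exact ⟨star u, hu.star hp⟩

/-- Induction over the homogeneous elements of the corner of a minimal projection. -/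
theorem IsMinimalProjection.compress_mem [Fintype G] {p : A.obj} (hp : A.IsMinimalProjection p)
    {S : Submodule ℂ A.obj} (hS : ∀ h u, A.IsHomogeneousUnitary p h u → u ∈ S) (c : A.obj) :
    p * c * p ∈ S := by
  rw [← A.obj.sum_proj c, Finset.mul_sum, Finset.sum_mul]
  refine Submodule.sum_mem _ fun h _ => ?_
  by_cases h0 : p * A.obj.proj h c * p = 0
  · rw [h0]
    exact zero_mem _
  · have hmem : p * A.obj.proj h c * p ∈ A.obj.deg h := by
      have := A.mul_mem_deg (A.mul_mem_deg hp.mem (A.obj.proj_mem h c)) hp.mem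
      simpa using this
    have hl : p * (p * A.obj.proj h c * p) = p * A.obj.proj h c * p := by
      rw [← _root_.mul_assoc, ← _root_.mul_assoc, hp.mul_self]
    have hr : p * A.obj.proj h c * p * p = p * A.obj.proj h c * p := by
      rw [_root_.mul_assoc _ p p, hp.mul_self]
    obtain ⟨u, hu⟩ := hp.exists_unitary hmem hl hr h0
    obtain ⟨d, hd⟩ := hu.exists_eq_smul hp hmem hl hr
    rw [hd]
    exact Submodule.smul_mem _ _ (hS h u hu)

end QSystem

/-! ### Corners of matrix algebras -/

theorem Matrix.trace_mulLeft_mulRight {n : ℕ} (P : Matrix (Fin n) (Fin n) ℂ) :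
    LinearMap.trace ℂ _ (LinearMap.mulRight ℂ P ∘ₗ LinearMap.mulLeft ℂ P) = P.trace * P.trace := by
  rw [LinearMap.trace_eq_matrix_trace ℂ (Matrix.stdBasis ℂ (Fin n) (Fin n)), Matrix.trace,
    Fintype.sum_prod_type, Matrix.trace, Finset.sum_mul_sum]
  refine Finset.sum_congr rfl fun i _ => Finset.sum_congr rfl fun j _ => ?_
  rw [Matrix.diag_apply, LinearMap.toMatrix_apply, Matrix.stdBasis_eq_single]
  change (P * Matrix.single i j (1 : ℂ) * P : Matrix (Fin n) (Fin n) ℂ) i j = _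
  simp [Matrix.mul_apply, Matrix.single, Finset.sum_ite_eq, ite_and]

theorem Matrix.exists_natCast_eq_trace {n : ℕ} {P : Matrix (Fin n) (Fin n) ℂ} (hP : P * P = P) :
    ∃ r : ℕ, P.trace = r := by
  have h1 : IsIdempotentElem (Matrix.toLin' P) := by
    change Matrix.toLin' P ∘ₗ Matrix.toLin' P = _
    rw [← Matrix.toLin'_mul, hP]
  have h2 := ((LinearMap.isProj_range_iff_isIdempotentElem _).mpr h1).trace
  rw [Matrix.trace_toLin'_eq] at h2
  exact ⟨_, h2⟩

namespace QSystem

variable {G : Type} [Group G] {A : QSystem G}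

theorem IsMatrixAlgebra.exists_algEquiv (hA : A.IsMatrixAlgebra) :
    ∃ n : ℕ, 0 < n ∧ Nonempty (A.obj ≃ₐ[ℂ] Matrix (Fin n) (Fin n) ℂ) := by
  obtain ⟨n, hn, f, hf, hf1⟩ := hA
  exact ⟨n, hn, ⟨AlgEquiv.ofLinearEquiv f hf1 hf⟩⟩

theorem IsMatrixAlgebra.one_ne_zero (hA : A.IsMatrixAlgebra) : (1 : A.obj) ≠ 0 := by
  obtain ⟨n, hn, ⟨F⟩⟩ := hA.exists_algEquiv
  have : Nonempty (Fin n) := ⟨⟨0, hn⟩⟩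
  intro h
  have h1 := congrArg F h
  rw [map_one, map_zero] at h1
  exact _root_.one_ne_zero h1

/-- A nonzero element of a matrix algebra generates the unit ideal. -/
theorem IsMatrixAlgebra.exists_sum_eq_one (hA : A.IsMatrixAlgebra) {p : A.obj} (hp : p ≠ 0) :
    ∃ (ι : Type) (_ : Fintype ι) (x y : ι → A.obj), ∑ i, x i * p * y i = 1 := by
  obtain ⟨n, hn, ⟨F⟩⟩ := hA.exists_algEquiv
  have h1 : F p ≠ 0 := fun h => hp (F.injective (by rw [h, map_zero]))
  obtain ⟨i, j, hij⟩ : ∃ i j, F p i j ≠ 0 := by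
    by_contra! h
    exact h1 (Matrix.ext h)
  -- With P the matrix of p, the matrix units satisfy E_ki P E_jk = P_ij E_kk, and the E_kk sum to
  -- 1.
  refine ⟨Fin n, inferInstance, fun k => F.symm ((F p i j)⁻¹ • Matrix.single k i 1),
    fun k => F.symm (Matrix.single j k 1), F.injective ?_⟩
  rw [map_sum, map_one]
  simp only [_root_.map_mul, AlgEquiv.apply_symm_apply]
  ext a b
  rw [Matrix.sum_apply, Finset.sum_eq_single a]
  · by_cases hab : a = b
    · subst hab
      simp [Matrix.mul_apply, Matrix.single, ite_and, hij]
    · simp [Matrix.mul_apply, Matrix.single, ite_and, hab]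
  · intro k _ hk
    simp [Matrix.mul_apply, Matrix.single, ite_and, hk]
  · simp

theorem IsMatrixAlgebra.exists_smul_one (hA : A.IsMatrixAlgebra) {w : A.obj}
    (hw : ∀ a, a * w = w * a) : ∃ c : ℂ, w = c • (1 : A.obj) := by
  obtain ⟨n, hn, ⟨F⟩⟩ := hA.exists_algEquiv
  obtain ⟨c, hc⟩ := Matrix.mem_range_scalar_of_commute_single (M := F w) fun i j _ => by
    have := congrArg F (hw (F.symm (Matrix.single i j 1)))
    rwa [_root_.map_mul, _root_.map_mul, AlgEquiv.apply_symm_apply] at this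
  refine ⟨c, F.injective ?_⟩
  rw [map_smul, map_one, ← hc]
  ext i j
  simp [Matrix.scalar_apply, Matrix.diagonal_apply, Matrix.one_apply]

/-- The corners of a matrix algebra have trivial centre. -/
theorem IsMatrixAlgebra.exists_smul_of_corner (hA : A.IsMatrixAlgebra) {p : A.obj} (hp : p ≠ 0)
    (hpp : p * p = p) {z : A.obj} (hl : p * z = z) (hr : z * p = z)
    (hz : ∀ a, (p * a * p) * z = z * (p * a * p)) : ∃ c : ℂ, z = c • p := by
  obtain ⟨ι, _, x, y, hxy⟩ := hA.exists_sum_eq_one hp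
  have key : ∀ a : A.obj, p * a * z = z * a * p := by
    intro a
    have := hz a
    rw [_root_.mul_assoc, hl] at this
    rw [this, ← _root_.mul_assoc, ← _root_.mul_assoc, hr]
  -- This extends z to a central element of the whole algebra with p w p = z, which is then a
  -- scalar.
  set w := ∑ i, x i * z * y i with hw
  have hcomm : ∀ a, a * w = w * a := by
    intro a
    calc a * w = (∑ j, x j * p * y j) * a * w := by rw [hxy, one_mul]
      _ = ∑ j, ∑ i, x j * (p * (y j * a * x i) * z) * y i := by
        rw [hw, Finset.sum_mul, Finset.sum_mul_sum]
        simp only [_root_.mul_assoc]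
      _ = ∑ j, ∑ i, x j * (z * (y j * a * x i) * p) * y i := by simp only [key]
      _ = w * a * (∑ i, x i * p * y i) := by
        rw [hw, Finset.sum_mul, Finset.sum_mul_sum]
        simp only [_root_.mul_assoc]
      _ = w * a := by rw [hxy, mul_one]
  obtain ⟨c, hc⟩ := hA.exists_smul_one hcomm
  refine ⟨c, ?_⟩
  calc z = z * (∑ i, x i * p * y i) * p := by rw [hxy, mul_one, hr]
    _ = ∑ i, (z * x i * p) * y i * p := by
      rw [Finset.mul_sum, Finset.sum_mul]
      simp only [_root_.mul_assoc]
    _ = p * w * p := by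
      simp only [← key]
      rw [hw, Finset.mul_sum, Finset.sum_mul]
      simp only [_root_.mul_assoc]
    _ = c • p := by rw [hc, mul_smul_comm, mul_one, smul_mul_assoc, hpp]

/-- The dimension of p A p is computed twice: as the trace of a ↦ p a p, which is the square of the
rank of p as a matrix, and as the number of degrees, each of which contributes one unitary. -/
theorem IsMatrixAlgebra.exists_card_support [Fintype G] (hA : A.IsMatrixAlgebra) {p : A.obj}
    (hp : A.IsMinimalProjection p) : ∃ r : ℕ, Nat.card hp.support = r * r := by
  classical
  obtain ⟨n, hn, ⟨F⟩⟩ := hA.exists_algEquiv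
  set E : A.obj →ₗ[ℂ] A.obj := LinearMap.mulRight ℂ p ∘ₗ LinearMap.mulLeft ℂ p with hE
  have hEa : ∀ a, E a = p * a * p := fun a => rfl
  have hEE : IsIdempotentElem E := by
    refine LinearMap.ext fun a => ?_
    change E (E a) = E a
    rw [hEa, hEa, ← _root_.mul_assoc, ← _root_.mul_assoc, hp.mul_self, _root_.mul_assoc _ p p,
      hp.mul_self]
  have htr : LinearMap.trace ℂ _ E = (F p).trace * (F p).trace := by
    rw [← Matrix.trace_mulLeft_mulRight, ← LinearMap.trace_conj' E F.toLinearEquiv]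
    congr 1
    refine LinearMap.ext fun M => ?_
    change F (p * F.symm M * p) = F p * M * F p
    rw [_root_.map_mul, _root_.map_mul, AlgEquiv.apply_symm_apply]
  obtain ⟨r, hr⟩ := Matrix.exists_natCast_eq_trace (P := F p) (by rw [← _root_.map_mul, hp.mul_self])
  have hproj := ((LinearMap.isProj_range_iff_isIdempotentElem E).mpr hEE).trace
  choose u hu using fun h : hp.support => h.2
  have hli : LinearIndependent ℂ u := by
    refine linearIndependent_of_ne_zero_of_inner_eq_zero (fun h => (hu h).ne_zero hp) ?_
    intro h k hhk
    exact A.obj.inner_eq_zero_of_ne (fun h' => hhk (Subtype.ext h')) (hu h).mem (hu k).mem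
  have hspan : LinearMap.range E = Submodule.span ℂ (Set.range u) := by
    refine le_antisymm ?_ (Submodule.span_le.mpr ?_)
    · rintro _ ⟨a, rfl⟩
      refine hp.compress_mem (fun h v hv => ?_) a
      obtain ⟨c, hc⟩ := (hu ⟨h, v, hv⟩).exists_eq_smul hp hv.mem hv.left hv.right
      rw [hc]
      exact Submodule.smul_mem _ _ (Submodule.subset_span ⟨_, rfl⟩)
    · rintro _ ⟨h, rfl⟩
      exact ⟨u h, by rw [hEa, (hu h).left, (hu h).right]⟩
  refine ⟨r, ?_⟩
  have hcard := finrank_span_eq_card hli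
  rw [htr, hr, hspan, hcard] at hproj
  rw [Nat.card_eq_fintype_card]
  exact_mod_cast hproj.symm

/-- The support of the corner of a minimal projection in a matrix algebra is not a nontrivial
cyclic group. -/
theorem IsMatrixAlgebra.eq_one_of_support_le [Fintype G] (hA : A.IsMatrixAlgebra) {p : A.obj}
    (hp : A.IsMinimalProjection p) {h : G} (hh : h ∈ hp.support)
    (hle : ∀ k ∈ hp.support, ∃ n : ℕ, k = h ^ n) : h = 1 := by
  obtain ⟨u, hu⟩ := hh
  by_contra hne
  -- The corner is spanned by powers of u, so u is central in it and hence a multiple of p,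
  -- contradicting its degree h ≠ 1.
  obtain ⟨c, hc⟩ := hA.exists_smul_of_corner hp.ne_zero hp.mul_self hu.left hu.right fun a => by
    have hmem : p * a * p ∈ LinearMap.ker (LinearMap.mulRight ℂ u - LinearMap.mulLeft ℂ u) := by
      refine hp.compress_mem (fun k v hv => ?_) a
      obtain ⟨n, rfl⟩ := hle k ⟨v, hv⟩
      obtain ⟨d, rfl⟩ := (hu.pow hp n).exists_eq_smul hp hv.mem hv.left hv.right
      refine Submodule.smul_mem _ _ (sub_eq_zero.mpr ?_)
      change p * u ^ n * u = u * (p * u ^ n)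
      rw [_root_.mul_assoc, ← pow_succ, ← _root_.mul_assoc u, hu.right, pow_succ',
        ← _root_.mul_assoc, hu.left]
    exact sub_eq_zero.mp hmem
  refine hu.ne_zero hp (A.obj.eq_zero_of_mem_of_mem hne hu.mem ?_)
  rw [hc]
  exact Submodule.smul_mem _ _ hp.mem

end QSystem

/-! ### Corners as twisted group algebras -/

namespace QSystem

variable {G : Type} [Group G] {A : QSystem G}

/-- A projective representation of `K` by homogeneous unitaries that span a corner of `A` embeds the
twisted group algebra of `K` as that corner. -/
noncomputable def cornerEmbeddingOfUnitaries [Fintype G] {p : A.obj} (hp : A.IsMinimalProjection p)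
    {K : Type} [Group K] [Fintype K] [DecidableEq K] (φ : K →* G) (hφ : Function.Injective φ)
    (ψ : TwoCocycle K) (s : G) (u : K → A.obj)
    (hu : ∀ x, A.IsHomogeneousUnitary p (s * φ x * s⁻¹) (u x))
    (hmul : ∀ x y, u x * u y = ψ.toFun x y • u (x * y)) (hu1 : u 1 = p)
    (hsupp : ∀ h ∈ hp.support, ∃ x, h = s * φ x * s⁻¹) :
    CornerEmbedding A (twistedGroupAlgebra φ hφ ψ) :=
  let f : (twistedGroupAlgebra φ hφ ψ).obj →ₗ[ℂ] A.obj :=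
    (TwistedGroupAlgebra.basis φ hφ ψ).constr ℂ fun x => (Real.sqrt (Fintype.card K) : ℂ)⁻¹ • u x
  have hs : (Real.sqrt (Fintype.card K) : ℂ) ≠ 0 := TwistedGroupAlgebra.sqrt_card_ne_zero
  have hf : ∀ x, f (TwistedGroupAlgebra.basisVec φ hφ ψ x) =
      (Real.sqrt (Fintype.card K) : ℂ)⁻¹ • u x := fun x => by
    rw [← TwistedGroupAlgebra.basis_apply]
    exact Module.Basis.constr_basis _ _ _ _
  have hf1 : f 1 = p := by
    rw [TwistedGroupAlgebra.one_eq_smul_basisVec, map_smul, hf, smul_smul, mul_inv_cancel₀ hs,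
      one_smul, hu1]
  { toFun := f
    map_mul := fun a b => by
      have h1 : f ∘ₗ LinearMap.mul' ℂ _ = LinearMap.mul' ℂ _ ∘ₗ TensorProduct.map f f := by
        refine TensorProduct.ext ((TwistedGroupAlgebra.basis φ hφ ψ).ext fun x =>
          (TwistedGroupAlgebra.basis φ hφ ψ).ext fun y => ?_)
        change f (TwistedGroupAlgebra.basis φ hφ ψ x * TwistedGroupAlgebra.basis φ hφ ψ y) =
          f (TwistedGroupAlgebra.basis φ hφ ψ x) * f (TwistedGroupAlgebra.basis φ hφ ψ y)
        rw [TwistedGroupAlgebra.basis_apply, TwistedGroupAlgebra.basis_apply,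
          TwistedGroupAlgebra.basisVec_mul, map_smul, hf, hf, hf, smul_mul_smul_comm, hmul,
          smul_smul, smul_smul]
        congr 1
        ring
      exact LinearMap.congr_fun h1 (a ⊗ₜ b)
    star_map_one := by rw [hf1, hp.star_eq]
    exists_eq := fun c => by
      rw [hf1]
      have : p * c * p ∈ LinearMap.range f := by
        refine hp.compress_mem (fun h v hv => ?_) c
        obtain ⟨x, rfl⟩ := hsupp h ⟨v, hv⟩
        obtain ⟨d, rfl⟩ := (hu x).exists_eq_smul hp hv.mem hv.left hv.right
        refine Submodule.smul_mem _ _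
          ⟨(Real.sqrt (Fintype.card K) : ℂ) • TwistedGroupAlgebra.basisVec φ hφ ψ x, ?_⟩
        rw [map_smul, hf, smul_smul, mul_inv_cancel₀ hs, one_smul]
      exact this
    -- A unit basis vector goes to |K|^(-1/2) u x, and every homogeneous unitary has the norm of p.
    scale := (Fintype.card K : ℝ)⁻¹ * ‖p‖ ^ 2
    scale_pos := mul_pos (inv_pos.mpr (by exact_mod_cast Fintype.card_pos))
      (pow_pos (norm_pos_iff.mpr hp.ne_zero) 2)
    inner_map := fun a b => by
      have h1 : LinearMap.adjoint f ∘ₗ f =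
          (((Fintype.card K : ℝ)⁻¹ * ‖p‖ ^ 2 : ℝ) : ℂ) • LinearMap.id := by
        refine (TwistedGroupAlgebra.basis φ hφ ψ).ext fun y =>
          InnerProductSpace.ext_inner_left_basis (TwistedGroupAlgebra.basis φ hφ ψ) fun x => ?_
        rw [LinearMap.comp_apply, LinearMap.adjoint_inner_right, LinearMap.smul_apply,
          LinearMap.id_apply, inner_smul_right, TwistedGroupAlgebra.basis_apply,
          TwistedGroupAlgebra.basis_apply, TwistedGroupAlgebra.inner_basisVec, hf, hf,
          inner_smul_left, inner_smul_right]
        by_cases hxy : x = y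
        · subst hxy
          rw [(hu x).inner_self hp, inner_self_eq_norm_sq_to_K, if_pos rfl, mul_one, ← _root_.mul_assoc,
            map_inv₀, Complex.conj_ofReal, ← mul_inv, TwistedGroupAlgebra.sqrt_card_mul_self]
          push_cast
          rfl
        · rw [if_neg hxy, A.obj.inner_eq_zero_of_ne (fun h => hxy (hφ (by simpa using h)))
            (hu x).mem (hu y).mem]
          simp
      rw [← LinearMap.adjoint_inner_right, ← LinearMap.comp_apply, h1, LinearMap.smul_apply,
        inner_smul_right]
      rfl
    shift := s
    map_mem := fun h a ha => by
      by_cases hh : ∃ x, φ x = h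
      · obtain ⟨x, rfl⟩ := hh
        obtain ⟨c, rfl⟩ := TwistedGroupAlgebra.eq_smul_of_mem_deg φ hφ ψ ha
        rw [map_smul, hf]
        exact Submodule.smul_mem _ _ (Submodule.smul_mem _ _ (hu x).mem)
      · rw [TwistedGroupAlgebra.eq_zero_of_mem_deg φ hφ ψ (fun x hx => hh ⟨x, hx⟩) ha, map_zero]
        exact zero_mem _ }

theorem cornerEmbeddingOfUnitaries_p [Fintype G] {p : A.obj} (hp : A.IsMinimalProjection p)
    {K : Type} [Group K] [Fintype K] [DecidableEq K] (φ : K →* G) (hφ : Function.Injective φ)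
    (ψ : TwoCocycle K) (s : G) (u : K → A.obj)
    (hu : ∀ x, A.IsHomogeneousUnitary p (s * φ x * s⁻¹) (u x))
    (hmul : ∀ x y, u x * u y = ψ.toFun x y • u (x * y)) (hu1 : u 1 = p)
    (hsupp : ∀ h ∈ hp.support, ∃ x, h = s * φ x * s⁻¹) :
    (cornerEmbeddingOfUnitaries hp φ hφ ψ s u hu hmul hu1 hsupp).p = p := by
  change (TwistedGroupAlgebra.basis φ hφ ψ).constr ℂ
    (fun x => (Real.sqrt (Fintype.card K) : ℂ)⁻¹ • u x) 1 = p
  rw [TwistedGroupAlgebra.one_eq_smul_basisVec, map_smul, ← TwistedGroupAlgebra.basis_apply,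
    Module.Basis.constr_basis, smul_smul, mul_inv_cancel₀ TwistedGroupAlgebra.sqrt_card_ne_zero,
    one_smul, hu1]

/-- The two corners compared are A itself, cut out by 1, and the corner of p; simplicity of A makes
p full. -/
theorem IsMatrixAlgebra.morita_of_unitaries [Fintype G] (hA : A.IsMatrixAlgebra) {p : A.obj}
    (hp : A.IsMinimalProjection p)
    {K : Type} [Group K] [Fintype K] [DecidableEq K] (φ : K →* G) (hφ : Function.Injective φ)
    (ψ : TwoCocycle K) (s : G) (u : K → A.obj)
    (hu : ∀ x, A.IsHomogeneousUnitary p (s * φ x * s⁻¹) (u x))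
    (hmul : ∀ x y, u x * u y = ψ.toFun x y • u (x * y)) (hu1 : u 1 = p)
    (hsupp : ∀ h ∈ hp.support, ∃ x, h = s * φ x * s⁻¹) :
    A.Morita (twistedGroupAlgebra φ hφ ψ) := by
  refine CornerEmbedding.morita (CornerEmbedding.refl A)
    (cornerEmbeddingOfUnitaries hp φ hφ ψ s u hu hmul hu1 hsupp) ?_ ?_
  · obtain ⟨ι, i, x, y, hxy⟩ := hA.exists_sum_eq_one hp.ne_zero
    refine ⟨ι, i, x, y, ?_⟩
    rw [cornerEmbeddingOfUnitaries_p]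
    change ∑ i, 1 * x i * p * y i * 1 = 1
    simpa using hxy
  · refine ⟨Unit, inferInstance, fun _ => 1, fun _ => 1, ?_⟩
    rw [cornerEmbeddingOfUnitaries_p]
    change ∑ _ : Unit, p * 1 * 1 * 1 * p = p
    simpa using hp.mul_self

theorem IsMatrixAlgebra.morita_trivialQSystem [Fintype G] (hA : A.IsMatrixAlgebra) {p : A.obj}
    (hp : A.IsMinimalProjection p) (hsupp : ∀ h ∈ hp.support, h = 1) :
    A.Morita (trivialQSystem G) := by
  have h1 : ∀ x : (⊥ : Subgroup G), (⊥ : Subgroup G).subtype x = 1 := fun x =>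
    Subgroup.mem_bot.mp x.2
  refine hA.morita_of_unitaries hp _ _ _ 1 (fun _ => p) (fun x => ?_) (fun x y => ?_) rfl
    fun h hh => ⟨1, by rw [h1, hsupp h hh]; simp⟩
  · rw [h1]
    simpa using IsHomogeneousUnitary.one hp
  · simp [trivialCocycle, hp.mul_self]

/-! ### Pairs of unitaries commuting up to a root of unity -/

section Pairs

variable {p U V : A.obj} {h k : G} {q : ℕ} {lam : ℂ}

theorem IsHomogeneousUnitary.pow_mul_pow (hp : A.IsMinimalProjection p)
    (hU : A.IsHomogeneousUnitary p h U) (m n : ℕ) : p * U ^ m * (p * U ^ n) = p * U ^ (m + n) := by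
  rw [← _root_.mul_assoc, (hU.pow hp m).right, _root_.mul_assoc, pow_add]

theorem IsHomogeneousUnitary.pow_mod (hp : A.IsMinimalProjection p)
    (hU : A.IsHomogeneousUnitary p h U) (hUq : p * U ^ q = p) (n : ℕ) :
    p * U ^ (n % q) = p * U ^ n := by
  have h1 : ∀ m, p * U ^ (q * m) = p := by
    intro m
    induction m with
    | zero => simp
    | succ m ih => rw [Nat.mul_succ, ← hU.pow_mul_pow hp, ih, hUq, hp.mul_self]
  conv_rhs => rw [← Nat.div_add_mod n q, ← hU.pow_mul_pow hp, h1, ← _root_.mul_assoc, hp.mul_self]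

theorem IsHomogeneousUnitary.mul_pow_comm (hV : A.IsHomogeneousUnitary p k V)
    (hVU : V * U = lam • (U * V)) (n : ℕ) : V * (p * U ^ n) = lam ^ n • (p * U ^ n * V) := by
  induction n with
  | zero => simp [hV.left, hV.right]
  | succ n ih =>
    have h1 : p * U ^ (n + 1) = p * U ^ n * U := by rw [pow_succ, _root_.mul_assoc]
    rw [h1, ← _root_.mul_assoc, ih, smul_mul_assoc, _root_.mul_assoc _ V U, hVU, mul_smul_comm,
      smul_smul, pow_succ, _root_.mul_assoc _ U V]

theorem IsHomogeneousUnitary.pow_mul_pow_comm (hp : A.IsMinimalProjection p)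
    (hU : A.IsHomogeneousUnitary p h U) (hV : A.IsHomogeneousUnitary p k V)
    (hVU : V * U = lam • (U * V)) (m n : ℕ) :
    p * V ^ m * (p * U ^ n) = lam ^ (m * n) • (p * U ^ n * (p * V ^ m)) := by
  induction m with
  | zero =>
    simp only [pow_zero, mul_one, zero_mul, one_smul]
    rw [(hU.pow hp n).left, (hU.pow hp n).right]
  | succ m ih =>
    have h1 : p * V ^ (m + 1) = p * V ^ m * V := by rw [pow_succ, _root_.mul_assoc]
    rw [h1, _root_.mul_assoc _ V, hV.mul_pow_comm hVU, mul_smul_comm,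
      ← _root_.mul_assoc _ _ V, ih, smul_mul_assoc, smul_smul, _root_.mul_assoc _ _ V, ← pow_add,
      Nat.succ_mul, Nat.add_comm]

/-- The q-th power has degree one, so it is a phase times p; a q-th root of the inverse phase
normalizes it. -/
theorem IsHomogeneousUnitary.exists_pow_eq (hp : A.IsMinimalProjection p)
    (hU : A.IsHomogeneousUnitary p h U) (hq : 0 < q) (hh : h ^ q = 1) :
    ∃ U', A.IsHomogeneousUnitary p h U' ∧ p * U' ^ q = p := by
  have h1 := hU.pow hp q
  rw [hh] at h1
  obtain ⟨c, hc, hcU⟩ := (IsHomogeneousUnitary.one hp).exists_norm_eq_one hp h1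
  obtain ⟨d, hd⟩ := IsAlgClosed.exists_pow_nat_eq (c⁻¹) hq
  have hc0 : c ≠ 0 := by
    rintro rfl
    simp at hc
  have hdn : ‖d‖ = 1 := by
    have := congrArg norm hd
    rw [norm_pow, norm_inv, hc, inv_one] at this
    exact (pow_eq_one_iff_of_nonneg (norm_nonneg d) hq.ne').mp this
  refine ⟨d • U, hU.smul hdn, ?_⟩
  rw [smul_pow, mul_smul_comm, hcU, smul_smul, hd, inv_mul_cancel₀ hc0, one_smul]

/-- VU and UV are unitaries of the same degree, so they differ by a scalar λ. Moving V past U ^ q,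
which is p in the corner, forces λ ^ q = 1. -/
theorem exists_commutation (hp : A.IsMinimalProjection p)
    (hU : A.IsHomogeneousUnitary p h U) (hV : A.IsHomogeneousUnitary p k V) (hhk : h * k = k * h)
    (hUq : p * U ^ q = p) : ∃ lam : ℂ, lam ^ q = 1 ∧ V * U = lam • (U * V) := by
  have hVU := hV.mul hU
  rw [← hhk] at hVU
  obtain ⟨lam, -, hlam⟩ := (hU.mul hV).exists_norm_eq_one hp hVU
  refine ⟨lam, ?_, hlam⟩
  have h1 := hV.mul_pow_comm hlam q
  rw [hUq, hV.left, hV.right] at h1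
  have h2 : (lam ^ q - 1) • V = 0 := by rw [sub_smul, one_smul, ← h1, sub_self]
  exact sub_eq_zero.mp ((smul_eq_zero.mp h2).resolve_right (hV.ne_zero hp))

theorem ofAdd_eq_pow_mul_pow {q : ℕ} [NeZero q] (x : Multiplicative (ZMod q × ZMod q)) :
    x = Multiplicative.ofAdd (1, 0) ^ x.toAdd.1.val *
      Multiplicative.ofAdd (0, 1) ^ x.toAdd.2.val := by
  refine Multiplicative.toAdd.injective (Prod.ext ?_ ?_) <;> simp [toAdd_pow]

theorem pair_unitary [NeZero q] (hp : A.IsMinimalProjection p)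
    (φ : Multiplicative (ZMod q × ZMod q) →* G) (s : G)
    (hU : A.IsHomogeneousUnitary p (s * φ (Multiplicative.ofAdd (1, 0)) * s⁻¹) U)
    (hV : A.IsHomogeneousUnitary p (s * φ (Multiplicative.ofAdd (0, 1)) * s⁻¹) V)
    (x : Multiplicative (ZMod q × ZMod q)) :
    A.IsHomogeneousUnitary p (s * φ x * s⁻¹)
      (p * U ^ x.toAdd.1.val * (p * V ^ x.toAdd.2.val)) := by
  have h1 := (hU.pow hp x.toAdd.1.val).mul (hV.pow hp x.toAdd.2.val)
  rw [conj_pow, conj_pow, conj_mul, ← map_pow φ, ← map_pow φ, ← _root_.map_mul φ,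
    ← ofAdd_eq_pow_mul_pow] at h1
  exact h1

/-- The unitaries U ^ x₁ V ^ x₂ form a projective representation: reordering V ^ x₂ U ^ y₁ produces
λ ^ (x₂ y₁), the bicharacter. -/
theorem IsMatrixAlgebra.morita_of_pair [Fintype G] [NeZero q] (hA : A.IsMatrixAlgebra)
    (hp : A.IsMinimalProjection p) (φ : Multiplicative (ZMod q × ZMod q) →* G)
    (hφ : Function.Injective φ) (s : G)
    (hU : A.IsHomogeneousUnitary p (s * φ (Multiplicative.ofAdd (1, 0)) * s⁻¹) U)
    (hV : A.IsHomogeneousUnitary p (s * φ (Multiplicative.ofAdd (0, 1)) * s⁻¹) V)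
    (hUq : p * U ^ q = p) (hVq : p * V ^ q = p) (hlam : lam ^ q = 1)
    (hVU : V * U = lam • (U * V)) (hsupp : ∀ h ∈ hp.support, ∃ x, h = s * φ x * s⁻¹) :
    A.Morita (twistedGroupAlgebra φ hφ (bicharacterCocycle q lam hlam)) := by
  refine hA.morita_of_unitaries hp φ hφ _ s _ (pair_unitary hp φ s hU hV) (fun x y => ?_) ?_ hsupp
  · rw [_root_.mul_assoc, ← _root_.mul_assoc (p * V ^ _), hU.pow_mul_pow_comm hp hV hVU,
      smul_mul_assoc, mul_smul_comm, _root_.mul_assoc (p * U ^ _) (p * V ^ _),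
      hV.pow_mul_pow hp, ← _root_.mul_assoc (p * U ^ _) (p * U ^ _), hU.pow_mul_pow hp, toAdd_mul, Prod.fst_add, Prod.snd_add, ZMod.val_add, ZMod.val_add,
      hU.pow_mod hp hUq, hV.pow_mod hp hVq]
    rfl
  · simp [hp.mul_self]

/-- A matrix algebra whose corner has support `ℤ_q × ℤ_q` is generated by a non-commuting pair. -/
theorem IsMatrixAlgebra.exists_pair [Fintype G] [NeZero q] [Fact (1 < q)] (hA : A.IsMatrixAlgebra)
    (hp : A.IsMinimalProjection p) (φ : Multiplicative (ZMod q × ZMod q) →* G)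
    (hφ : Function.Injective φ) (hmem : ∀ x, φ x ∈ hp.support)
    (hsupp : ∀ h ∈ hp.support, ∃ x, h = φ x) :
    ∃ (U V : A.obj) (lam : ℂ),
      A.IsHomogeneousUnitary p (φ (Multiplicative.ofAdd (1, 0))) U ∧
      A.IsHomogeneousUnitary p (φ (Multiplicative.ofAdd (0, 1))) V ∧
      p * U ^ q = p ∧ p * V ^ q = p ∧ lam ^ q = 1 ∧ lam ≠ 1 ∧ V * U = lam • (U * V) := by
  have hpow : ∀ x, φ x ^ q = 1 := by
    intro x
    rw [← map_pow]
    have : x ^ q = 1 := by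
      refine Multiplicative.toAdd.injective (Prod.ext ?_ ?_) <;> simp [toAdd_pow]
    rw [this, map_one]
  obtain ⟨U₀, hU₀⟩ := hmem (Multiplicative.ofAdd (1, 0))
  obtain ⟨V₀, hV₀⟩ := hmem (Multiplicative.ofAdd (0, 1))
  obtain ⟨U, hU, hUq⟩ := hU₀.exists_pow_eq hp (NeZero.pos q) (hpow _)
  obtain ⟨V, hV, hVq⟩ := hV₀.exists_pow_eq hp (NeZero.pos q) (hpow _)
  obtain ⟨lam, hlam, hVU⟩ := exists_commutation hp hU hV
    (by rw [← _root_.map_mul φ, ← _root_.map_mul φ, mul_comm]) hUq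
  refine ⟨U, V, lam, hU, hV, hUq, hVq, hlam, ?_, hVU⟩
  -- If λ were 1, U would commute with the whole corner and so be a multiple of p, against its
  -- nontrivial degree.
  rintro rfl
  rw [one_smul] at hVU
  have hne : φ (Multiplicative.ofAdd (1, 0)) ≠ 1 := by
    rw [Ne, map_eq_one_iff φ hφ, ofAdd_eq_one, Prod.mk_eq_zero]
    exact fun h => _root_.one_ne_zero h.1
  obtain ⟨c, hc⟩ := hA.exists_smul_of_corner hp.ne_zero hp.mul_self hU.left hU.right fun a => by
    have hmem : p * a * p ∈ LinearMap.ker (LinearMap.mulRight ℂ U - LinearMap.mulLeft ℂ U) := by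
      refine hp.compress_mem (fun k v hv => ?_) a
      obtain ⟨x, rfl⟩ := hsupp k ⟨v, hv⟩
      have h1 := pair_unitary hp φ 1 (by simpa using hU) (by simpa using hV) x
      rw [one_mul, inv_one, mul_one] at h1
      obtain ⟨d, rfl⟩ := h1.exists_eq_smul hp hv.mem hv.left hv.right
      refine Submodule.smul_mem _ _ (sub_eq_zero.mpr ?_)
      have hpU : Commute p U := hU.left.trans hU.right.symm
      have hVU' : Commute V U := hVU
      exact ((hpU.mul_left ((Commute.refl U).pow_left _)).mul_left
        (hpU.mul_left (hVU'.pow_left _))).eq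
    exact sub_eq_zero.mp hmem
  refine hU.ne_zero hp (A.obj.eq_zero_of_mem_of_mem hne hU.mem ?_)
  rw [hc]
  exact Submodule.smul_mem _ _ hp.mem

end Pairs

end QSystem

/-! ### The full centre as an invariant of phases -/

namespace QSystem

variable {G : Type} [Group G]

theorem Morita.hasCentralElement_iff [Fintype G] {A B : QSystem G} (h : A.Morita B) (k : G) :
    A.HasCentralElement k ↔ B.HasCentralElement k :=
  ⟨h.symm.hasCentralElement, h.hasCentralElement⟩

/-- Lifting the predicate to the quotient avoids any appeal to transitivity of Morita equivalence.
-/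
theorem hasCentralElement_iff_of_phase_eq [Fintype G] {A B : {A : QSystem G // A.IsMatrixAlgebra}}
    (h : (Quot.mk _ A : RepSPTPhase G) = Quot.mk _ B) (k : G) :
    A.1.HasCentralElement k ↔ B.1.HasCentralElement k := by
  have h1 := congrArg (Quot.lift (fun A : {A : QSystem G // A.IsMatrixAlgebra} =>
    A.1.HasCentralElement k) fun A B hAB => propext (hAB.hasCentralElement_iff k)) h
  exact iff_of_eq h1

theorem phase_eq_of_morita {A B : QSystem G} (hA : A.IsMatrixAlgebra) (hB : B.IsMatrixAlgebra)
    (h : A.Morita B) : (Quot.mk _ ⟨A, hA⟩ : RepSPTPhase G) = Quot.mk _ ⟨B, hB⟩ :=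
  Quot.sound h

end QSystem

open QSystem

/-! ### Classification for the dihedral group of order 8 -/

/-- Since (s r^i)(s r^j) = r^(j - i), reflections whose indices have different parity would produce
r or its inverse. Only one Klein four-group can then contain H, and the orders agree. -/
theorem subgroup_D8_cases (H : Subgroup D8) (hr : DihedralGroup.r 1 ∉ H) (hH : Nat.card H = 4) :
    (∀ h, h ∈ H ↔ ∃ x, h = kleinEmbedding 0 x) ∨ ∀ h, h ∈ H ↔ ∃ x, h = kleinEmbedding 1 x := by
  classical
  have key : ∀ k : ZMod 4, (∀ h, h ∈ H → ∃ x, h = kleinEmbedding k x) →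
      ∀ h, h ∈ H ↔ ∃ x, h = kleinEmbedding k x := by
    intro k hk
    have h1 : H ≤ (kleinEmbedding k).range := fun h hh => by
      obtain ⟨x, rfl⟩ := hk h hh
      exact ⟨x, rfl⟩
    have h2 : Nat.card (kleinEmbedding k).range = 4 := by
      rw [← Nat.card_congr (MonoidHom.ofInjective (kleinEmbedding_injective k)).toEquiv]
      simp
    have h3 := Subgroup.eq_of_le_of_card_ge h1 (by rw [h2, hH])
    intro h
    rw [h3, MonoidHom.mem_range]
    simp only [eq_comm]
  have hr3 : DihedralGroup.r 3 ∉ H := fun h => hr (by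
    have := inv_mem h
    rwa [show (DihedralGroup.r 3 : D8)⁻¹ = DihedralGroup.r 1 by decide] at this)
  have hprod : ∀ i j : ZMod 4, DihedralGroup.sr i ∈ H → DihedralGroup.sr j ∈ H →
      DihedralGroup.r (j - i) ∈ H := by
    intro i j hi hj
    have := mul_mem hi hj
    rwa [DihedralGroup.sr_mul_sr] at this
  by_cases h0 : DihedralGroup.sr 0 ∈ H ∨ DihedralGroup.sr 2 ∈ H
  · left
    refine key 0 fun h hh => ?_
    have h1 : DihedralGroup.sr 1 ∉ H := fun h1 => by
      rcases h0 with h0 | h0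
      · exact hr (hprod 0 1 h0 h1)
      · exact hr (hprod 1 2 h1 h0)
    have h3 : DihedralGroup.sr 3 ∉ H := fun h1 => by
      rcases h0 with h0 | h0
      · exact hr3 (hprod 0 3 h0 h1)
      · exact hr (hprod 2 3 h0 h1)
    have h4 : h ≠ DihedralGroup.r 1 ∧ h ≠ DihedralGroup.r 3 ∧ h ≠ DihedralGroup.sr 1 ∧
        h ≠ DihedralGroup.sr 3 :=
      ⟨fun e => hr (e ▸ hh), fun e => hr3 (e ▸ hh), fun e => h1 (e ▸ hh), fun e => h3 (e ▸ hh)⟩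
    revert h4
    clear hh
    revert h
    decide
  · right
    push Not at h0
    refine key 1 fun h hh => ?_
    have h4 : h ≠ DihedralGroup.r 1 ∧ h ≠ DihedralGroup.r 3 ∧ h ≠ DihedralGroup.sr 0 ∧
        h ≠ DihedralGroup.sr 2 :=
      ⟨fun e => hr (e ▸ hh), fun e => hr3 (e ▸ hh), fun e => h0.1 (e ▸ hh), fun e => h0.2 (e ▸ hh)⟩
    revert h4
    clear hh
    revert h
    decide

/-- The order n² of the support divides 8, so n is 1 or 2. For n = 2 the cyclic group generated by r
is excluded, and on a Klein four-group the scalar is a square root of 1 other than 1. -/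
theorem morita_cases_D8 (A : QSystem D8) (hA : A.IsMatrixAlgebra) :
    A.Morita (trivialQSystem D8) ∨ A.Morita (kleinQSystem 0) ∨ A.Morita (kleinQSystem 1) := by
  obtain ⟨p, hp⟩ := exists_isMinimalProjection hA.one_ne_zero
  obtain ⟨n, hn⟩ := hA.exists_card_support hp
  have hdvd := Subgroup.card_subgroup_dvd_card hp.support
  rw [hn, DihedralGroup.nat_card] at hdvd
  have hle : n ≤ 2 := by
    by_contra! h
    have := Nat.le_of_dvd (by norm_num) hdvd
    nlinarith
  have hklein : ∀ k, (∀ h, h ∈ hp.support ↔ ∃ x, h = kleinEmbedding k x) →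
      A.Morita (kleinQSystem k) := by
    intro k hk
    have : Fact (1 < 2) := ⟨one_lt_two⟩
    obtain ⟨U, V, lam, hU, hV, hU2, hV2, hlam, hlam1, hVU⟩ := hA.exists_pair hp (kleinEmbedding k)
      (kleinEmbedding_injective k) (fun x => (hk _).mpr ⟨x, rfl⟩) fun h hh => (hk h).mp hh
    obtain rfl : lam = -1 := (mul_self_eq_one_iff.mp (by rw [← sq, hlam])).resolve_left hlam1
    exact hA.morita_of_pair hp (kleinEmbedding k) (kleinEmbedding_injective k) 1 (by simpa using hU)
      (by simpa using hV) hU2 hV2 hlam hVU (by simpa using fun h hh => (hk h).mp hh)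
  interval_cases n
  · exact absurd hn Nat.card_pos.ne'
  · left
    refine hA.morita_trivialQSystem hp fun h hh => ?_
    rw [Subgroup.card_eq_one.mp hn] at hh
    exact hh
  · right
    have hr : DihedralGroup.r 1 ∉ hp.support := by
      intro hr
      have h1 : hp.support = Subgroup.zpowers (DihedralGroup.r 1) := by
        symm
        refine Subgroup.eq_of_le_of_card_ge ((Subgroup.zpowers_le).mpr hr) ?_
        rw [Nat.card_zpowers, DihedralGroup.orderOf_r_one, hn]
      have h2 := hA.eq_one_of_support_le hp hr fun k hk => by
        rw [h1, ← mem_powers_iff_mem_zpowers] at hk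
        obtain ⟨n, hn⟩ := hk
        exact ⟨n, hn.symm⟩
      exact absurd h2 (by decide)
    rcases subgroup_D8_cases hp.support hr hn with h | h
    · exact Or.inl (hklein 0 h)
    · exact Or.inr (hklein 1 h)

/-! ### Classification for S3 × Z3 -/

/-- The S3-component of an element of H is killed by the exponents 9 and 6, hence by 3, so it is a
power of the 3-cycle; comparing orders gives equality. -/
theorem mem_subgroup_S3Z3 (H : Subgroup S3Z3) (hH : Nat.card H = 9) (h : S3Z3) :
    h ∈ H ↔ ∃ x, h = z3z3Embedding x := by
  have h1 : H ≤ z3z3Embedding.range := fun h hh => by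
    have h2 : (⟨h, hh⟩ : H) ^ 9 = 1 := by rw [← hH, pow_card_eq_one']
    have h3 : h ^ 9 = 1 := congrArg Subtype.val h2
    have h4 : ∀ σ : Equiv.Perm (Fin 3), σ ^ 3 = 1 → ∃ i : ZMod 3, finRotate 3 ^ i.val = σ := by
      decide
    have h5 : h.1 ^ 6 = 1 := by
      have := pow_card_eq_one' (x := h.1)
      rwa [Nat.card_perm, Nat.card_fin] at this
    have h6 : h.1 ^ 6 * h.1 ^ 3 = 1 := (pow_add h.1 6 3).symm.trans (congrArg Prod.fst h3)
    rw [h5, one_mul] at h6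
    obtain ⟨i, hi⟩ := h4 h.1 h6
    exact ⟨Multiplicative.ofAdd (i, h.2.toAdd), Prod.ext hi rfl⟩
  have h2 : Nat.card z3z3Embedding.range = 9 := by
    rw [← Nat.card_congr (MonoidHom.ofInjective z3z3Embedding_injective).toEquiv]
    simp
  rw [Subgroup.eq_of_le_of_card_ge h1 (by rw [h2, hH]), MonoidHom.mem_range]
  simp only [eq_comm]

theorem isPrimitiveRoot_exp_two_pi_div_three :
    IsPrimitiveRoot (Complex.exp (2 * Real.pi * Complex.I / 3)) 3 := by
  simpa using Complex.isPrimitiveRoot_exp 3 (by norm_num)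

theorem isPrimitiveRoot_exp_neg_two_pi_div_three :
    IsPrimitiveRoot (Complex.exp (-(2 * Real.pi * Complex.I / 3))) 3 := by
  rw [Complex.exp_neg]
  exact isPrimitiveRoot_exp_two_pi_div_three.inv

theorem morita_cases_S3Z3 (A : QSystem S3Z3) (hA : A.IsMatrixAlgebra) :
    A.Morita (trivialQSystem S3Z3) ∨ A.Morita z3z3QSystemPlus := by
  obtain ⟨p, hp⟩ := exists_isMinimalProjection hA.one_ne_zero
  obtain ⟨n, hn⟩ := hA.exists_card_support hp
  have hdvd := Subgroup.card_subgroup_dvd_card hp.support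
  have hcard : Nat.card S3Z3 = 18 := by
    rw [Nat.card_prod, Nat.card_perm]
    simp [Nat.factorial]
  rw [hn, hcard] at hdvd
  have hle : n ≤ 4 := by
    by_contra! h
    have := Nat.le_of_dvd (by norm_num) hdvd
    nlinarith
  interval_cases n
  · exact absurd hn Nat.card_pos.ne'
  · left
    refine hA.morita_trivialQSystem hp fun h hh => ?_
    rw [Subgroup.card_eq_one.mp hn] at hh
    exact hh
  · exact absurd hdvd (by norm_num)
  · right
    have hmem := mem_subgroup_S3Z3 hp.support hn
    have : Fact (1 < 3) := ⟨by norm_num⟩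
    obtain ⟨U, V, lam, hU, hV, hU3, hV3, hlam, hlam1, hVU⟩ := hA.exists_pair hp z3z3Embedding
      z3z3Embedding_injective (fun x => (hmem _).mpr ⟨x, rfl⟩) fun h hh => (hmem h).mp hh
    have hprim := isPrimitiveRoot_exp_two_pi_div_three
    obtain ⟨i, hi, rfl⟩ := hprim.eq_pow_of_pow_eq_one hlam
    interval_cases i
    · exact absurd (pow_zero _) hlam1
    · rw [pow_one] at hVU
      exact hA.morita_of_pair hp z3z3Embedding z3z3Embedding_injective 1 (by simpa using hU)
        (by simpa using hV) hU3 hV3 _ hVU (by simpa using fun h hh => (hmem h).mp hh)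
    -- Here λ is the square of the chosen root ω. Replacing U by U², its inverse in the corner,
    -- turns λ into ω⁴ = ω; the inverted 3-cycle degree is absorbed by conjugation with a
    -- transposition, used as the shift.
    · have hU' := hU.pow hp 2
      have hVU' := hV.mul_pow_comm hVU 2
      rw [← pow_mul, show 2 * 2 = 3 + 1 from rfl, pow_succ (Complex.exp _), hprim.pow_eq_one, one_mul] at hVU'
      have h1 : ∀ x, ∃ y, z3z3Embedding x = (Equiv.swap 0 1, 1) * z3z3Embedding y *
          ((Equiv.swap 0 1, 1) : S3Z3)⁻¹ := by decide
      refine hA.morita_of_pair hp z3z3Embedding z3z3Embedding_injective (Equiv.swap 0 1, 1)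
        (U := p * U ^ 2) (V := V) ?_ ?_ ?_ hV3 _ hVU' fun h hh => ?_
      · convert hU' using 1
        decide
      · convert hV using 1
        decide
      · have h2 : (p * U ^ 2) ^ 3 = p * U ^ 6 := by
          rw [pow_succ, pow_two, hU.pow_mul_pow hp, hU.pow_mul_pow hp]
        rw [h2, ← _root_.mul_assoc, hp.mul_self, ← hU.pow_mod hp hU3]
        simp
      · obtain ⟨x, rfl⟩ := (hmem h).mp hh
        exact h1 x
  · exact absurd hdvd (by norm_num)

/-! ### Separating the classes and counting phases -/

theorem hasCentralElement_kleinQSystem (k : ZMod 4) :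
    (kleinQSystem k).HasCentralElement (DihedralGroup.sr k) := by
  have : Fact (1 < 2) := ⟨one_lt_two⟩
  have h1 : kleinEmbedding k (Multiplicative.ofAdd (0, 1)) = DihedralGroup.sr k := by
    revert k
    decide
  have h := hasCentralElement_bicharacter (p := 2) (lam := -1) (by norm_num) (kleinEmbedding k)
    (kleinEmbedding_injective k)
  rwa [h1] at h

/-- The conjugates of s r are s r and s r³, neither of which lies in the subgroup generated by r²
and s. -/
theorem not_hasCentralElement_kleinQSystem_zero :
    ¬ (kleinQSystem 0).HasCentralElement (DihedralGroup.sr 1) :=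
  TwistedGroupAlgebra.not_hasCentralElement _ _ _ (by decide)

theorem hasCentralElement_z3z3QSystem (lam : ℂ) (hlam : lam ^ 3 = 1) :
    (z3z3QSystem lam hlam).HasCentralElement (z3z3Embedding (Multiplicative.ofAdd (0, 1))) := by
  have : Fact (1 < 3) := ⟨by norm_num⟩
  exact hasCentralElement_bicharacter hlam z3z3Embedding z3z3Embedding_injective

theorem not_hasCentralElement_trivialQSystem_S3Z3 : ¬ (trivialQSystem S3Z3).HasCentralElement
    (z3z3Embedding (Multiplicative.ofAdd (0, 1))) :=
  not_hasCentralElement_trivialQSystem (by decide)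

theorem not_hasCentralElement_trivialQSystem_D8 (k : ZMod 4) :
    ¬ (trivialQSystem D8).HasCentralElement (DihedralGroup.sr k) :=
  not_hasCentralElement_trivialQSystem (by revert k; decide)

theorem isMatrixAlgebra_kleinQSystem (k : ZMod 4) : (kleinQSystem k).IsMatrixAlgebra :=
  isMatrixAlgebra_bicharacter (IsPrimitiveRoot.neg_one 0 (by norm_num)) (kleinEmbedding k)
    (kleinEmbedding_injective k)

theorem isMatrixAlgebra_z3z3QSystemPlus : z3z3QSystemPlus.IsMatrixAlgebra :=
  isMatrixAlgebra_bicharacter isPrimitiveRoot_exp_two_pi_div_three z3z3Embedding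
    z3z3Embedding_injective

theorem isMatrixAlgebra_z3z3QSystemMinus : z3z3QSystemMinus.IsMatrixAlgebra :=
  isMatrixAlgebra_bicharacter isPrimitiveRoot_exp_neg_two_pi_div_three z3z3Embedding
    z3z3Embedding_injective

/-- By the classification the minus system is equivalent to the trivial or to the plus system; its
full centre in a nontrivial degree excludes the former. -/
theorem morita_z3z3QSystemPlus_z3z3QSystemMinus : z3z3QSystemPlus.Morita z3z3QSystemMinus := by
  rcases morita_cases_S3Z3 _ isMatrixAlgebra_z3z3QSystemMinus with h | h
  · exact absurd ((h.hasCentralElement_iff _).mp (hasCentralElement_z3z3QSystem _ _))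
      not_hasCentralElement_trivialQSystem_S3Z3
  · exact h.symm

theorem card_repSPTPhase_D8 : Nat.card (RepSPTPhase D8) = 3 := by
  let f : Fin 3 → RepSPTPhase D8 := ![Quot.mk _ ⟨_, isMatrixAlgebra_trivialQSystem D8⟩,
    Quot.mk _ ⟨_, isMatrixAlgebra_kleinQSystem 0⟩, Quot.mk _ ⟨_, isMatrixAlgebra_kleinQSystem 1⟩]
  have h01 : f 0 ≠ f 1 := fun h => not_hasCentralElement_trivialQSystem_D8 0
    ((hasCentralElement_iff_of_phase_eq h _).mpr (hasCentralElement_kleinQSystem 0))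
  have h02 : f 0 ≠ f 2 := fun h => not_hasCentralElement_trivialQSystem_D8 1
    ((hasCentralElement_iff_of_phase_eq h _).mpr (hasCentralElement_kleinQSystem 1))
  have h12 : f 1 ≠ f 2 := fun h => not_hasCentralElement_kleinQSystem_zero
    ((hasCentralElement_iff_of_phase_eq h _).mpr (hasCentralElement_kleinQSystem 1))
  have hf : Function.Bijective f := by
    constructor
    · intro i j hij
      fin_cases i <;> fin_cases j
      · rfl
      · exact absurd hij h01
      · exact absurd hij h02
      · exact absurd hij.symm h01
      · rfl
      · exact absurd hij h12
      · exact absurd hij.symm h02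
      · exact absurd hij.symm h12
      · rfl
    · rintro ⟨A, hA⟩
      rcases morita_cases_D8 A hA with h | h | h
      · exact ⟨0, (phase_eq_of_morita hA _ h).symm⟩
      · exact ⟨1, (phase_eq_of_morita hA _ h).symm⟩
      · exact ⟨2, (phase_eq_of_morita hA _ h).symm⟩
  rw [← Nat.card_eq_of_bijective f hf, Nat.card_fin]

theorem card_repSPTPhase_S3Z3 : Nat.card (RepSPTPhase S3Z3) = 2 := by
  let f : Fin 2 → RepSPTPhase S3Z3 := ![Quot.mk _ ⟨_, isMatrixAlgebra_trivialQSystem S3Z3⟩,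
    Quot.mk _ ⟨_, isMatrixAlgebra_z3z3QSystemPlus⟩]
  have h01 : f 0 ≠ f 1 := fun h => not_hasCentralElement_trivialQSystem_S3Z3
    ((hasCentralElement_iff_of_phase_eq h _).mpr (hasCentralElement_z3z3QSystem _ _))
  have hf : Function.Bijective f := by
    constructor
    · intro i j hij
      fin_cases i <;> fin_cases j
      · rfl
      · exact absurd hij h01
      · exact absurd hij.symm h01
      · rfl
    · rintro ⟨A, hA⟩
      rcases morita_cases_S3Z3 A hA with h | h
      · exact ⟨0, (phase_eq_of_morita hA _ h).symm⟩
      · exact ⟨1, (phase_eq_of_morita hA _ h).symm⟩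
  rw [← Nat.card_eq_of_bijective f hf, Nat.card_fin]

theorem mainTheorem10 :
    ((trivialQSystem D8).IsMatrixAlgebra ∧ (kleinQSystem 0).IsMatrixAlgebra ∧
      (kleinQSystem 1).IsMatrixAlgebra ∧
      ¬ (trivialQSystem D8).Morita (kleinQSystem 0) ∧
      ¬ (trivialQSystem D8).Morita (kleinQSystem 1) ∧
      ¬ (kleinQSystem 0).Morita (kleinQSystem 1) ∧
      (∀ A : QSystem D8, A.IsMatrixAlgebra →
        A.Morita (trivialQSystem D8) ∨ A.Morita (kleinQSystem 0) ∨ A.Morita (kleinQSystem 1)) ∧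
      Nat.card (RepSPTPhase D8) = 3) ∧
    ((trivialQSystem S3Z3).IsMatrixAlgebra ∧ z3z3QSystemPlus.IsMatrixAlgebra ∧
      z3z3QSystemMinus.IsMatrixAlgebra ∧
      z3z3QSystemPlus.Morita z3z3QSystemMinus ∧
      ¬ (trivialQSystem S3Z3).Morita z3z3QSystemPlus ∧
      (∀ A : QSystem S3Z3, A.IsMatrixAlgebra →
        A.Morita (trivialQSystem S3Z3) ∨ A.Morita z3z3QSystemPlus) ∧
      Nat.card (RepSPTPhase S3Z3) = 2) := by
  refine ⟨⟨isMatrixAlgebra_trivialQSystem D8, isMatrixAlgebra_kleinQSystem 0,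
    isMatrixAlgebra_kleinQSystem 1, fun h => ?_, fun h => ?_, fun h => ?_, morita_cases_D8,
    card_repSPTPhase_D8⟩, isMatrixAlgebra_trivialQSystem S3Z3, isMatrixAlgebra_z3z3QSystemPlus,
    isMatrixAlgebra_z3z3QSystemMinus, morita_z3z3QSystemPlus_z3z3QSystemMinus, fun h => ?_,
    morita_cases_S3Z3, card_repSPTPhase_S3Z3⟩
  · exact not_hasCentralElement_trivialQSystem_D8 0
      ((h.hasCentralElement_iff _).mpr (hasCentralElement_kleinQSystem 0))
  · exact not_hasCentralElement_trivialQSystem_D8 1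
      ((h.hasCentralElement_iff _).mpr (hasCentralElement_kleinQSystem 1))
  · exact not_hasCentralElement_kleinQSystem_zero
      ((h.hasCentralElement_iff _).mpr (hasCentralElement_kleinQSystem 1))
  · exact not_hasCentralElement_trivialQSystem_S3Z3
      ((h.hasCentralElement_iff _).mpr (hasCentralElement_z3z3QSystem _ _))
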